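/- **Setting.** Let $G=([n],E)$ be a $k$-partite design: $[n]=V_1\sqcup\dots\sqcup V_k$, and every edge of $E$ points from a layer to a strictly later one. Let $\Sigma$ be a finite alphabet and let $P(x)=\prod_{i}P(x_i\mid \mathrm{pa}_i)$ be the distribution on $\Sigma^n$ given by conditional distributions $P(x_i\mid\mathrm{pa}_i)$ along $G$. For a set of edges $S\subseteq E$, write $\mathrm{Pa}_i^S$ for the parents of $i$ joined to $i$ by an edge of $S$ and $\mathrm{Pa}_i^{\bar S}$ for the other parents. The post-intervention distribution is $$P_S(x)=\prod_i\ \sum_{\mathrm{pa}_i^{S}}P\big(x_i\mid \mathrm{pa}_i^{\bar S},\mathrm{pa}_i^{S}\big)\prod_{j\in \mathrm{Pa}_i^S}P(X_j=\mathrm{pa}^S_{i,j}).$$ The causal influence of $S$ is $C(S)=D_{H^2}(P\,\|\,P_S)$, where $D_{H^2}(p\,\|\,q)=\sum_x q(x)\,\phi(p(x)/q(x))$ with $\phi(t)=\tfrac12(\sqrt t-1)^2$. Let $\omega$ be the number of variables in the last layer $V_k$ that are heads of edges of $S$, let $d$ be the maximum number of parents of a variable in $V_k$, let $0<\varepsilon\le1$,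 and put $$B=\frac{|\Sigma|^{\frac34(d+1)}\,\omega}{\varepsilon^2}.$$ **Algorithm.** Draw $m$ independent samples from $P$ and $m$ from $P_S$. For each of the $\omega$ outcome variables $X_i\in V_k$ that are heads of edges of $S$, run on the coordinates $X_i\cup\mathrm{Pa}_i$ of these samples a (randomized) squared Hellinger test of $H_0$: $P$ and $P_S$ have the same marginal on $X_i\cup \mathrm{Pa}_i$, against $H_1$: the squared Hellinger distance $D_{H^2}$ of these two marginals is at least $\varepsilon^2/(2\omega)$. Return failure if $H_0$ is accepted in all $\omega$ tests, and success otherwise. The tests are executions of a program of a uniform-cost random access machine. The program reads single coordinates of samples and fair coins, one step each. It starts with a bounded number of integers that depend only on $|\Sigma|$, $d+1$, the threshold $\varepsilon^2/(2\omega)$ and the error probability $1/(3\omega)$. **Theorem.** There are one such test program, with numbers of samples and coins that depend only on these four parameters, and constants $K,c$ such that the following holds for all $n,k,\Sigma,G,P$, all $S\subseteq E$ and all $0<\varepsilon\le1$. 1. (Samples) $m\le K\,B\,(1+\log B)^c$, that is, $m=\tilde O\big(|\Sigma|^{\frac34(d+1)}\omega/\varepsilon^2\big)$. (Here $B=0$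 means $m=0$.) 2. (Time) For all values of the samples and coins, the running time is at most $K\,B\,(1+\log B)^c$. It consists of the $2m$ draws, the maximum number of steps of the $\omega$ mutually independent tests, which run in parallel on the common samples, and $\omega$ steps for collecting their answers. 3. (Hellinger tests) Each of the $\omega$ tests rejects with probability at most $1/(3\omega)$ if its $H_0$ holds, and accepts with probability at most $1/(3\omega)$ if its $H_1$ holds. 4. (Correctness) If $C(S)=0$, the algorithm returns failure with probability at least $2/3$. If all edges of $S$ point into $V_k$ and $C(S)\ge\varepsilon$, it returns success with probability at least $2/3$. -/

import Mathlib

open scoped BigOperators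

noncomputable section

/-! ## Layered causal models and edge interventions -/

/-- A `k`-partite design on the variables `0, …, n-1`: every variable lies in one of `k` layers and
every edge `(u, v)` points from a strictly earlier layer to a strictly later one (so that the graph
is acyclic and every layer is an antichain). -/
structure KPartiteDesign (n k : ℕ) where
  layer : Fin n → Fin k
  edges : Finset (Fin n × Fin n)
  layer_lt : ∀ e ∈ edges, layer e.1 < layer e.2

namespace KPartiteDesign

variable {n k : ℕ} (G : KPartiteDesign n k)

/-- `Pa_v`. -/
def parents (v : Fin n) : Finset (Fin n) := Finset.univ.filter fun u => (u, v) ∈ G.edges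

/-- `{X_v} ∪ Pa_v`. -/
def family (v : Fin n) : Finset (Fin n) := insert v (G.parents v)

/-- Membership in the last layer `V_k`, the layer of the outcome variables. -/
def IsOutcome (v : Fin n) : Prop := (G.layer v : ℕ) + 1 = k

instance (v : Fin n) : Decidable (G.IsOutcome v) :=
  inferInstanceAs (Decidable ((G.layer v : ℕ) + 1 = k))

/-- The outcome variables that are targets of an edge in `S`. -/
def outcomeTargets (S : Finset (Fin n × Fin n)) : Finset (Fin n) :=
  Finset.univ.filter fun v => G.IsOutcome v ∧ ∃ u, (u, v) ∈ S

/-- The number `ω` of outcome variables that are targets of an edge in `S`. -/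
def omega (S : Finset (Fin n × Fin n)) : ℕ := (G.outcomeTargets S).card

/-- The maximal number `d` of parents of an outcome variable. -/
def maxOutcomeInDegree : ℕ :=
  (Finset.univ.filter fun v => G.IsOutcome v).sup fun v => (G.parents v).card

end KPartiteDesign

/-- A causal Bayesian network on the design `G` over the alphabet `Fin q`: for every variable `v`
and every assignment of its parents, a probability vector `P(x_v | pa_v)`. -/
structure CausalModel {n k : ℕ} (G : KPartiteDesign n k) (q : ℕ) where
  cpd : (v : Fin n) → (G.parents v → Fin q) → stdSimplex ℝ (Fin q)

namespace CausalModel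

variable {n k q : ℕ} {G : KPartiteDesign n k} (M : CausalModel G q)

/-- The observational distribution `P(x) = ∏_v P(x_v | pa_v)`. -/
def P (x : Fin n → Fin q) : ℝ :=
  ∏ v, (M.cpd v fun u => x u).1 (x v)

/-- The marginal probability `P(X_u = a)`. -/
def marginal (u : Fin n) (a : Fin q) : ℝ :=
  ∑ x : Fin n → Fin q, if x u = a then M.P x else 0

/-- The distribution after intervention on the edges `S`,
`P_S(x) = ∏_v ∑_{pa'} P(x_v | pa_v outside S, pa') ∏_{u ∈ Pa_v^S} P(X_u = pa'_u)`:
every parent that is attached to `v` by an edge of `S` is replaced by an independent copy drawn from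
its observational marginal. -/
def PS (S : Finset (Fin n × Fin n)) (x : Fin n → Fin q) : ℝ :=
  ∏ v, ∑ y : {u : Fin n // (u, v) ∈ S} → Fin q,
    (M.cpd v fun u => if h : ((u : Fin n), v) ∈ S then y ⟨u, h⟩ else x u).1 (x v) *
      ∏ u : {u : Fin n // (u, v) ∈ S}, M.marginal u.1 (y u)

end CausalModel

/-- The `φ`-divergence `D_φ(p ‖ q) = ∑ q φ(p / q)` on a finite set, with `0 φ(0 / 0) = 0`.
It is used only for pairs `p, q` such that `q x = 0` implies `p x = 0`. -/
def phiDiv {X : Type*} [Fintype X] (φ : ℝ → ℝ) (p q : X → ℝ) : ℝ :=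
  ∑ x, q x * φ (p x / q x)

/-- `φ(t) = (√t - 1)² / 2`, whose `φ`-divergence is the squared Hellinger distance. -/
def hellingerPhi (t : ℝ) : ℝ := 1 / 2 * (√t - 1) ^ 2

/-- The causal influence `D_φ(P ‖ P_S)` of the edge set `S`. (If `P_S(x) = 0` then `P(x) = 0`.) -/
def CausalModel.causalInfluence {n k q : ℕ} {G : KPartiteDesign n k} (M : CausalModel G q)
    (φ : ℝ → ℝ) (S : Finset (Fin n × Fin n)) : ℝ :=
  phiDiv φ M.P (M.PS S)

/-- The marginal on the variables in `W` of a distribution of all the variables. -/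
def marginalOn {n q : ℕ} (W : Finset (Fin n)) (p : (Fin n → Fin q) → ℝ) (z : W → Fin q) : ℝ :=
  ∑ x : Fin n → Fin q, if (fun u : W => x u) = z then p x else 0

/-! ## A random access machine with sample access and coins -/

/-- Programs of a uniform-cost random access machine with integer registers and integer memory
cells. Arguments of type `ℕ` are names of registers. -/
inductive Cmd where
  /-- `dst := c` -/
  | const (dst : ℕ) (c : ℤ)
  /-- `dst := a + b` -/
  | add (dst a b : ℕ)
  /-- `dst := a - b` -/
  | sub (dst a b : ℕ)
  /-- `dst := a * b` -/
  | mul (dst a b : ℕ)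
  /-- `dst := a / b` (integer division, and `0` for `b = 0`) -/
  | div (dst a b : ℕ)
  /-- `dst := memory[a]` -/
  | load (dst a : ℕ)
  /-- `memory[a] := b` -/
  | store (a b : ℕ)
  /-- `dst := ` coordinate number `i` of sample number `t` from the source `src` -/
  | sample (src : Bool) (dst t i : ℕ)
  /-- `dst := ` coin number `t` -/
  | coin (dst t : ℕ)
  /-- first `p`, then `p'` -/
  | seq (p p' : Cmd)
  /-- `p` if `a > 0`, otherwise `p'` -/
  | ifPos (a : ℕ) (p p' : Cmd)
  /-- `p`, as many times as the value of `a` on entry -/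
  | loop (a : ℕ) (p : Cmd)

/-- The read-only input of a program. -/
structure Cmd.Input where
  /-- `sample src t i` is coordinate `i` of the `t`-th sample from the source `src`. -/
  sample : Bool → ℕ → ℕ → ℤ
  /-- Random bits. -/
  coin : ℕ → Bool

/-- The state of the machine, together with the number of steps made so far. -/
structure Cmd.State where
  reg : ℕ → ℤ
  mem : ℤ → ℤ
  steps : ℕ

/-- Write a register, in one step. -/
def Cmd.State.set (s : Cmd.State) (dst : ℕ) (a : ℤ) : Cmd.State :=
  { s with reg := Function.update s.reg dst a, steps := s.steps + 1 }

/-- One step without any other effect. -/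
def Cmd.State.tick (s : Cmd.State) : Cmd.State := { s with steps := s.steps + 1 }

/-- Execution. Every elementary instruction, every test of a conditional, every entry to a loop and
every round of a loop costs one step. -/
def Cmd.exec (inp : Cmd.Input) : Cmd → Cmd.State → Cmd.State
  | .const dst c, s => s.set dst c
  | .add dst a b, s => s.set dst (s.reg a + s.reg b)
  | .sub dst a b, s => s.set dst (s.reg a - s.reg b)
  | .mul dst a b, s => s.set dst (s.reg a * s.reg b)
  | .div dst a b, s => s.set dst (s.reg a / s.reg b)
  | .load dst a, s => s.set dst (s.mem (s.reg a))
  | .store a b, s =>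
      { s with mem := Function.update s.mem (s.reg a) (s.reg b), steps := s.steps + 1 }
  | .sample src dst t i, s => s.set dst (inp.sample src (s.reg t).toNat (s.reg i).toNat)
  | .coin dst t, s => s.set dst (if inp.coin (s.reg t).toNat then 1 else 0)
  | .seq p p', s => Cmd.exec inp p' (Cmd.exec inp p s)
  | .ifPos a p p', s => if 0 < s.reg a then Cmd.exec inp p s.tick else Cmd.exec inp p' s.tick
  | .loop a p, s => (fun s' => Cmd.exec inp p s'.tick)^[(s.reg a).toNat] s.tick

/-- A two-sample test procedure. One fixed program serves all parameters: the alphabet size `q`, the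
number `r` of coordinates of a sample, the distance threshold `τ` and the error probability `δ`.
The parameters determine the number of samples from each of the two sources, the number of coins,
and the numbers that stand in the first `arity` registers at the start. -/
structure TwoSampleTest where
  prog : Cmd
  samples : (q r : ℕ) → (τ δ : ℝ) → ℕ
  coins : (q r : ℕ) → (τ δ : ℝ) → ℕ
  arity : ℕ
  args : (q r : ℕ) → (τ δ : ℝ) → Fin arity → ℤ

namespace TwoSampleTest

variable (T : TwoSampleTest)

/-- The final state of the test on the input `inp`; memory and the other registers start at `0`. -/
def final (q r : ℕ) (τ δ : ℝ) (inp : Cmd.Input) : Cmd.State :=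
  T.prog.exec inp
    { reg := fun i => if h : i < T.arity then T.args q r τ δ ⟨i, h⟩ else 0
      mem := fun _ => 0
      steps := 0 }

/-- The test rejects the null hypothesis if register `0` is positive at the end. -/
def rejects (q r : ℕ) (τ δ : ℝ) (inp : Cmd.Input) : Bool :=
  decide (0 < (T.final q r τ δ inp).reg 0)

/-- The number of steps of the test. -/
def steps (q r : ℕ) (τ δ : ℝ) (inp : Cmd.Input) : ℕ := (T.final q r τ δ inp).steps

end TwoSampleTest

/-! ## The testing algorithm -/

/-- What the test at the variable `v` can see: of each of the `m` samples `x` (source `true`) and `y`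
(source `false`) the variables in the family of `v`, in increasing order, and `c` coins. Out of
range there are only zeros. -/
def familyInput {n k q m c : ℕ} (G : KPartiteDesign n k) (v : Fin n)
    (x y : Fin m → Fin n → Fin q) (ρ : Fin c → Bool) : Cmd.Input where
  sample src t i :=
    if ht : t < m then
      if hi : i < (G.family v).card then
        (((if src then x else y) ⟨t, ht⟩ ((G.family v).orderEmbOfFin rfl ⟨i, hi⟩) : Fin q) : ℕ)
      else 0
    else 0
  coin t := if ht : t < c then ρ ⟨t, ht⟩ else false

namespace InfluenceTest

variable {n k : ℕ} (T : TwoSampleTest) (G : KPartiteDesign n k) (q : ℕ)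
  (S : Finset (Fin n × Fin n)) (ε : ℝ)

/-- The threshold `ε² / (2ω)` of the alternative hypotheses. -/
def threshold : ℝ := ε ^ 2 / (2 * G.omega S)

/-- The error probability `1 / (3ω)` with which every single test is run. -/
def testError : ℝ := 1 / (3 * G.omega S)

/-- The number of samples drawn from each of `P` and `P_S`; all the tests share them. -/
def numSamples : ℕ :=
  T.samples q (G.maxOutcomeInDegree + 1) (threshold G S ε) (testError G S)

/-- The number of coins of every test. -/
def numCoins : ℕ :=
  T.coins q (G.maxOutcomeInDegree + 1) (threshold G S ε) (testError G S)

variable {q} (x y : Fin (numSamples T G q S ε) → Fin n → Fin q)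
  (ρ : Fin n → Fin (numCoins T G q S ε) → Bool)

/-- The test at `v` rejects its null hypothesis, on the samples `x` from `P` and `y` from `P_S`. -/
def testRejects (v : Fin n) : Bool :=
  T.rejects q (G.maxOutcomeInDegree + 1) (threshold G S ε) (testError G S)
    (familyInput G v x y (ρ v))

/-- The number of steps of the test at `v`. -/
def testSteps (v : Fin n) : ℕ :=
  T.steps q (G.maxOutcomeInDegree + 1) (threshold G S ε) (testError G S)
    (familyInput G v x y (ρ v))

/-- The algorithm runs the test at each of the `ω` outcome targets of `S`. It returns failure
(`false`) if all the tests accept their null hypotheses, and otherwise success (`true`). -/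
def output : Bool := decide (∃ v ∈ G.outcomeTargets S, testRejects T G S ε x y ρ v = true)

/-- The running time of the algorithm: drawing the samples, the `ω` tests, which are independent
of each other and run side by side on these samples, and collecting their `ω` answers. -/
def time : ℕ :=
  2 * numSamples T G q S ε + (G.outcomeTargets S).sup (testSteps T G S ε x y ρ) + G.omega S

end InfluenceTest

/-- The probability of the event `A` for `m` independent samples from `P`, `m` independent samples
from `Q`, and `c` independent fair coins for each of the `n` variables. -/
def sampleProb {n q m c : ℕ} (P Q : (Fin n → Fin q) → ℝ)
    (A : (Fin m → Fin n → Fin q) → (Fin m → Fin n → Fin q) → (Fin n → Fin c → Bool) → Bool) : ℝ :=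
  ∑ x : Fin m → Fin n → Fin q, ∑ y : Fin m → Fin n → Fin q, ∑ ρ : Fin n → Fin c → Bool,
    if A x y ρ = true then (∏ t, P (x t)) * (∏ t, Q (y t)) * (1 / 2) ^ (n * c) else 0

end

/-! Reduction to families. The post-intervention distribution factorizes along the same design, so
it is the distribution of another causal model (`intervened`). If `S` points into the last layer
only, the two models differ only in conditionals of variables without children. Given the earlier
layers, the Hellinger affinity ∑ √P √P_S is then a product over outcome variables of factors 1 -
h_v, and 1 - ∏ (1 - h_v) ≤ ∑ h_v yields `hellingerSq_P_le`. The averaged h_v is exactly the distance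
of the marginals on the family of v (`hellingerSq_family`), and it vanishes for outcomes not hit by
`S`. So C(S) ≥ ε forces one of the ω families to be at distance at least ε²/(2ω), while C(S) = 0
forces P = P_S. A union bound over the ω tests controls false success; one rejecting test suffices
for success.

The test. Assignments of a family are coded as numbers below D = |Σ|^(d+1). A coin selects the
source of every draw. Then an element i has the mixture law r_i = (p_i + q_i)/2, and given the
elements the coin signs are independent with means b_i = (p_i - q_i)/(p_i + q_i). With N_i
occurrences and sign sum S_i, the statistic ∑ (S_i² - N_i)/N_i has conditional mean μ = ∑ (N_i - 1)⁺
b_i² and conditional variance at most 2D + 4μ (`collisionStat_variance`). For p = q the mean is 0,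
and a threshold of order √D works by Chebyshev. Otherwise let A = n ∑ r_i b_i² ≥ n H². Draws of a
second half that repeat elements of a first half of n draws make μ at least of order A²/(D + A) with
high probability (`collisionMean_lower_tail`, `le_card_mul_seenMean`). This beats √D once A is a
large multiple of D^(3/4), whence the exponent. A majority of about log(1/δ) rounds lowers the error
from 1/16 to δ.

Time. A draw changes one cell, so the statistic is updated in place, and every round uses a fresh
zero block of memory. Hence D is never a number of steps: a draw costs O(d + 1) steps, which is
logarithmic in B for |Σ| ≥ 2; for |Σ| = 1 no coordinate has to be read. -/

set_option linter.unusedSectionVars false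

noncomputable section

/-! ## Expectations under finite product weights -/

/-- The expectation of `F` under the product of the weights `w t`. -/
def prodExp {ι α : Type*} [Fintype ι] [DecidableEq ι] [Fintype α] (w : ι → α → ℝ)
    (F : (ι → α) → ℝ) : ℝ :=
  ∑ z : ι → α, (∏ t, w t (z t)) * F z

/-- All the `w t` are probability vectors. -/
structure IsWeight {ι α : Type*} [Fintype α] (w : ι → α → ℝ) : Prop where
  nonneg : ∀ t a, 0 ≤ w t a
  sum_eq_one : ∀ t, ∑ a, w t a = 1

namespace prodExp

variable {ι α : Type*} [Fintype ι] [DecidableEq ι] [Fintype α] {w : ι → α → ℝ}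

theorem prod (w f : ι → α → ℝ) :
    prodExp w (fun z => ∏ t, f t (z t)) = ∏ t, ∑ a, w t a * f t a := by
  classical
  simp only [prodExp, ← Finset.prod_mul_distrib]
  rw [Finset.prod_univ_sum, Fintype.piFinset_univ]

theorem add (w : ι → α → ℝ) (F G : (ι → α) → ℝ) :
    prodExp w (fun z => F z + G z) = prodExp w F + prodExp w G := by
  simp [prodExp, mul_add, Finset.sum_add_distrib]

theorem const_mul (w : ι → α → ℝ) (c : ℝ) (F : (ι → α) → ℝ) :
    prodExp w (fun z => c * F z) = c * prodExp w F := by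
  simp only [prodExp, Finset.mul_sum]
  exact Finset.sum_congr rfl fun _ _ => by ring

theorem sub (w : ι → α → ℝ) (F G : (ι → α) → ℝ) :
    prodExp w (fun z => F z - G z) = prodExp w F - prodExp w G := by
  simp [prodExp, mul_sub, Finset.sum_sub_distrib]

theorem sum {κ : Type*} (s : Finset κ) (w : ι → α → ℝ) (F : κ → (ι → α) → ℝ) :
    prodExp w (fun z => ∑ k ∈ s, F k z) = ∑ k ∈ s, prodExp w (F k) := by
  simp only [prodExp, Finset.mul_sum]
  exact Finset.sum_comm

theorem mono (hw : IsWeight w) {F G : (ι → α) → ℝ} (h : ∀ z, F z ≤ G z) :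
    prodExp w F ≤ prodExp w G :=
  Finset.sum_le_sum fun z _ =>
    mul_le_mul_of_nonneg_left (h z) (Finset.prod_nonneg fun t _ => hw.nonneg t _)

theorem const (hw : IsWeight w) (c : ℝ) : prodExp w (fun _ => c) = c := by
  have h := prod w (fun _ _ => 1)
  simp only [Finset.prod_const_one, mul_one, hw.sum_eq_one] at h
  have h2 := const_mul w c (fun _ => 1)
  rw [h] at h2
  simpa using h2

/-- Functions of disjoint sets of coordinates are independent. -/
theorem indep (hw : IsWeight w) (s : Finset ι) {F G : (ι → α) → ℝ}
    (hF : ∀ z z', (∀ t ∈ s, z t = z' t) → F z = F z')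
    (hG : ∀ z z', (∀ t ∉ s, z t = z' t) → G z = G z') :
    prodExp w (fun z => F z * G z) = prodExp w F * prodExp w G := by
  classical
  -- On two independent copies, exchange the coordinates outside `s`. The weight is preserved, and
  -- F(z) G(z) turns into F(z) G(z').
  let φ : (ι → α) × (ι → α) → (ι → α) × (ι → α) := fun p =>
    (s.piecewise p.1 p.2, s.piecewise p.2 p.1)
  have hφ : Function.Involutive φ := by
    rintro ⟨x, y⟩
    ext t <;> by_cases ht : t ∈ s <;> simp [φ, ht]
  have hW : ∀ p : (ι → α) × (ι → α), (∏ t, w t ((φ p).1 t)) * (∏ t, w t ((φ p).2 t)) =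
      (∏ t, w t (p.1 t)) * (∏ t, w t (p.2 t)) := by
    intro p
    rw [← Finset.prod_mul_distrib, ← Finset.prod_mul_distrib]
    refine Finset.prod_congr rfl fun t _ => ?_
    by_cases ht : t ∈ s <;> simp [φ, ht, mul_comm]
  have h1 : prodExp w (fun z => F z * G z) * prodExp w (fun _ => 1) =
      ∑ p : (ι → α) × (ι → α),
        (∏ t, w t (p.1 t)) * (∏ t, w t (p.2 t)) * (F p.1 * G p.1) := by
    rw [prodExp, prodExp, Finset.sum_mul_sum, Fintype.sum_prod_type]
    exact Finset.sum_congr rfl fun _ _ => Finset.sum_congr rfl fun _ _ => by ring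
  have h2 : prodExp w F * prodExp w G =
      ∑ p : (ι → α) × (ι → α),
        (∏ t, w t (p.1 t)) * (∏ t, w t (p.2 t)) * (F p.1 * G p.2) := by
    rw [prodExp, prodExp, Finset.sum_mul_sum, Fintype.sum_prod_type]
    exact Finset.sum_congr rfl fun _ _ => Finset.sum_congr rfl fun _ _ => by ring
  rw [const hw, mul_one] at h1
  rw [h1, h2, ← Equiv.sum_comp hφ.toPerm]
  refine Finset.sum_congr rfl fun p _ => ?_
  simp only [Function.Involutive.coe_toPerm, hW]
  rw [hF (φ p).1 p.1 fun t ht => by simp [φ, ht], hG (φ p).1 p.2 fun t ht => by simp [φ, ht]]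

theorem coord (hw : IsWeight w) (s : ι) (f : α → ℝ) :
    prodExp w (fun z => f (z s)) = ∑ a, w s a * f a := by
  have h := prod w (fun t a => if t = s then f a else 1)
  simp only [Finset.prod_ite_eq', Finset.mem_univ, if_true] at h
  rw [h, Finset.prod_eq_single s]
  · simp
  · intro t _ ht
    simp [ht, hw.sum_eq_one]
  · simp

/-- The second moment of a sum of pairwise uncorrelated centred variables. -/
theorem sq_sum {κ : Type*} [DecidableEq κ] (s : Finset κ) (w : ι → α → ℝ)
    (X : κ → (ι → α) → ℝ)
    (h : ∀ i ∈ s, ∀ j ∈ s, i ≠ j → prodExp w (fun z => X i z * X j z) = 0) :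
    prodExp w (fun z => (∑ i ∈ s, X i z) ^ 2) = ∑ i ∈ s, prodExp w (fun z => X i z ^ 2) := by
  simp only [sq, Finset.sum_mul_sum, sum]
  refine Finset.sum_congr rfl fun i hi => ?_
  rw [Finset.sum_eq_single i (fun j hj hji => h i hi j hj hji.symm) (fun h => absurd hi h)]

/-- Chebyshev's inequality for a lower tail. -/
theorem chebyshev_lower (hw : IsWeight w) {F : (ι → α) → ℝ} {μ a V : ℝ} (ha : a < μ)
    (hV : prodExp w (fun z => (F z - μ) ^ 2) ≤ V) :
    prodExp w (fun z => if F z ≤ a then 1 else 0) ≤ V / (μ - a) ^ 2 := by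
  have hp : 0 < (μ - a) ^ 2 := by have := sub_pos.2 ha; positivity
  rw [le_div_iff₀ hp, mul_comm, ← const_mul]
  refine le_trans (mono hw fun z => ?_) hV
  split_ifs with h
  · nlinarith
  · nlinarith [sq_nonneg (F z - μ)]

/-- Chebyshev's inequality for an upper tail. -/
theorem chebyshev_upper (hw : IsWeight w) {F : (ι → α) → ℝ} {μ a V : ℝ} (ha : μ < a)
    (hV : prodExp w (fun z => (F z - μ) ^ 2) ≤ V) :
    prodExp w (fun z => if a ≤ F z then 1 else 0) ≤ V / (a - μ) ^ 2 := by
  have hp : 0 < (a - μ) ^ 2 := by have := sub_pos.2 ha; positivity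
  rw [le_div_iff₀ hp, mul_comm, ← const_mul]
  refine le_trans (mono hw fun z => ?_) hV
  split_ifs with h
  · nlinarith
  · nlinarith [sq_nonneg (F z - μ)]

/-- The lower tail of a sum of independent identically distributed variables in `[0, 1]`. -/
theorem sum_lower_tail {r : α → ℝ} (hw : IsWeight (fun _ : ι => r)) {h : α → ℝ}
    (h0 : ∀ a, 0 ≤ h a) (h1 : ∀ a, h a ≤ 1) {m : ℝ}
    (hm : m = Fintype.card ι * ∑ a, r a * h a) (hpos : 0 < m) :
    prodExp (fun _ : ι => r) (fun z => if ∑ t, h (z t) ≤ m / 2 then 1 else 0) ≤ 4 / m := by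
  set y := ∑ a, r a * h a with hy
  have hc : ∀ t : ι, prodExp (fun _ : ι => r) (fun z => h (z t) - y) = 0 := by
    intro t
    rw [sub, coord hw t h, const hw, sub_self]
  -- Values in [0, 1] satisfy h² ≤ h, so each summand has variance at most its mean and the total
  -- variance is at most `m`.
  have hV : prodExp (fun _ : ι => r) (fun z => (∑ t, h (z t) - m) ^ 2) ≤ m := by
    have e : ∀ z : ι → α, ∑ t, h (z t) - m = ∑ t, (h (z t) - y) := by
      intro z
      simp [Finset.sum_sub_distrib, hm]
    simp only [e]
    rw [sq_sum]
    · calc ∑ t : ι, prodExp (fun _ : ι => r) (fun z => (h (z t) - y) ^ 2)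
          ≤ ∑ t : ι, y := by
            refine Finset.sum_le_sum fun t _ => ?_
            have e2 : ∀ z : ι → α, (h (z t) - y) ^ 2 = h (z t) ^ 2 - 2 * y * (h (z t) - y) - y ^ 2 :=
              fun z => by ring
            simp only [e2]
            rw [sub, sub, const_mul, hc, const hw, coord hw t (fun a => h a ^ 2)]
            have : ∑ a, r a * h a ^ 2 ≤ y := Finset.sum_le_sum fun a _ =>
              mul_le_mul_of_nonneg_left (by nlinarith [h0 a, h1 a]) (hw.nonneg t a)
            nlinarith [sq_nonneg y]
        _ = m := by simp [hm]
    · intro i _ j _ hij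
      rw [indep hw {i} (F := fun z => h (z i) - y) (G := fun z => h (z j) - y), hc, zero_mul]
      · intro z z' hz
        simp [hz i]
      · intro z z' hz
        simp [hz j (by simpa using hij.symm)]
  refine (chebyshev_lower hw (by linarith) hV).trans (le_of_eq ?_)
  field_simp
  ring

/-- The expectation of a function of images of the coordinates. -/
theorem map {β : Type*} [Fintype β] [DecidableEq β] (w : ι → α → ℝ) (g : α → β)
    (F : (ι → β) → ℝ) :
    prodExp w (fun z => F (fun t => g (z t))) =
      prodExp (fun t b => ∑ a, if g a = b then w t a else 0) F := by
  classical
  simp only [prodExp]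
  have h : ∀ u : ι → β, (∏ t, ∑ a, if g a = u t then w t a else 0) =
      ∑ z : ι → α, if (fun t => g (z t)) = u then ∏ t, w t (z t) else 0 := by
    intro u
    rw [Finset.prod_univ_sum, Fintype.piFinset_univ]
    refine Finset.sum_congr rfl fun z _ => ?_
    split_ifs with h
    · exact Finset.prod_congr rfl fun t _ => by rw [if_pos (congrFun h t)]
    · obtain ⟨t, ht⟩ := Function.ne_iff.1 h
      exact Finset.prod_eq_zero (Finset.mem_univ t) (if_neg ht)
  simp only [h, Finset.sum_mul]
  rw [Finset.sum_comm]
  refine Finset.sum_congr rfl fun z _ => ?_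
  simp

theorem reindex {κ : Type*} [Fintype κ] [DecidableEq κ] (e : κ ≃ ι) (w : ι → α → ℝ)
    (F : (ι → α) → ℝ) :
    prodExp w F = prodExp (fun k => w (e k)) (fun z => F (fun t => z (e.symm t))) := by
  classical
  simp only [prodExp]
  rw [← Equiv.sum_comp (Equiv.arrowCongr e (Equiv.refl α))]
  refine Finset.sum_congr rfl fun z _ => ?_
  congr 1
  rw [← Equiv.prod_comp e]
  simp [Equiv.arrowCongr]

theorem sumElim {κ : Type*} [Fintype κ] [DecidableEq κ] (w : ι ⊕ κ → α → ℝ)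
    (F : (ι ⊕ κ → α) → ℝ) :
    prodExp w F = prodExp (fun t => w (.inl t)) (fun a =>
      prodExp (fun t => w (.inr t)) (fun b => F (Sum.elim a b))) := by
  classical
  simp only [prodExp, Finset.mul_sum]
  rw [← Equiv.sum_comp (Equiv.sumArrowEquivProdArrow ι κ α).symm, Fintype.sum_prod_type]
  refine Finset.sum_congr rfl fun a _ => Finset.sum_congr rfl fun b _ => ?_
  simp [Fintype.prod_sum_type, Equiv.sumArrowEquivProdArrow, mul_assoc]

theorem curry {κ : Type*} [Fintype κ] [DecidableEq κ] (w : α → ℝ)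
    (F : (κ × ι → α) → ℝ) :
    prodExp (fun _ => w) F =
      prodExp (fun _ : κ => fun z : ι → α => ∏ t, w (z t)) (fun Z => F fun p => Z p.1 p.2) := by
  classical
  simp only [prodExp]
  rw [← Equiv.sum_comp (Equiv.curry κ ι α).symm]
  refine Finset.sum_congr rfl fun Z _ => ?_
  rw [Fintype.prod_prod_type]
  rfl

/-- First the second components, then the first components given the second ones. -/
theorem condition {β : Type*} [Fintype β] (r : ι → β → ℝ) (s : β → α → ℝ)
    (F : (ι → α × β) → ℝ) :
    prodExp (fun t p => r t p.2 * s p.2 p.1) F =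
      prodExp r (fun e => prodExp (fun t => s (e t)) (fun σ => F fun t => (σ t, e t))) := by
  classical
  simp only [prodExp, Finset.mul_sum]
  rw [← Equiv.sum_comp (Equiv.arrowProdEquivProdArrow ι (fun _ => α) (fun _ => β)).symm,
    Fintype.sum_prod_type, Finset.sum_comm]
  refine Finset.sum_congr rfl fun e _ => Finset.sum_congr rfl fun σ _ => ?_
  simp [Equiv.arrowProdEquivProdArrow, Finset.prod_mul_distrib, mul_assoc]

theorem isWeight_pi {r : α → ℝ} (hw : IsWeight (fun _ : ι => r)) (κ : Type*) :
    IsWeight (fun _ : κ => fun z : ι → α => ∏ t, r (z t)) where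
  nonneg _ z := Finset.prod_nonneg fun t _ => hw.nonneg t _
  sum_eq_one _ := by simpa [prodExp] using const hw 1

/-- A majority of `R` independent trials with failure probability at most `1 / 16` fails with
probability at most `2 ^ (-R)`. -/
theorem majority {R : ℕ} {r : α → ℝ} (hw : IsWeight (fun _ : Fin R => r)) (bad : α → Prop)
    [DecidablePred bad] (h : ∑ a, r a * (if bad a then 1 else 0) ≤ 1 / 16) :
    prodExp (fun _ : Fin R => r)
      (fun z => if R ≤ 2 * (Finset.univ.filter fun t => bad (z t)).card then 1 else 0) ≤
        (1 / 2) ^ R := by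
  -- Exponential Markov inequality: if at least half of the trials are bad, then 16 ^ #bad ≥ 4 ^ R.
  -- Each trial then contributes a factor at most (1 + 15/16)/4 < 1/2.
  have key : ∀ z : Fin R → α,
      (if R ≤ 2 * (Finset.univ.filter fun t => bad (z t)).card then (1 : ℝ) else 0) ≤
        (1 / 4) ^ R * ∏ t, (if bad (z t) then (16 : ℝ) else 1) := by
    intro z
    rw [Finset.prod_ite, Finset.prod_const, Finset.prod_const_one, mul_one]
    split_ifs with hz
    · calc (1 : ℝ) = (1 / 4) ^ R * 4 ^ R := by rw [← mul_pow]; norm_num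
        _ ≤ (1 / 4) ^ R * 4 ^ (2 * (Finset.univ.filter fun t => bad (z t)).card) := by
          gcongr
          norm_num
        _ = _ := by rw [pow_mul]; norm_num
    · positivity
  refine (mono hw key).trans ?_
  rw [const_mul, prod _ (fun _ a => if bad a then (16 : ℝ) else 1), Finset.prod_const, Finset.card_univ, Fintype.card_fin, ← mul_pow]
  rcases Nat.eq_zero_or_pos R with rfl | hR
  · simp
  have e : ∀ a, r a * (if bad a then (16 : ℝ) else 1) =
      r a + 15 * (r a * (if bad a then 1 else 0)) := by
    intro a; split_ifs <;> ring
  simp only [e, Finset.sum_add_distrib, ← Finset.mul_sum, hw.sum_eq_one ⟨0, hR⟩]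
  refine pow_le_pow_left₀ ?_ (by linarith) R
  have : 0 ≤ ∑ a, r a * (if bad a then (1 : ℝ) else 0) :=
    Finset.sum_nonneg fun a _ => mul_nonneg (hw.nonneg ⟨0, hR⟩ a) (by split_ifs <;> norm_num)
  linarith

end prodExp

/-! ## The collision statistic for given elements and random signs -/

/-- The sign of a bit. -/
def bitSign (c : Bool) : ℤ := if c then 1 else -1

theorem bitSign_sq (c : Bool) : (bitSign c : ℝ) ^ 2 = 1 := by cases c <;> simp [bitSign]

/-- The sum of the signs of the coordinates in `s`. -/
def signSum {ι : Type*} (s : Finset ι) (σ : ι → Bool) : ℝ := ∑ t ∈ s, (bitSign (σ t) : ℝ)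

theorem signSum_insert {ι : Type*} [DecidableEq ι] {s : Finset ι} {a : ι} (ha : a ∉ s) (σ : ι → Bool) :
    signSum (insert a s) σ = signSum s σ + bitSign (σ a) := by
  rw [signSum, Finset.sum_insert ha, add_comm]; rfl

theorem signSum_congr {ι : Type*} {s : Finset ι} {σ σ' : ι → Bool} (h : ∀ t ∈ s, σ t = σ' t) :
    signSum s σ = signSum s σ' :=
  Finset.sum_congr rfl fun t ht => by rw [h t ht]

/-! ### Moments of sums of independent signs, and the collision count of one cell -/

section SignMoments

variable {ι : Type*} [Fintype ι] [DecidableEq ι] {w : ι → Bool → ℝ}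

theorem prodExp_signSum_pow_mul (hw : IsWeight w) {s : Finset ι} {a : ι} (ha : a ∉ s) (k : ℕ) :
    prodExp w (fun σ => signSum s σ ^ k * bitSign (σ a)) =
      prodExp w (fun σ => signSum s σ ^ k) * ∑ c, w a c * bitSign c := by
  rw [prodExp.indep hw s (F := fun σ => signSum s σ ^ k) (G := fun σ => (bitSign (σ a) : ℝ)),
    prodExp.coord hw a (fun c => (bitSign c : ℝ))]
  · intro z z' h
    simp only [signSum_congr h]
  · intro z z' h
    simp only [h a ha]

/-- Since the square of a sign is 1, adding one independent sign expresses each moment through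
moments of the smaller sum of at most the same degree. Four moments are needed because the collision
count is quadratic and its variance quartic. -/
theorem signSum_moments (hw : IsWeight w) (s : Finset ι) (b : ℝ)
    (hb : ∀ t ∈ s, ∑ c, w t c * (bitSign c : ℝ) = b) :
    prodExp w (fun σ => signSum s σ) = s.card * b ∧
    prodExp w (fun σ => signSum s σ ^ 2) = s.card + s.card * (s.card - 1) * b ^ 2 ∧
    prodExp w (fun σ => signSum s σ ^ 3) =
      s.card * (3 * s.card - 2) * b + s.card * (s.card - 1) * (s.card - 2) * b ^ 3 ∧
    prodExp w (fun σ => signSum s σ ^ 4) =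
      s.card * (s.card - 1) * (s.card - 2) * (s.card - 3) * b ^ 4 +
      6 * (s.card * (s.card - 1) * (s.card - 2)) * b ^ 2 + 4 * (s.card * (s.card - 1)) * b ^ 2 +
      3 * (s.card * (s.card - 1)) + s.card := by
  induction s using Finset.induction_on with
  | empty => simp [signSum, prodExp.const hw]
  | insert a s ha ih =>
    obtain ⟨h1, h2, h3, h4⟩ := ih fun t ht => hb t (Finset.mem_insert_of_mem ht)
    have hba := hb a (Finset.mem_insert_self a s)
    have m0 := prodExp_signSum_pow_mul hw ha 0
    have m1 := prodExp_signSum_pow_mul hw ha 1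
    have m2 := prodExp_signSum_pow_mul hw ha 2
    have m3 := prodExp_signSum_pow_mul hw ha 3
    simp only [pow_zero, pow_one, one_mul, hba, prodExp.const hw, h1, h2, h3] at m0 m1 m2 m3
    simp only [signSum_insert ha, Finset.card_insert_of_notMem ha, Nat.cast_add, Nat.cast_one]
    have hs := bitSign_sq
    refine ⟨?_, ?_, ?_, ?_⟩
    · rw [prodExp.add, h1, m0]; ring
    · have e : ∀ σ : ι → Bool, (signSum s σ + bitSign (σ a)) ^ 2 =
          signSum s σ ^ 2 + 2 * (signSum s σ * bitSign (σ a)) + 1 := by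
        intro σ; linear_combination hs (σ a)
      simp only [e]
      rw [prodExp.add, prodExp.add, prodExp.const_mul, prodExp.const hw, h2, m1]; ring
    · have e : ∀ σ : ι → Bool, (signSum s σ + bitSign (σ a)) ^ 3 =
          signSum s σ ^ 3 + 3 * (signSum s σ ^ 2 * bitSign (σ a)) + 3 * signSum s σ +
            bitSign (σ a) := by
        intro σ; linear_combination (3 * signSum s σ + bitSign (σ a)) * hs (σ a)
      simp only [e]
      rw [prodExp.add, prodExp.add, prodExp.add, prodExp.const_mul, prodExp.const_mul, h3, m2, h1,
        m0]
      ring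
    · have e : ∀ σ : ι → Bool, (signSum s σ + bitSign (σ a)) ^ 4 =
          signSum s σ ^ 4 + 4 * (signSum s σ ^ 3 * bitSign (σ a)) + 6 * signSum s σ ^ 2 +
            4 * (signSum s σ * bitSign (σ a)) + 1 := by
        intro σ
        linear_combination (6 * signSum s σ ^ 2 + 4 * signSum s σ * bitSign (σ a) +
          bitSign (σ a) ^ 2 + 1) * hs (σ a)
      simp only [e]
      rw [prodExp.add, prodExp.add, prodExp.add, prodExp.add, prodExp.const_mul, prodExp.const_mul,
        prodExp.const_mul, prodExp.const hw, h4, m3, h2, m1]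
      ring

/-- The normalized number of ordered pairs of equal signs minus that of different signs. -/
def collision (s : Finset ι) (σ : ι → Bool) : ℝ := (signSum s σ ^ 2 - s.card) / s.card

/-- S² - N is the sum over ordered pairs of distinct positions of products of two independent signs,
so its mean is N(N - 1)b². The truncated subtraction makes the formula true for an empty cell as
well, where the quotient is 0 by convention. -/
theorem collision_mean (hw : IsWeight w) (s : Finset ι) (b : ℝ)
    (hb : ∀ t ∈ s, ∑ c, w t c * (bitSign c : ℝ) = b) :
    prodExp w (collision s) = ((s.card - 1 : ℕ) : ℝ) * b ^ 2 := by
  obtain ⟨-, h2, -, -⟩ := signSum_moments hw s b hb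
  have e : collision s = fun σ : ι → Bool =>
      (1 / (s.card : ℝ)) * (signSum s σ ^ 2 - s.card) := by
    funext σ; rw [collision]; ring
  rw [e, prodExp.const_mul, prodExp.sub, h2, prodExp.const hw]
  rcases Nat.eq_zero_or_pos s.card with h | h
  · simp [h]
  · have : (s.card : ℝ) ≠ 0 := by positivity
    rw [Nat.cast_sub h]
    field_simp
    push_cast
    ring

/-- The division by N is what makes the constant term independent of N: without bias, a crowded cell
fluctuates no more than a sparse one. The rest of the variance is controlled by the mean. -/
theorem collision_variance (hw : IsWeight w) (s : Finset ι) (b : ℝ) (hb1 : b ^ 2 ≤ 1)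
    (hb : ∀ t ∈ s, ∑ c, w t c * (bitSign c : ℝ) = b) :
    prodExp w (fun σ => (collision s σ - ((s.card - 1 : ℕ) : ℝ) * b ^ 2) ^ 2) ≤
      2 + 4 * (((s.card - 1 : ℕ) : ℝ) * b ^ 2) := by
  obtain ⟨-, h2, -, h4⟩ := signSum_moments hw s b hb
  rcases Nat.eq_zero_or_pos s.card with h | h
  · simp [h, collision, prodExp.const hw]
  rw [Nat.cast_sub h, Nat.cast_one]
  have h0 : (s.card : ℝ) ≠ 0 := by positivity
  have h1 : (1 : ℝ) ≤ s.card := by exact_mod_cast h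
  set N : ℝ := (s.card : ℝ)
  have e : ∀ σ : ι → Bool, (collision s σ - (N - 1) * b ^ 2) ^ 2 =
      (1 / N ^ 2) * (signSum s σ ^ 4 - 2 * (N + N * (N - 1) * b ^ 2) * signSum s σ ^ 2 +
        (N + N * (N - 1) * b ^ 2) ^ 2) := by
    intro σ
    rw [collision]
    field_simp
    ring
  simp only [e]
  rw [prodExp.const_mul, prodExp.add, prodExp.sub, prodExp.const_mul, prodExp.const hw, h2, h4]
  rw [one_div, inv_mul_le_iff₀ (by positivity)]
  have k1 : 0 ≤ (N - 1) * (1 - b ^ 2) * N * (2 * b ^ 2 - b ^ 2 * b ^ 2) := by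
    have : 0 ≤ b ^ 2 * (2 - b ^ 2) := by nlinarith [sq_nonneg b]
    have h3 : 0 ≤ (N - 1) * (1 - b ^ 2) * N := by
      refine mul_nonneg (mul_nonneg ?_ ?_) ?_ <;> linarith
    nlinarith
  -- The left side is exactly N² times the variance, as the four moments give it.
  have v : 2 * N * (N - 1) * (1 - b ^ 2) ^ 2 + 4 * N * (N - 1) ^ 2 * b ^ 2 * (1 - b ^ 2) ≤
      N ^ 2 * (2 + 4 * ((N - 1) * b ^ 2)) := by
    have a1 : 2 * N * (N - 1) * (1 - b ^ 2) ^ 2 ≤ N ^ 2 * 2 := by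
      have : (1 - b ^ 2) ^ 2 ≤ 1 := by nlinarith [sq_nonneg b]
      have : 2 * N * (N - 1) * (1 - b ^ 2) ^ 2 ≤ 2 * N * (N - 1) * 1 :=
        mul_le_mul_of_nonneg_left this (by nlinarith)
      nlinarith
    have a2 : 4 * N * (N - 1) ^ 2 * b ^ 2 * (1 - b ^ 2) ≤ 4 * N * (N - 1) ^ 2 * b ^ 2 * 1 :=
      mul_le_mul_of_nonneg_left (by nlinarith [sq_nonneg b]) (by positivity)
    have a3 : N * ((N - 1) ^ 2 * b ^ 2) ≤ N * (N * (N - 1) * b ^ 2) := by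
      have : (N - 1) ^ 2 ≤ N * (N - 1) := by nlinarith
      exact mul_le_mul_of_nonneg_left (mul_le_mul_of_nonneg_right this (sq_nonneg b)) (by linarith)
    nlinarith
  refine le_trans (le_of_eq ?_) v
  ring

end SignMoments

/-! ### The collision statistic over all cells -/

section SignStatistic

variable {ι β : Type*} [Fintype ι] [DecidableEq ι] [Fintype β] [DecidableEq β]

/-- The positions of the element `i` in the sequence `e`. -/
def positions (e : ι → β) (i : β) : Finset ι := Finset.univ.filter fun t => e t = i

/-- The sum of the normalized collision counts of all elements. -/
def collisionStat (e : ι → β) (σ : ι → Bool) : ℝ := ∑ i, collision (positions e i) σ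

/-- The conditional mean of `collisionStat` given the elements. -/
def collisionMean (b : β → ℝ) (e : ι → β) : ℝ :=
  ∑ i, (((positions e i).card - 1 : ℕ) : ℝ) * b i ^ 2

/-- Given the elements, different cells read signs at disjoint sets of positions. They are therefore
uncorrelated and their variances add up. -/
theorem collisionStat_variance {s : β → Bool → ℝ} (hs : IsWeight s) {b : β → ℝ}
    (hb1 : ∀ i, b i ^ 2 ≤ 1) (hb : ∀ i, ∑ c, s i c * (bitSign c : ℝ) = b i) (e : ι → β) :
    prodExp (fun t => s (e t)) (fun σ => (collisionStat e σ - collisionMean b e) ^ 2) ≤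
      2 * Fintype.card β + 4 * collisionMean b e := by
  have hw : IsWeight (fun t => s (e t)) := ⟨fun t => hs.nonneg _, fun t => hs.sum_eq_one _⟩
  have hbi : ∀ i, ∀ t ∈ positions e i, ∑ c, s (e t) c * (bitSign c : ℝ) = b i := by
    intro i t ht
    rw [(Finset.mem_filter.1 ht).2, hb]
  have e1 : ∀ σ, collisionStat e σ - collisionMean b e =
      ∑ i, (collision (positions e i) σ - (((positions e i).card - 1 : ℕ) : ℝ) * b i ^ 2) := by
    intro σ; rw [collisionStat, collisionMean, Finset.sum_sub_distrib]
  simp only [e1]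
  rw [prodExp.sq_sum]
  · refine (Finset.sum_le_sum fun i _ =>
      collision_variance hw (positions e i) (b i) (hb1 i) (hbi i)).trans (le_of_eq ?_)
    simp [collisionMean, Finset.sum_add_distrib, Finset.mul_sum, mul_comm]
  · intro i _ j _ hij
    rw [prodExp.indep hw (positions e i)
      (F := fun σ => collision (positions e i) σ - (((positions e i).card - 1 : ℕ) : ℝ) * b i ^ 2)
      (G := fun σ => collision (positions e j) σ - (((positions e j).card - 1 : ℕ) : ℝ) * b j ^ 2),
      prodExp.sub, collision_mean hw (positions e i) (b i) (hbi i), prodExp.const hw, sub_self,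
      zero_mul]
    · intro z z' h
      simp only [collision, signSum_congr h]
    · intro z z' h
      have : signSum (positions e j) z = signSum (positions e j) z' := by
        refine signSum_congr fun t ht => h t fun hti => hij ?_
        rw [← (Finset.mem_filter.1 ht).2, ← (Finset.mem_filter.1 hti).2]
      simp only [collision, this]

end SignStatistic

/-! ## The elements of a random sequence -/

section Occupancy

variable {ι β : Type*} [Fintype ι] [DecidableEq ι] [Fintype β] [DecidableEq β]

/-- The indicator of the event that `i` does not occur in the sequence `a`. -/
def unseen (a : ι → β) (i : β) : ℝ := ∏ t, if a t = i then 0 else 1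

theorem unseen_eq (a : ι → β) (i : β) : unseen a i = if ∃ t, a t = i then 0 else 1 := by
  rw [unseen]
  split_ifs with h
  · obtain ⟨t, ht⟩ := h
    exact Finset.prod_eq_zero (Finset.mem_univ t) (if_pos ht)
  · exact Finset.prod_eq_one fun t _ => if_neg fun ht => h ⟨t, ht⟩

theorem prodExp_unseen {r : β → ℝ} (hw : IsWeight (fun _ : ι => r)) [Nonempty ι] (i : β) :
    prodExp (fun _ : ι => r) (fun a => unseen a i) = (1 - r i) ^ Fintype.card ι := by
  simp only [unseen]
  rw [prodExp.prod _ (fun _ c => if c = i then 0 else 1), Finset.prod_const, Finset.card_univ]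
  congr 1
  have e : ∀ c, r c * (if c = i then (0 : ℝ) else 1) = r c - if c = i then r c else 0 := by
    intro c; split_ifs <;> simp
  simp only [e, Finset.sum_sub_distrib, Finset.sum_ite_eq', Finset.mem_univ, if_true,
    hw.sum_eq_one (Classical.arbitrary ι)]

/-- Being unseen is negatively correlated for different elements, because 1 - r_i - r_j ≤ (1 -
r_i)(1 - r_j). -/
theorem prodExp_unseen_mul {r : β → ℝ} (hw : IsWeight (fun _ : ι => r)) [Nonempty ι] {i j : β}
    (hij : i ≠ j) :
    prodExp (fun _ : ι => r) (fun a => unseen a i * unseen a j) ≤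
      (1 - r i) ^ Fintype.card ι * (1 - r j) ^ Fintype.card ι := by
  have t0 := Classical.arbitrary ι
  simp only [unseen, ← Finset.prod_mul_distrib]
  rw [prodExp.prod _ (fun _ c => (if c = i then (0 : ℝ) else 1) * if c = j then 0 else 1),
    Finset.prod_const, Finset.card_univ, ← mul_pow]
  have e : ∑ c, r c * ((if c = i then (0 : ℝ) else 1) * if c = j then 0 else 1) =
      1 - r i - r j := by
    have : ∀ c, r c * ((if c = i then (0 : ℝ) else 1) * if c = j then 0 else 1) =
        r c - (if c = i then r c else 0) - (if c = j then r c else 0) := by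
      intro c
      by_cases h1 : c = i
      · subst h1; simp [hij]
      · simp [h1]; split_ifs <;> simp
    simp only [this, Finset.sum_sub_distrib, Finset.sum_ite_eq', Finset.mem_univ, if_true,
      hw.sum_eq_one t0]
  rw [e]
  have h1 := hw.nonneg t0 i
  have h2 := hw.nonneg t0 j
  refine pow_le_pow_left₀ ?_ (by nlinarith) _
  rw [← e]
  exact Finset.sum_nonneg fun c _ => mul_nonneg (hw.nonneg t0 c) (by split_ifs <;> norm_num)

/-- By Bernoulli, (1 - x)ⁿ(1 + nx) ≤ (1 - x²)ⁿ ≤ 1. This serves twice: for r(1 - r)ⁿ ≤ 1/n, and for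
a lower bound on the probability that an element is seen. -/
theorem one_sub_pow_le {x : ℝ} (h0 : 0 ≤ x) (h1 : x ≤ 1) (n : ℕ) :
    (1 - x) ^ n ≤ 1 / (1 + n * x) := by
  rw [le_div_iff₀ (by positivity)]
  calc (1 - x) ^ n * (1 + n * x) ≤ (1 - x) ^ n * (1 + x) ^ n :=
        mul_le_mul_of_nonneg_left (one_add_mul_le_pow (by linarith) n)
          (pow_nonneg (by linarith) n)
    _ = (1 - x ^ 2) ^ n := by rw [← mul_pow]; ring
    _ ≤ 1 := pow_le_one₀ (by nlinarith) (by nlinarith)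

/-- The total weight of the elements that occur in `a`. -/
def seenWeight (g : β → ℝ) (a : ι → β) : ℝ := ∑ i, g i * (1 - unseen a i)

/-- The mean of `seenWeight` for `n` draws. -/
def seenMean (r g : β → ℝ) (n : ℕ) : ℝ := ∑ i, g i * (1 - (1 - r i) ^ n)

variable {r g : β → ℝ}

theorem weight_le_one {r : β → ℝ} (h0 : ∀ i, 0 ≤ r i) (h1 : ∑ i, r i = 1) (i : β) : r i ≤ 1 :=
  h1 ▸ Finset.single_le_sum (fun i _ => h0 i) (Finset.mem_univ i)

/-- Negative correlation leaves only the diagonal terms g²u(1 - u), where u is the probability of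
being unseen, and g u ≤ r u ≤ 1/n. A variance of mean/n makes Chebyshev at half the mean effective
as soon as n times the mean is large. -/
theorem seenWeight_variance (hw : IsWeight (fun _ : ι => r)) [Nonempty ι]
    (hg0 : ∀ i, 0 ≤ g i) (hg : ∀ i, g i ≤ r i) :
    prodExp (fun _ : ι => r)
        (fun a => (seenWeight g a - seenMean r g (Fintype.card ι)) ^ 2) ≤
      seenMean r g (Fintype.card ι) / Fintype.card ι := by
  set n := Fintype.card ι with hn
  have hn0 : 0 < n := Fintype.card_pos
  have hr0 : ∀ i, 0 ≤ r i := hw.nonneg (Classical.arbitrary ι)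
  have hr1 := weight_le_one hr0 (hw.sum_eq_one (Classical.arbitrary ι))
  set u : β → ℝ := fun i => (1 - r i) ^ n with hu
  have hu0 : ∀ i, 0 ≤ u i := fun i => pow_nonneg (by linarith [hr1 i]) n
  have hu1 : ∀ i, u i ≤ 1 := fun i => pow_le_one₀ (by linarith [hr1 i]) (by linarith [hr0 i])
  have hru : ∀ i, r i * u i ≤ 1 / n := by
    intro i
    have h := one_sub_pow_le (hr0 i) (hr1 i) n
    have hp : (0 : ℝ) < n := by exact_mod_cast hn0
    calc r i * u i ≤ r i * (1 / (1 + n * r i)) := mul_le_mul_of_nonneg_left h (hr0 i)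
      _ ≤ 1 / n := by
        have := hr0 i
        rw [mul_one_div, div_le_div_iff₀ (by positivity) hp]
        linarith
  have e : ∀ a : ι → β, (seenWeight g a - seenMean r g n) ^ 2 =
      ∑ i, ∑ j, g i * g j * ((u i - unseen a i) * (u j - unseen a j)) := by
    intro a
    rw [seenWeight, seenMean, ← Finset.sum_sub_distrib, sq, Finset.sum_mul_sum]
    exact Finset.sum_congr rfl fun i _ => Finset.sum_congr rfl fun j _ => by
      simp only [hu]; ring
  simp only [e, prodExp.sum, prodExp.const_mul]
  have cov : ∀ i j, prodExp (fun _ : ι => r)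
      (fun a => (u i - unseen a i) * (u j - unseen a j)) ≤
        if j = i then u i * (1 - u i) else 0 := by
    intro i j
    have e2 : ∀ a : ι → β, (u i - unseen a i) * (u j - unseen a j) =
        u i * u j - u i * unseen a j - u j * unseen a i + unseen a i * unseen a j :=
      fun a => by ring
    simp only [e2]
    rw [prodExp.add, prodExp.sub, prodExp.sub, prodExp.const hw, prodExp.const_mul,
      prodExp.const_mul, prodExp_unseen hw, prodExp_unseen hw]
    split_ifs with hij
    · subst hij
      have e3 : ∀ a : ι → β, unseen a j * unseen a j = unseen a j := by
        intro a; rw [unseen_eq]; split_ifs <;> simp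
      simp only [e3]
      rw [prodExp_unseen hw]
      simp only [hu, hn]
      linarith
    · have := prodExp_unseen_mul hw (ι := ι) (i := i) (j := j) (Ne.symm hij)
      simp only [hu, hn]
      linarith
  calc ∑ i, ∑ j, g i * g j * prodExp (fun _ : ι => r)
          (fun a => (u i - unseen a i) * (u j - unseen a j))
      ≤ ∑ i, ∑ j, g i * g j * (if j = i then u i * (1 - u i) else 0) :=
        Finset.sum_le_sum fun i _ => Finset.sum_le_sum fun j _ =>
          mul_le_mul_of_nonneg_left (cov i j) (mul_nonneg (hg0 i) (hg0 j))
    _ = ∑ i, g i * g i * (u i * (1 - u i)) := by simp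
    _ ≤ ∑ i, g i * (1 - u i) * (1 / n) := by
        refine Finset.sum_le_sum fun i _ => ?_
        have h1 : g i * u i ≤ 1 / n :=
          (mul_le_mul_of_nonneg_right (hg i) (hu0 i)).trans (hru i)
        have h2 : 0 ≤ g i * (1 - u i) := mul_nonneg (hg0 i) (by linarith [hu1 i])
        calc g i * g i * (u i * (1 - u i)) = g i * (1 - u i) * (g i * u i) := by ring
          _ ≤ _ := mul_le_mul_of_nonneg_left h1 h2
    _ = _ := by rw [← Finset.sum_mul, seenMean, mul_one_div]

/-- Each element contributes at least (n g)²/(1 + n g), and Cauchy–Schwarz in the form (∑ x)²/∑ y ≤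
∑ x²/y adds these up. The regime A²/D of this bound, for A = n ∑ g below D, is responsible for the
exponent 3/4. -/
theorem le_card_mul_seenMean (hr0 : ∀ i, 0 ≤ r i) (hr : ∑ i, r i = 1)
    (hg0 : ∀ i, 0 ≤ g i) (hg : ∀ i, g i ≤ r i) (n : ℕ) :
    (n * ∑ i, g i) ^ 2 / (Fintype.card β + n * ∑ i, g i) ≤ n * seenMean r g n := by
  have hx : ∀ i, 0 ≤ n * g i := fun i => mul_nonneg (Nat.cast_nonneg n) (hg0 i)
  have h := Finset.sq_sum_div_le_sum_sq_div Finset.univ (fun i => n * g i)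
    (g := fun i => 1 + n * g i) (fun i _ => by linarith [hx i])
  simp only [Finset.sum_add_distrib, Finset.sum_const, Finset.card_univ, nsmul_eq_mul, mul_one,
    ← Finset.mul_sum] at h
  refine h.trans ?_
  rw [seenMean, Finset.mul_sum]
  refine Finset.sum_le_sum fun i _ => ?_
  have h1 := one_sub_pow_le (hr0 i) (weight_le_one hr0 hr i) n
  have h2 : 1 / (1 + n * r i) ≤ 1 / (1 + n * g i) := by
    have := hx i
    have := mul_le_mul_of_nonneg_left (hg i) (Nat.cast_nonneg (α := ℝ) n)
    exact one_div_le_one_div_of_le (by linarith) (by linarith)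
  have h3 : (n * g i) ^ 2 / (1 + n * g i) = n * g i * (1 - 1 / (1 + n * g i)) := by
    have : 1 + n * g i ≠ 0 := by linarith [hx i]
    field_simp
    ring
  rw [h3, ← mul_assoc]
  exact mul_le_mul_of_nonneg_left (by linarith) (hx i)

theorem sum_comp_eq_sum_card_positions (e : ι → β) (h : β → ℝ) :
    ∑ t, h (e t) = ∑ i, ((positions e i).card : ℝ) * h i := by
  rw [← Finset.sum_fiberwise Finset.univ e]
  refine Finset.sum_congr rfl fun i _ => ?_
  rw [Finset.sum_congr rfl (g := fun _ => h i) fun t ht => by rw [(Finset.mem_filter.1 ht).2]]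
  simp [positions]

/-- An element that occurs in the first half `a` occurs N - 1 or fewer times in the second half `c`,
so the factor N - 1 counts every repetition there. This replaces the dependent counts by a sum of
independent terms given `a`. -/
theorem sum_seen_le_collisionMean {κ : Type*} [Fintype κ] [DecidableEq κ] (b : β → ℝ)
    (a : ι → β) (c : κ → β) :
    ∑ t, (1 - unseen a (c t)) * b (c t) ^ 2 ≤ collisionMean b (Sum.elim a c) := by
  rw [sum_comp_eq_sum_card_positions c (fun i => (1 - unseen a i) * b i ^ 2), collisionMean]
  refine Finset.sum_le_sum fun i _ => ?_
  rw [← mul_assoc]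
  refine mul_le_mul_of_nonneg_right ?_ (sq_nonneg _)
  have hc : (positions (Sum.elim a c) i).card = (positions a i).card + (positions c i).card := by
    simp only [positions, Finset.card_filter, Fintype.sum_sum_type, Sum.elim_inl, Sum.elim_inr]
    rfl
  rw [unseen_eq]
  split_ifs with h
  · obtain ⟨t, ht⟩ := h
    have : 0 < (positions a i).card := Finset.card_pos.2 ⟨t, by simp [positions, ht]⟩
    rw [sub_zero, mul_one]
    exact_mod_cast (by omega)
  · simp

/-- The conditional mean of the collision statistic is large with high probability. -/
theorem collisionMean_lower_tail {κ : Type*} [Fintype κ] [DecidableEq κ]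
    (hcard : Fintype.card κ = Fintype.card ι) [Nonempty ι] (hr : IsWeight (fun _ : Unit => r))
    {b : β → ℝ} (hb : ∀ i, b i ^ 2 ≤ 1) {L : ℝ} (hL : 0 < L)
    (hmean : L ≤ Fintype.card ι * seenMean r (fun i => r i * b i ^ 2) (Fintype.card ι)) :
    prodExp (fun _ : ι ⊕ κ => r) (fun e => if collisionMean b e ≤ L / 4 then 1 else 0) ≤
      12 / L := by
  have hr0 := hr.nonneg ()
  have hw : ∀ (η : Type _), IsWeight (fun _ : η => r) := fun η => ⟨fun _ => hr0, fun _ => hr.sum_eq_one ()⟩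
  have hw' : IsWeight (fun _ : κ => r) := ⟨fun _ => hr0, fun _ => hr.sum_eq_one ()⟩
  set g : β → ℝ := fun i => r i * b i ^ 2 with hg
  set n := Fintype.card ι with hn
  have hn0 : (0 : ℝ) < n := by exact_mod_cast Fintype.card_pos (α := ι)
  set y := seenMean r g n with hy
  have hy0 : 0 < y := pos_of_mul_pos_right (hL.trans_le hmean) hn0.le
  have hv := seenWeight_variance (hw ι) (g := g) (fun i => mul_nonneg (hr0 i) (sq_nonneg _))
    (fun i => mul_le_of_le_one_right (hr0 i) (hb i))
  have h1 := prodExp.chebyshev_lower (hw ι) (a := y / 2) (by linarith) hv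
  have h1' : y / n / (y - y / 2) ^ 2 ≤ 4 / L := by
    have : y / n / (y - y / 2) ^ 2 = 4 / (n * y) := by field_simp; ring
    rw [this]
    exact div_le_div_of_nonneg_left (by norm_num) hL hmean
  rw [prodExp.sumElim]
  -- Condition on the first half. If its seen weight exceeds half the mean, the second half has mean
  -- m ≥ L/2 and falls to m/2 or below with probability at most 4/m ≤ 8/L. With 4/L for the first
  -- half this gives 12/L.
  have h2 : ∀ a : ι → β, prodExp (fun _ : κ => r)
      (fun c => if collisionMean b (Sum.elim a c) ≤ L / 4 then 1 else 0) ≤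
        (if seenWeight g a ≤ y / 2 then 1 else 0) + 8 / L := by
    intro a
    have hL8 : 0 < 8 / L := by positivity
    split_ifs with ha
    · refine (prodExp.mono hw' (G := fun _ => 1) fun c => by split_ifs <;> norm_num).trans ?_
      rw [prodExp.const hw']
      linarith
    · rw [not_le] at ha
      set m : ℝ := Fintype.card κ * ∑ i, r i * ((1 - unseen a i) * b i ^ 2) with hm
      have hmL : L / 2 ≤ m := by
        have : m = n * seenWeight g a := by
          rw [hm, hcard, seenWeight]
          congr 1
          exact Finset.sum_congr rfl fun i _ => by simp only [hg]; ring
        rw [this]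
        nlinarith
      have hu : ∀ i, 0 ≤ 1 - unseen a i ∧ 1 - unseen a i ≤ 1 := by
        intro i; rw [unseen_eq]; split_ifs <;> norm_num
      have h3 := prodExp.sum_lower_tail hw' (h := fun i => (1 - unseen a i) * b i ^ 2)
        (fun i => mul_nonneg (hu i).1 (sq_nonneg _))
        (fun i => mul_le_one₀ (hu i).2 (sq_nonneg _) (hb i)) hm (by linarith)
      have h4 : 4 / m ≤ 8 / L := by
        rw [div_le_div_iff₀ (by linarith) hL]; linarith
      rw [zero_add]
      refine le_trans (prodExp.mono hw' fun c => ?_) (h3.trans h4)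
      have h5 := sum_seen_le_collisionMean b a c
      by_cases h6 : collisionMean b (Sum.elim a c) ≤ L / 4
      · rw [if_pos h6, if_pos (by linarith)]
      · rw [if_neg h6]; split_ifs <;> norm_num
  refine (prodExp.mono (hw ι) h2).trans ?_
  rw [prodExp.add, prodExp.const (hw ι)]
  have : 12 / L = 4 / L + 8 / L := by ring
  linarith

end Occupancy

/-! ## One round of the squared Hellinger test -/

/-- The number of occurrences of `i` in a sequence of labelled elements. -/
def labelCount {ι β : Type*} [Fintype ι] [DecidableEq β] (z : ι → Bool × β) (i : β) : ℤ :=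
  ∑ t, if (z t).2 = i then 1 else 0

/-- The sum of the signs of the occurrences of `i` in a sequence of labelled elements. -/
def labelSum {ι β : Type*} [Fintype ι] [DecidableEq β] (z : ι → Bool × β) (i : β) : ℤ :=
  ∑ t, if (z t).2 = i then bitSign (z t).1 else 0

/-- The scaled and rounded collision count of an element with `N` occurrences and sign sum `S`. -/
def cellValue (D N S : ℤ) : ℤ := D * (S * S - N) / N

/-- The integer version of the collision statistic. -/
def integerStat {ι β : Type*} [Fintype ι] [Fintype β] [DecidableEq β] (D : ℤ)
    (z : ι → Bool × β) : ℤ :=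
  ∑ i, cellValue D (labelCount z i) (labelSum z i)

/-- The squared Hellinger distance of two nonnegative vectors. -/
def hellingerSq {β : Type*} [Fintype β] (p q : β → ℝ) : ℝ := ∑ i, 1 / 2 * (√(p i) - √(q i)) ^ 2

/-- The law of a fair label together with an element from the source that it selects. -/
def labelWeight {β : Type*} (p q : β → ℝ) (a : Bool × β) : ℝ :=
  1 / 2 * (if a.1 then p a.2 else q a.2)

/-- The rejection threshold for `D` elements. -/
def rejectThreshold (D : ℕ) : ℤ := ⌈(D : ℝ) * (6 * √D)⌉

theorem intCast_ediv_bounds (a : ℤ) {N : ℤ} (hN : 0 < N) :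
    (a : ℝ) / N - 1 ≤ ((a / N : ℤ) : ℝ) ∧ ((a / N : ℤ) : ℝ) ≤ (a : ℝ) / N := by
  have hN' : (0 : ℝ) < N := by exact_mod_cast hN
  have h1 : N * (a / N) + a % N = a := Int.mul_ediv_add_emod a N
  have h2 := Int.emod_nonneg a hN.ne'
  have h3 := Int.emod_lt_of_pos a hN
  have h1' : (N : ℝ) * ((a / N : ℤ) : ℝ) + ((a % N : ℤ) : ℝ) = a := by exact_mod_cast h1
  have h2' : (0 : ℝ) ≤ ((a % N : ℤ) : ℝ) := by exact_mod_cast h2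
  have h3' : ((a % N : ℤ) : ℝ) ≤ N := by exact_mod_cast h3.le
  constructor
  · rw [sub_le_iff_le_add, div_le_iff₀ hN']; linarith
  · rw [le_div_iff₀ hN']; linarith

section Round

variable {ι β : Type*} [Fintype ι] [DecidableEq ι] [Fintype β] [DecidableEq β]

theorem labelCount_eq (σ : ι → Bool) (e : ι → β) (i : β) :
    labelCount (fun t => (σ t, e t)) i = (positions e i).card := by
  simp [labelCount, positions]

theorem labelSum_eq (σ : ι → Bool) (e : ι → β) (i : β) :
    (labelSum (fun t => (σ t, e t)) i : ℝ) = signSum (positions e i) σ := by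
  simp [labelSum, positions, signSum, Finset.sum_filter]

/-- Each floor loses at most 1. As the cells are scaled by their number D, the D losses amount to at
most 1 in the unscaled statistic. Empty cells give 0 on both sides. -/
theorem integerStat_bounds (σ : ι → Bool) (e : ι → β) :
    Fintype.card β * (collisionStat e σ - 1) ≤
        integerStat (Fintype.card β) (fun t => (σ t, e t)) ∧
      (integerStat (Fintype.card β) (fun t => (σ t, e t)) : ℝ) ≤
        Fintype.card β * collisionStat e σ := by
  have key : ∀ i, Fintype.card β * collision (positions e i) σ - 1 ≤
      (cellValue (Fintype.card β) (labelCount (fun t => (σ t, e t)) i)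
        (labelSum (fun t => (σ t, e t)) i) : ℝ) ∧
      (cellValue (Fintype.card β) (labelCount (fun t => (σ t, e t)) i)
        (labelSum (fun t => (σ t, e t)) i) : ℝ) ≤
      Fintype.card β * collision (positions e i) σ := by
    intro i
    rw [cellValue, collision, ← labelSum_eq σ e i, labelCount_eq]
    rcases Nat.eq_zero_or_pos (positions e i).card with h | h
    · simp [h]
    · have := intCast_ediv_bounds ((Fintype.card β : ℤ) *
        (labelSum (fun t => (σ t, e t)) i * labelSum (fun t => (σ t, e t)) i -
          (positions e i).card)) (N := (positions e i).card) (by exact_mod_cast h)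
      push_cast at this
      rw [← mul_div_assoc, sq]
      exact this
  rw [integerStat, collisionStat, Int.cast_sum, Finset.mul_sum]
  constructor
  · rw [mul_sub, Finset.mul_sum, mul_one]
    have : ((Fintype.card β : ℕ) : ℝ) = ∑ _i : β, (1 : ℝ) := by simp
    conv_lhs => rw [this]
    rw [← Finset.sum_sub_distrib]
    refine Finset.sum_le_sum fun i _ => ?_
    simpa using (key i).1
  · exact Finset.sum_le_sum fun i _ => (key i).2

/-- The probability of a label given the difference quotient `b` of the two sources. -/
def labelBias (b : ℝ) (c : Bool) : ℝ := (1 + bitSign c * b) / 2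

theorem isWeight_labelBias {b : β → ℝ} (hb : ∀ i, b i ^ 2 ≤ 1) :
    IsWeight (fun i => labelBias (b i)) where
  nonneg i c := by
    have := abs_le.1 ((sq_le_one_iff_abs_le_one _).1 (hb i))
    cases c <;> simp [labelBias, bitSign] <;> linarith
  sum_eq_one i := by simp [labelBias, bitSign]; ring

theorem labelBias_mean (b : ℝ) : ∑ c, labelBias b c * (bitSign c : ℝ) = b := by
  simp [labelBias, bitSign]; ring

theorem relDiff_sq_le_one {x y : ℝ} (hx : 0 ≤ x) (hy : 0 ≤ y) : ((x - y) / (x + y)) ^ 2 ≤ 1 := by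
  rw [div_pow]
  refine div_le_one_of_le₀ ?_ (sq_nonneg _)
  nlinarith [mul_nonneg hx hy]

/-- Bayes' rule: first the element from the mixture, then its label. Where both sources vanish, the
mixture weight is 0 and the bias is irrelevant. -/
theorem labelWeight_eq {p q : β → ℝ} (hp : ∀ i, 0 ≤ p i) (hq : ∀ i, 0 ≤ q i) (a : Bool × β) :
    labelWeight p q a = (p a.2 + q a.2) / 2 *
      labelBias ((p a.2 - q a.2) / (p a.2 + q a.2)) a.1 := by
  obtain ⟨c, i⟩ := a
  rcases (add_nonneg (hp i) (hq i)).eq_or_lt with h | h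
  · have h1 : p i = 0 := by linarith [hp i, hq i]
    have h2 : q i = 0 := by linarith [hp i, hq i]
    cases c <;> simp [labelWeight, h1, h2]
  · cases c <;> simp [labelWeight, labelBias, bitSign] <;> field_simp <;> ring

theorem isWeight_labelWeight {p q : β → ℝ} (hp : ∀ i, 0 ≤ p i) (hq : ∀ i, 0 ≤ q i)
    (hp1 : ∑ i, p i = 1) (hq1 : ∑ i, q i = 1) (η : Type*) :
    IsWeight (fun _ : η => labelWeight p q) where
  nonneg _ a := by
    have := hp a.2
    have := hq a.2
    rw [labelWeight]
    split_ifs <;> positivity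
  sum_eq_one _ := by
    rw [Fintype.sum_prod_type]
    simp [labelWeight, ← Finset.mul_sum, hp1, hq1]

theorem isWeight_mixture {p q : β → ℝ} (hp : ∀ i, 0 ≤ p i) (hq : ∀ i, 0 ≤ q i)
    (hp1 : ∑ i, p i = 1) (hq1 : ∑ i, q i = 1) (η : Type*) :
    IsWeight (fun _ : η => fun i => (p i + q i) / 2) where
  nonneg _ i := by have := hp i; have := hq i; positivity
  sum_eq_one _ := by rw [← Finset.sum_div, Finset.sum_add_distrib, hp1, hq1]; norm_num

theorem prodExp_labelWeight {p q : β → ℝ} (hp : ∀ i, 0 ≤ p i) (hq : ∀ i, 0 ≤ q i)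
    (F : (ι → Bool × β) → ℝ) :
    prodExp (fun _ : ι => labelWeight p q) F =
      prodExp (fun _ : ι => fun i => (p i + q i) / 2) (fun e =>
        prodExp (fun t => labelBias ((p (e t) - q (e t)) / (p (e t) + q (e t))))
          (fun σ => F fun t => (σ t, e t))) := by
  rw [← prodExp.condition (fun _ i => (p i + q i) / 2)
    (fun i => labelBias ((p i - q i) / (p i + q i)))]
  congr 1
  funext _ a
  exact labelWeight_eq hp hq a

/-- Termwise, (√p - √q)²(p + q) ≤ (√p - √q)²(√p + √q)² = (p - q)². -/
theorem hellingerSq_le {p q : β → ℝ} (hp : ∀ i, 0 ≤ p i) (hq : ∀ i, 0 ≤ q i) :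
    hellingerSq p q ≤ ∑ i, (p i + q i) / 2 * ((p i - q i) / (p i + q i)) ^ 2 := by
  refine Finset.sum_le_sum fun i _ => ?_
  rcases (add_nonneg (hp i) (hq i)).eq_or_lt with h | h
  · have h1 : p i = 0 := by linarith [hp i, hq i]
    have h2 : q i = 0 := by linarith [hp i, hq i]
    simp [h1, h2]
  · have e : (p i + q i) / 2 * ((p i - q i) / (p i + q i)) ^ 2 =
        1 / 2 * ((p i - q i) ^ 2 / (p i + q i)) := by field_simp
    rw [e]
    refine mul_le_mul_of_nonneg_left ?_ (by norm_num)
    rw [le_div_iff₀ h]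
    have s1 := Real.sq_sqrt (hp i)
    have s2 := Real.sq_sqrt (hq i)
    have n1 := Real.sqrt_nonneg (p i)
    have n2 := Real.sqrt_nonneg (q i)
    generalize √(p i) = x at *
    generalize √(q i) = y at *
    rw [← s1, ← s2]
    have : (x ^ 2 - y ^ 2) ^ 2 = (x - y) ^ 2 * (x + y) ^ 2 := by ring
    rw [this]
    exact mul_le_mul_of_nonneg_left (by nlinarith [mul_nonneg n1 n2]) (sq_nonneg _)

/-- One round rejects a true null hypothesis with probability at most `1 / 16`. -/
theorem integerStat_null [Nonempty β] {p : β → ℝ} (hp : ∀ i, 0 ≤ p i) (hp1 : ∑ i, p i = 1) :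
    prodExp (fun _ : ι => labelWeight p p)
      (fun z => if rejectThreshold (Fintype.card β) < integerStat (Fintype.card β) z
        then 1 else 0) ≤ 1 / 16 := by
  rw [prodExp_labelWeight hp hp]
  have hw := isWeight_mixture hp hp hp1 hp1 ι
  have hb : ∀ i, ((p i - p i) / (p i + p i)) ^ 2 ≤ 1 := fun i => by simp
  have hs := isWeight_labelBias hb
  rw [← prodExp.const hw (1 / 16)]
  refine prodExp.mono hw fun e => ?_
  have hv := collisionStat_variance hs hb (fun i => labelBias_mean _) e
  have hm : collisionMean (fun i => (p i - p i) / (p i + p i)) e = 0 := by simp [collisionMean]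
  rw [hm] at hv
  set D := Fintype.card β with hD
  have hD0 : (0 : ℝ) < D := by exact_mod_cast Fintype.card_pos (α := β)
  have hw' : IsWeight (fun t => labelBias ((p (e t) - p (e t)) / (p (e t) + p (e t)))) :=
    ⟨fun t => hs.nonneg _, fun t => hs.sum_eq_one _⟩
  have h1 := prodExp.chebyshev_upper hw' (a := 6 * √D) (by positivity) hv
  refine (prodExp.mono hw' fun σ => ?_).trans (h1.trans ?_)
  · have h2 := (integerStat_bounds σ e).2
    by_cases h : rejectThreshold D < integerStat D (fun t => (σ t, e t))
    · have h3 : (rejectThreshold D : ℝ) < integerStat D (fun t => (σ t, e t)) := by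
        exact_mod_cast h
      have h4 : (D : ℝ) * (6 * √D) ≤ rejectThreshold D := Int.le_ceil _
      have h5 : (D : ℝ) * (6 * √D) < D * collisionStat e σ := by linarith
      rw [if_pos h, if_pos (lt_of_mul_lt_mul_left h5 hD0.le).le]
    · rw [if_neg h]; split_ifs <;> norm_num
  -- The Chebyshev bound is 2D/(36D) = 1/18.
  · rw [sub_zero, mul_pow, Real.sq_sqrt hD0.le]
    rw [div_le_div_iff₀ (by positivity) (by norm_num)]
    linarith

/-- One round accepts with probability at most `1 / 16` if the distance is large. -/
theorem integerStat_alternative {κ : Type*} [Fintype κ] [DecidableEq κ] [Nonempty β]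
    (hcard : Fintype.card κ = Fintype.card ι) [Nonempty ι]
    {p q : β → ℝ} (hp : ∀ i, 0 ≤ p i) (hq : ∀ i, 0 ≤ q i)
    (hp1 : ∑ i, p i = 1) (hq1 : ∑ i, q i = 1)
    (h : 8192 * (Fintype.card β : ℝ) ^ (3 / 4 : ℝ) ≤ Fintype.card ι * hellingerSq p q) :
    prodExp (fun _ : ι ⊕ κ => labelWeight p q)
      (fun z => if integerStat (Fintype.card β) z ≤ rejectThreshold (Fintype.card β)
        then 1 else 0) ≤ 1 / 16 := by
  rw [prodExp_labelWeight hp hq]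
  have hw := isWeight_mixture hp hq hp1 hq1 (ι ⊕ κ)
  set b : β → ℝ := fun i => (p i - q i) / (p i + q i) with hbdef
  have hb : ∀ i, b i ^ 2 ≤ 1 := fun i => relDiff_sq_le_one (hp i) (hq i)
  have hs := isWeight_labelBias hb
  set r : β → ℝ := fun i => (p i + q i) / 2 with hr
  have hwr : IsWeight (fun _ : Unit => r) := isWeight_mixture hp hq hp1 hq1 Unit
  set D := Fintype.card β with hD
  have hDN : 1 ≤ D := Fintype.card_pos (α := β)
  have hD1 : (1 : ℝ) ≤ D := by exact_mod_cast hDN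
  have hs1 : 1 ≤ √(D : ℝ) := Real.one_le_sqrt.2 hD1
  have hss : √(D : ℝ) * √D = D := Real.mul_self_sqrt (by linarith)
  set n := Fintype.card ι with hn
  -- With y = D^(3/4) and A ≥ 8192y, A² has to be at least 4096√D(D + A). One half of A² pays for
  -- the term with D because y² = D√D, the other half for the term with A because √D ≤ y.
  have hmean : 4096 * √(D : ℝ) ≤ n * seenMean r (fun i => r i * b i ^ 2) n := by
    refine le_trans ?_ (le_card_mul_seenMean (hwr.nonneg ()) (hwr.sum_eq_one ())
      (fun i => mul_nonneg (hwr.nonneg () i) (sq_nonneg _))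
      (fun i => mul_le_of_le_one_right (hwr.nonneg () i) (hb i)) n)
    have hA : 8192 * (D : ℝ) ^ (3 / 4 : ℝ) ≤ n * ∑ i, r i * b i ^ 2 :=
      h.trans (mul_le_mul_of_nonneg_left (hellingerSq_le hp hq) (Nat.cast_nonneg n))
    set A := n * ∑ i, r i * b i ^ 2
    set y := (D : ℝ) ^ (3 / 4 : ℝ) with hy
    have hy2 : y * y = D * √D := by
      rw [hy, Real.sqrt_eq_rpow, ← Real.rpow_add (by linarith)]
      nth_rewrite 2 [← Real.rpow_one (D : ℝ)]
      rw [← Real.rpow_add (by linarith)]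
      norm_num
    have hyD : y ≤ D := by
      rw [hy]
      nth_rewrite 2 [← Real.rpow_one (D : ℝ)]
      exact Real.rpow_le_rpow_of_exponent_le hD1 (by norm_num)
    have hy0 : 0 < y := by rw [hy]; positivity
    rw [← hD, le_div_iff₀ (by linarith)]
    have hyS : √(D : ℝ) ≤ y := by
      rw [hy, Real.sqrt_eq_rpow]
      exact Real.rpow_le_rpow_of_exponent_le hD1 (by norm_num)
    nlinarith [mul_le_mul hA hA (by positivity) (by linarith)]
  have hL : 0 < 4096 * √(D : ℝ) := by positivity
  have h1 := collisionMean_lower_tail (κ := κ) hcard hwr hb hL hmean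
  -- For μ > 1024√D, acceptance means a statistic of at most 6√D + 2 (rounding included), hence at
  -- most μ/2. Chebyshev bounds this by (2D + 4μ)/(μ/2)² ≤ 1/32. Small μ costs 12/(4096√D) ≤ 1/32
  -- more.
  have h2 : ∀ e : ι ⊕ κ → β, prodExp (fun t => labelBias (b (e t)))
      (fun σ => if integerStat D (fun t => (σ t, e t)) ≤ rejectThreshold D then 1 else 0) ≤
        (if collisionMean b e ≤ 4096 * √(D : ℝ) / 4 then 1 else 0) + 1 / 32 := by
    intro e
    have hw' : IsWeight (fun t => labelBias (b (e t))) :=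
      ⟨fun t => hs.nonneg _, fun t => hs.sum_eq_one _⟩
    split_ifs with he
    · refine (prodExp.mono hw' (G := fun _ => 1) fun c => by split_ifs <;> norm_num).trans ?_
      rw [prodExp.const hw']
      norm_num
    · rw [not_le] at he
      have hv := collisionStat_variance hs hb (fun i => labelBias_mean _) e
      set μ := collisionMean b e
      have h3 := prodExp.chebyshev_lower hw' (a := μ / 2) (by linarith) hv
      rw [zero_add]
      refine (prodExp.mono hw' fun σ => ?_).trans (h3.trans ?_)
      · have h4 := (integerStat_bounds σ e).1
        by_cases h5 : integerStat D (fun t => (σ t, e t)) ≤ rejectThreshold D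
        · have h6 : (integerStat D (fun t => (σ t, e t)) : ℝ) ≤ rejectThreshold D := by
            exact_mod_cast h5
          have h7 : (rejectThreshold D : ℝ) < D * (6 * √D) + 1 := Int.ceil_lt_add_one _
          have h8 : (D : ℝ) * (collisionStat e σ - 1) ≤ D * (6 * √D + 1) := by
            rw [← hD] at h4
            linarith
          have h9 := le_of_mul_le_mul_left h8 (by linarith)
          rw [if_pos h5, if_pos (by linarith)]
        · rw [if_neg h5]; split_ifs <;> norm_num
      · rw [← hD, div_le_div_iff₀ (by nlinarith) (by norm_num)]
        nlinarith
  refine (prodExp.mono hw h2).trans ?_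
  rw [prodExp.add, prodExp.const hw]
  have h3 : 12 / (4096 * √(D : ℝ)) ≤ 1 / 32 := by
    rw [div_le_div_iff₀ hL (by norm_num)]; linarith
  linarith

end Round

/-! ## The test program -/

namespace Cmd

/-- The instructions of a nonempty list, one after the other. -/
def block : List Cmd → Cmd
  | [] => .const 19 0
  | [p] => p
  | p :: p' :: l => .seq p (block (p' :: l))

theorem exec_block_cons (inp : Input) (p p' : Cmd) (l : List Cmd) (s : State) :
    exec inp (block (p :: p' :: l)) s = exec inp (block (p' :: l)) (exec inp p s) := rfl

theorem exec_block_singleton (inp : Input) (p : Cmd) (s : State) :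
    exec inp (block [p]) s = exec inp p s := rfl

/-- The number of rounds is read once on entry, so an invariant indexed by the round suffices,
whatever the body does to the register. -/
theorem exec_loop_induct {inp : Input} {a : ℕ} {p : Cmd} {s : State} {n : ℕ}
    (hn : (s.reg a).toNat = n) (Inv : ℕ → State → Prop) (h0 : Inv 0 s.tick)
    (hs : ∀ j s, j < n → Inv j s → Inv (j + 1) (exec inp p s.tick)) :
    Inv n (exec inp (.loop a p) s) := by
  have : ∀ j ≤ n, Inv j ((fun s' => exec inp p s'.tick)^[j] s.tick) := by
    intro j
    induction j with
    | zero => exact fun _ => h0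
    | succ j ih =>
      intro hj
      rw [Function.iterate_succ_apply']
      exact hs j _ hj (ih (by omega))
  simpa [exec, hn] using this n le_rfl

/-- The number with the base `q` digits `f 0, …, f (r - 1)`. -/
def hornerKey (q : ℤ) (f : ℕ → ℤ) : ℕ → ℤ
  | 0 => 0
  | r + 1 => hornerKey q f r * q + f r

/-- Reads the key of a sample into register `12`. -/
def readKey (src : Bool) : Cmd :=
  .loop 3 (block [.sample src 14 9 13, .mul 12 12 4, .add 12 12 14, .add 13 13 7])

theorem exec_readKey (inp : Input) (src : Bool) (s : State) {r t : ℕ} {q : ℤ}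
    (h3 : s.reg 3 = r) (h4 : s.reg 4 = q) (h7 : s.reg 7 = 1) (h9 : s.reg 9 = t)
    (h12 : s.reg 12 = 0) (h13 : s.reg 13 = 0) :
    (exec inp (readKey src) s).mem = s.mem ∧
    (exec inp (readKey src) s).steps = s.steps + 1 + 5 * r ∧
    (exec inp (readKey src) s).reg 12 = hornerKey q (inp.sample src t) r ∧
    ∀ j, j ≠ 12 → j ≠ 13 → j ≠ 14 → (exec inp (readKey src) s).reg j = s.reg j := by
  have := exec_loop_induct (inp := inp) (a := 3) (s := s) (n := r)
    (p := block [.sample src 14 9 13, .mul 12 12 4, .add 12 12 14, .add 13 13 7]) (by simp [h3])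
    (fun i s' => s'.mem = s.mem ∧ s'.steps = s.steps + 1 + 5 * i ∧
      s'.reg 12 = hornerKey q (inp.sample src t) i ∧ s'.reg 13 = i ∧
      ∀ j, j ≠ 12 → j ≠ 13 → j ≠ 14 → s'.reg j = s.reg j)
    (by simp [State.tick, hornerKey, h12, h13])
    (by
      rintro i s' - ⟨hm, hst, hk, hi, hr⟩
      have e4 := hr 4 (by norm_num) (by norm_num) (by norm_num)
      have e7 := hr 7 (by norm_num) (by norm_num) (by norm_num)
      have e9 := hr 9 (by norm_num) (by norm_num) (by norm_num)
      rw [h4] at e4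
      rw [h7] at e7
      rw [h9] at e9
      refine ⟨?_, ?_, ?_, ?_, ?_⟩
      · simpa [exec, block, State.set, State.tick] using hm
      · simp [exec, block, State.set, State.tick, hst]; ring
      · simp [exec, block, State.set, State.tick, hk, hi, e4, e9,
          hornerKey]
      · simp [exec, block, State.set, State.tick, hi, e7]
      · intro j h1 h2 h3
        simp [exec, block, State.set, State.tick, h1, h2, h3, hr])
  exact ⟨this.1, this.2.1, this.2.2.1, this.2.2.2.2⟩

/-- Writes the value of the cell with count `17` and sign sum `18` into register `19`. -/
def cellCode : List Cmd := [.mul 19 18 18, .sub 19 19 17, .mul 19 5 19, .div 19 19 17]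

/-- Processes one sample. -/
def sampleCode : Cmd :=
  block ([.coin 11 9, .const 12 0, .const 13 0, .ifPos 11 (readKey true) (readKey false),
    .add 12 12 8, .sub 16 15 12, .load 17 12, .load 18 16] ++ cellCode ++
    [.sub 10 10 19, .add 17 17 7, .add 18 18 11, .add 18 18 11, .sub 18 18 7] ++ cellCode ++
    [.add 10 10 19, .store 12 17, .store 16 18, .add 9 9 7])

/-- Register layout: 0 votes, 1 rounds, 2 samples per round, 3 key length, 4 alphabet size, 5 number
of keys, 6 threshold, 7 the constant 1, 8 base address, 9 sample index, 10 running statistic, 15 the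
constant 0; the others are scratch. A count is stored at address k + base and the sign sum of the
same key at the negative address. -/
theorem exec_sampleCode (inp : Input) (s : State) {r t : ℕ} {q D base : ℤ} {k : ℤ}
    (h3 : s.reg 3 = r) (h4 : s.reg 4 = q) (h5 : s.reg 5 = D) (h7 : s.reg 7 = 1)
    (h8 : s.reg 8 = base) (h9 : s.reg 9 = t) (h15 : s.reg 15 = 0)
    (hk : hornerKey q (inp.sample (inp.coin t) t) r = k) :
    (exec inp sampleCode s).mem =
      Function.update (Function.update s.mem (k + base) (s.mem (k + base) + 1)) (-(k + base))
        (s.mem (-(k + base)) + bitSign (inp.coin t)) ∧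
    (exec inp sampleCode s).steps = s.steps + (26 + 5 * r) ∧
    (exec inp sampleCode s).reg 10 = s.reg 10 -
      cellValue D (s.mem (k + base)) (s.mem (-(k + base))) +
      cellValue D (s.mem (k + base) + 1) (s.mem (-(k + base)) + bitSign (inp.coin t)) ∧
    (exec inp sampleCode s).reg 9 = t + 1 ∧
    (exec inp sampleCode s).reg 15 = 0 ∧
    ∀ j ≤ 8, (exec inp sampleCode s).reg j = s.reg j := by
  set s0 := exec inp (.const 13 0) (exec inp (.const 12 0) (exec inp (.coin 11 9) s)) with hs0
  obtain ⟨s1, hs1, hm, hst, h12, h11, hr⟩ : ∃ s1,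
      exec inp (.ifPos 11 (readKey true) (readKey false)) s0 = s1 ∧ s1.mem = s.mem ∧
      s1.steps = s.steps + (5 + 5 * r) ∧ s1.reg 12 = k ∧
      s1.reg 11 = (if inp.coin t then 1 else 0) ∧
      ∀ j, j ≠ 11 → j ≠ 12 → j ≠ 13 → j ≠ 14 → s1.reg j = s.reg j := by
    refine ⟨_, rfl, ?_⟩
    have e : exec inp (.ifPos 11 (readKey true) (readKey false)) s0 =
        exec inp (readKey (inp.coin t)) s0.tick := by
      cases hc : inp.coin t <;>
        simp [exec, hs0, State.set, h9, hc]
    rw [e]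
    obtain ⟨a1, a2, a3, a4⟩ := exec_readKey inp (inp.coin t) s0.tick (r := r) (t := t) (q := q)
      (by simp [hs0, State.tick, exec, State.set, h3])
      (by simp [hs0, State.tick, exec, State.set, h4])
      (by simp [hs0, State.tick, exec, State.set, h7])
      (by simp [hs0, State.tick, exec, State.set, h9])
      (by simp [hs0, State.tick, exec, State.set])
      (by simp [hs0, State.tick, exec, State.set])
    refine ⟨?_, ?_, ?_, ?_, ?_⟩
    · rw [a1]; simp [hs0, State.tick, exec, State.set]
    · rw [a2]; simp [hs0, State.tick, exec, State.set]; ring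
    · rw [a3, hk]
    · rw [a4 11 (by norm_num) (by norm_num) (by norm_num)]
      simp [hs0, State.tick, exec, State.set, h9]
    · intro j j1 j2 j3 j4
      rw [a4 j j2 j3 j4]
      simp [hs0, State.tick, exec, State.set, j1, j2, j3]
  have e : exec inp sampleCode s = exec inp (block ([.add 12 12 8, .sub 16 15 12, .load 17 12,
      .load 18 16] ++ cellCode ++ [.sub 10 10 19, .add 17 17 7, .add 18 18 11, .add 18 18 11,
      .sub 18 18 7] ++ cellCode ++
      [.add 10 10 19, .store 12 17, .store 16 18, .add 9 9 7])) s1 := by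
    rw [← hs1, hs0]; rfl
  have r5 := hr 5 (by norm_num) (by norm_num) (by norm_num) (by norm_num)
  have r7 := hr 7 (by norm_num) (by norm_num) (by norm_num) (by norm_num)
  have r8 := hr 8 (by norm_num) (by norm_num) (by norm_num) (by norm_num)
  have r9 := hr 9 (by norm_num) (by norm_num) (by norm_num) (by norm_num)
  have r10 := hr 10 (by norm_num) (by norm_num) (by norm_num) (by norm_num)
  have r15 := hr 15 (by norm_num) (by norm_num) (by norm_num) (by norm_num)
  rw [h5] at r5
  rw [h7] at r7
  rw [h8] at r8
  rw [h9] at r9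
  rw [h15] at r15
  -- The sign is 2c - 1 for the coin value c in {0, 1}.
  have hsgn : ∀ x : ℤ, x + s1.reg 11 + s1.reg 11 - 1 = x + bitSign (inp.coin t) := by
    intro x
    rw [h11, bitSign]
    split_ifs <;> ring
  rw [e]
  simp only [cellCode, List.cons_append, List.nil_append, exec_block_cons, exec_block_singleton]
  refine ⟨?_, ?_, ?_, ?_, ?_, ?_⟩
  · simp [exec, State.set, r7, r8, r15, h12, hm, hsgn]
  · simp [exec, State.set, hst]; ring
  · simp [exec, State.set, r5, r7, r8, r10, r15, h12, hm, hsgn, cellValue]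
  · simp [exec, State.set, r7, r9]
  · simp [exec, State.set, r15]
  · intro j hj
    have hne : ∀ i, 8 < i → j ≠ i := fun i hi => by omega
    simp [exec, State.set, hne, hr]

end Cmd

/-! ### Effect of one more sample on the counts and the statistic -/

theorem labelCount_succ {β : Type*} [DecidableEq β] (z : ℕ → Bool × β) (j : ℕ) (i : β) :
    labelCount (fun t : Fin (j + 1) => z t) i =
      labelCount (fun t : Fin j => z t) i + if (z j).2 = i then 1 else 0 := by
  rw [labelCount, Fin.sum_univ_castSucc]; rfl

theorem labelSum_succ {β : Type*} [DecidableEq β] (z : ℕ → Bool × β) (j : ℕ) (i : β) :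
    labelSum (fun t : Fin (j + 1) => z t) i =
      labelSum (fun t : Fin j => z t) i + if (z j).2 = i then bitSign (z j).1 else 0 := by
  rw [labelSum, Fin.sum_univ_castSucc]; rfl

/-- Only the cell of the new element changes. The statistic can thus be maintained in constant time
per sample, without a pass over all D cells, which the time bound would not allow. -/
theorem integerStat_succ {β : Type*} [Fintype β] [DecidableEq β] (D : ℤ) (z : ℕ → Bool × β)
    (j : ℕ) :
    integerStat D (fun t : Fin (j + 1) => z t) = integerStat D (fun t : Fin j => z t) -
      cellValue D (labelCount (fun t : Fin j => z t) (z j).2)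
        (labelSum (fun t : Fin j => z t) (z j).2) +
      cellValue D (labelCount (fun t : Fin j => z t) (z j).2 + 1)
        (labelSum (fun t : Fin j => z t) (z j).2 + bitSign (z j).1) := by
  simp only [integerStat, labelCount_succ, labelSum_succ]
  rw [← Finset.add_sum_erase _ _ (Finset.mem_univ (z j).2),
    ← Finset.add_sum_erase (a := (z j).2) _ (fun i => cellValue D
      (labelCount (fun t : Fin j => z t) i) (labelSum (fun t : Fin j => z t) i))
      (Finset.mem_univ _)]
  simp only [if_true]
  rw [Finset.sum_congr rfl (s₁ := Finset.univ.erase (z j).2) fun i hi => by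
    rw [if_neg (Finset.ne_of_mem_erase hi).symm, if_neg (Finset.ne_of_mem_erase hi).symm,
      add_zero, add_zero]]
  ring

namespace Cmd

/-- One round: all its samples, then the vote. -/
def roundCode : Cmd :=
  block [.const 10 0, .loop 2 sampleCode, .add 8 8 5, .sub 19 10 6,
    .ifPos 19 (.add 0 0 7) (.sub 0 0 7)]

/-- The test: a majority vote of all rounds. -/
def testCode : Cmd := .loop 1 roundCode

/-- The memory holds the counts and sign sums of the labelled elements `z` behind `base`. -/
structure Tallied {D : ℕ} (base : ℤ) {j : ℕ} (z : Fin j → Bool × Fin D) (mem : ℤ → ℤ) :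
    Prop where
  count : ∀ i : Fin D, mem (i + base) = labelCount z i
  sum : ∀ i : Fin D, mem (-(i + base)) = labelSum z i
  fresh : ∀ x, base + D ≤ |x| → mem x = 0

/-- A base of at least 1 keeps counts at positive and sign sums at negative addresses, so the two
tables never overlap. -/
theorem Tallied.update {D : ℕ} {base : ℤ} (hbase : 1 ≤ base) {z : ℕ → Bool × Fin D} {j : ℕ}
    {mem : ℤ → ℤ} (h : Tallied base (fun t : Fin j => z t) mem) :
    Tallied base (fun t : Fin (j + 1) => z t)
      (Function.update (Function.update mem ((z j).2 + base) (mem ((z j).2 + base) + 1))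
        (-((z j).2 + base)) (mem (-((z j).2 + base)) + bitSign (z j).1)) where
  count i := by
    have h1 : (i : ℤ) + base ≠ -((z j).2 + base) := by omega
    rw [Function.update_of_ne h1, labelCount_succ, ← h.count]
    by_cases hi : (z j).2 = i
    · subst hi; simp
    · have : (i : ℤ) + base ≠ (z j).2 + base := fun h => hi (Fin.ext (by omega))
      rw [Function.update_of_ne this]
      simp [hi]
  sum i := by
    rw [labelSum_succ, ← h.sum]
    by_cases hi : (z j).2 = i
    · subst hi; simp
    · have h1 : -((i : ℤ) + base) ≠ (z j).2 + base := by omega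
      have h2 : -((i : ℤ) + base) ≠ -((z j).2 + base) := fun h => hi (Fin.ext (by omega))
      rw [Function.update_of_ne h2, Function.update_of_ne h1]
      simp [hi]
  fresh x hx := by
    have := (z j).2.isLt
    have h1 : x ≠ (z j).2 + base := by
      rintro rfl
      rw [abs_of_nonneg (by omega)] at hx
      omega
    have h2 : x ≠ -((z j).2 + base) := by
      rintro rfl
      rw [abs_neg, abs_of_nonneg (by omega)] at hx
      omega
    rw [Function.update_of_ne h2, Function.update_of_ne h1, h.fresh x hx]

/-- The labelled elements that the input `inp` shows to a test of samples with `r` coordinates. -/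
def Shows {D : ℕ} (inp : Input) (q r m : ℕ) (z : ℕ → Bool × Fin D) : Prop :=
  ∀ t < m, inp.coin t = (z t).1 ∧
    hornerKey q (inp.sample (inp.coin t) t) r = ((z t).2 : ℕ)

/-- The vote of one round. -/
def vote {β : Type*} [Fintype β] [DecidableEq β] {T : ℕ} (D θ : ℤ) (z : Fin T → Bool × β) : ℤ :=
  if θ < integerStat D z then 1 else -1

/-- Advancing the base by D hands an untouched block of zeros to the next round. Clearing the old
block would cost on the order of D steps. -/
theorem exec_roundCode {D : ℕ} (inp : Input) (s : State) {q r m T t₀ : ℕ} {θ base : ℤ}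
    {z : ℕ → Bool × Fin D} (hz : Shows inp q r m z) (hm : t₀ + T ≤ m) (hbase : 1 ≤ base)
    (h2 : s.reg 2 = T) (h3 : s.reg 3 = r) (h4 : s.reg 4 = q) (h5 : s.reg 5 = D)
    (h6 : s.reg 6 = θ) (h7 : s.reg 7 = 1) (h8 : s.reg 8 = base) (h9 : s.reg 9 = t₀)
    (h15 : s.reg 15 = 0) (hmem : ∀ x, base ≤ |x| → s.mem x = 0) :
    (∀ x, base + D ≤ |x| → (exec inp roundCode s).mem x = 0) ∧
    (exec inp roundCode s).steps = s.steps + (6 + T * (27 + 5 * r)) ∧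
    (exec inp roundCode s).reg 0 = s.reg 0 + vote D θ (fun t : Fin T => z (t₀ + t)) ∧
    (exec inp roundCode s).reg 8 = base + D ∧
    (exec inp roundCode s).reg 9 = (t₀ + T : ℕ) ∧
    (exec inp roundCode s).reg 15 = 0 ∧
    ∀ j, 1 ≤ j → j ≤ 7 → (exec inp roundCode s).reg j = s.reg j := by
  set s0 := exec inp (.const 10 0) s with hs0
  obtain ⟨hT, hst, h10', h9', h15', hr⟩ := exec_loop_induct (inp := inp) (a := 2) (s := s0)
    (p := sampleCode) (n := T) (by simp [hs0, exec, State.set, h2])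
    (fun j s' => Tallied base (fun t : Fin j => z (t₀ + t)) s'.mem ∧
      s'.steps = s.steps + 2 + j * (27 + 5 * r) ∧
      s'.reg 10 = integerStat D (fun t : Fin j => z (t₀ + t)) ∧
      s'.reg 9 = (t₀ + j : ℕ) ∧ s'.reg 15 = 0 ∧ ∀ i ≤ 8, s'.reg i = s.reg i)
    (by
      refine ⟨⟨?_, ?_, ?_⟩, ?_, ?_, ?_, ?_, ?_⟩
      · intro i
        simp only [hs0, exec, State.set, State.tick, labelCount, Finset.univ_eq_empty,
          Finset.sum_empty]
        exact hmem _ (by rw [abs_of_nonneg (by omega)]; omega)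
      · intro i
        simp only [hs0, exec, State.set, State.tick, labelSum, Finset.univ_eq_empty,
          Finset.sum_empty]
        exact hmem _ (by rw [abs_neg, abs_of_nonneg (by omega)]; omega)
      · intro x hx
        exact hmem x (by omega)
      · simp [hs0, exec, State.set, State.tick]
      · simp [hs0, exec, State.set, State.tick, integerStat, labelCount, labelSum, cellValue]
      · simp [hs0, exec, State.set, State.tick, h9]
      · simp [hs0, exec, State.set, State.tick, h15]
      · intro i hi
        have : i ≠ 10 := by omega
        simp [hs0, exec, State.set, State.tick, this])
    (by
      rintro j s' hj ⟨hT, hst, h10', h9', h15', hr⟩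
      obtain ⟨hc, hk⟩ := hz (t₀ + j) (by omega)
      obtain ⟨a1, a2, a3, a4, a5, a6⟩ := exec_sampleCode inp s'.tick (r := r) (t := t₀ + j)
        (q := q) (D := D) (base := base) (k := ((z (t₀ + j)).2 : ℕ))
        (by simp [State.tick, hr, h3]) (by simp [State.tick, hr, h4])
        (by simp [State.tick, hr, h5]) (by simp [State.tick, hr, h7])
        (by simp [State.tick, hr, h8]) h9' h15' hk
      rw [hc] at a1 a3
      refine ⟨?_, ?_, ?_, ?_, a5, ?_⟩
      · rw [a1]
        exact Tallied.update (z := fun t => z (t₀ + t)) hbase hT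
      · rw [a2]; simp only [State.tick, hst]; ring
      · rw [a3, integerStat_succ (D : ℤ) (fun t => z (t₀ + t))]
        simp only [State.tick]
        rw [h10', hT.count, hT.sum]
      · rw [a4]; push_cast; ring
      · intro i hi
        rw [a6 i hi]
        exact hr i hi)
  simp only [roundCode, exec_block_cons, exec_block_singleton]
  rw [← hs0]
  set s1 := exec inp (.loop 2 sampleCode) s0
  have r0 := hr 0 (by norm_num)
  have r5 := hr 5 (by norm_num)
  have r6 := hr 6 (by norm_num)
  have r7 := hr 7 (by norm_num)
  have r8 := hr 8 (by norm_num)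
  rw [h5] at r5
  rw [h6] at r6
  rw [h7] at r7
  rw [h8] at r8
  have hif : ∀ s' : State, (exec inp (.ifPos 19 (.add 0 0 7) (.sub 0 0 7)) s').mem = s'.mem ∧
      (exec inp (.ifPos 19 (.add 0 0 7) (.sub 0 0 7)) s').steps = s'.steps + 2 ∧
      (exec inp (.ifPos 19 (.add 0 0 7) (.sub 0 0 7)) s').reg =
        Function.update s'.reg 0 (if 0 < s'.reg 19 then s'.reg 0 + s'.reg 7
          else s'.reg 0 - s'.reg 7) := by
    intro s'
    simp only [exec]
    split_ifs <;> simp [State.set, State.tick]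
  obtain ⟨i1, i2, i3⟩ := hif (exec inp (.sub 19 10 6) (exec inp (.add 8 8 5) s1))
  rw [i1, i2, i3]
  refine ⟨?_, ?_, ?_, ?_, ?_, ?_, ?_⟩
  · exact hT.fresh
  · simp only [exec, State.set, hst]; ring
  · simp only [exec, State.set, vote]
    simp [h10', r0, r6, r7]
    split_ifs <;> ring
  · simp [exec, State.set, r8, r5]
  · simp [exec, State.set, h9']
  · simp [exec, State.set, h15']
  · intro j hj1 hj2
    have n1 : j ≠ 0 := by omega
    have n2 : j ≠ 19 := by omega
    have n3 : j ≠ 8 := by omega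
    simp [exec, State.set, n1, n2, n3, hr j (by omega)]

theorem exec_testCode {D : ℕ} (inp : Input) (s : State) {q r R T : ℕ} {θ : ℤ}
    {z : ℕ → Bool × Fin D} (hz : Shows inp q r (R * T) z)
    (h0 : s.reg 0 = 0) (h1 : s.reg 1 = R)
    (h2 : s.reg 2 = T) (h3 : s.reg 3 = r) (h4 : s.reg 4 = q) (h5 : s.reg 5 = D)
    (h6 : s.reg 6 = θ) (h7 : s.reg 7 = 1) (h8 : s.reg 8 = 1) (h9 : s.reg 9 = 0)
    (h15 : s.reg 15 = 0) (hmem : s.mem = fun _ => 0) :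
    (exec inp testCode s).steps = s.steps + 1 + R * (7 + T * (27 + 5 * r)) ∧
    (exec inp testCode s).reg 0 =
      ∑ j : Fin R, vote D θ (fun t : Fin T => z (j * T + t)) := by
  obtain ⟨b1, b2, b3, b4, b5, b6, b7⟩ := exec_loop_induct (inp := inp) (a := 1) (s := s)
    (p := roundCode) (n := R) (by simp [h1])
    (fun j s' => (∀ x : ℤ, 1 + ((j * D : ℕ) : ℤ) ≤ |x| → s'.mem x = 0) ∧
      s'.steps = s.steps + 1 + j * (7 + T * (27 + 5 * r)) ∧
      s'.reg 0 = ∑ i : Fin j, vote D θ (fun t : Fin T => z (i * T + t)) ∧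
      s'.reg 8 = 1 + (j * D : ℕ) ∧ s'.reg 9 = (j * T : ℕ) ∧ s'.reg 15 = 0 ∧
      ∀ i, 1 ≤ i → i ≤ 7 → s'.reg i = s.reg i)
    (by simp [State.tick, hmem, h0, h8, h9, h15])
    (by
      rintro j s' hj ⟨b1, b2, b3, b4, b5, b6, b7⟩
      obtain ⟨a1, a2, a3, a4, a5, a6, a7⟩ := exec_roundCode inp s'.tick (q := q) (r := r)
        (m := R * T) (T := T) (t₀ := j * T) (θ := θ) (base := 1 + (j * D : ℕ)) hz
        (by rw [← Nat.succ_mul]; exact Nat.mul_le_mul_right T hj)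
        (by omega) (by simp [State.tick, b7, h2]) (by simp [State.tick, b7, h3])
        (by simp [State.tick, b7, h4]) (by simp [State.tick, b7, h5])
        (by simp [State.tick, b7, h6]) (by simp [State.tick, b7, h7]) b4 b5 b6 b1
      have e : ((1 : ℤ) + ((j + 1) * D : ℕ)) = 1 + (j * D : ℕ) + D := by push_cast; ring
      refine ⟨?_, ?_, ?_, ?_, ?_, a6, ?_⟩
      · rw [e]; exact a1
      · rw [a2]; simp only [State.tick, b2]; ring
      · rw [a3, Fin.sum_univ_castSucc]
        simp only [State.tick, b3, Fin.val_castSucc, Fin.val_last]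
      · rw [a4, e]
      · rw [a5]; congr 1; ring
      · intro i hi1 hi2
        rw [a7 i hi1 hi2]
        exact b7 i hi1 hi2)
  exact ⟨b2, b3⟩

end Cmd

/-! ## The squared Hellinger test -/

/-- The sum of the votes of `R` rounds with `T` samples each. -/
def totalVote {D R T : ℕ} (Z : Fin (R * T) → Bool × Fin D) : ℤ :=
  ∑ j : Fin R, Cmd.vote D (rejectThreshold D) fun t : Fin T => Z (finProdFinEquiv (j, t))

theorem totalVote_eq {D R T : ℕ} (Z : Fin (R * T) → Bool × Fin D) :
    totalVote Z = 2 * (Finset.univ.filter fun j : Fin R => rejectThreshold D <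
      integerStat D fun t : Fin T => Z (finProdFinEquiv (j, t))).card - R := by
  have e : ∀ j : Fin R, Cmd.vote D (rejectThreshold D)
      (fun t : Fin T => Z (finProdFinEquiv (j, t))) = 2 * (if rejectThreshold D <
        integerStat D fun t : Fin T => Z (finProdFinEquiv (j, t)) then 1 else 0) - 1 := by
    intro j
    rw [Cmd.vote]
    split_ifs <;> norm_num
  simp only [totalVote, e, Finset.sum_sub_distrib, ← Finset.mul_sum]
  simp

theorem prodExp_rounds {α : Type*} [Fintype α] {R T : ℕ} (w : α → ℝ)
    (F : (Fin R → Fin T → α) → ℝ) :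
    prodExp (fun _ : Fin (R * T) => w) (fun Z => F fun j t => Z (finProdFinEquiv (j, t))) =
      prodExp (fun _ : Fin R => fun z : Fin T → α => ∏ t, w (z t)) F := by
  rw [prodExp.reindex finProdFinEquiv]
  simp only [Equiv.symm_apply_apply]
  rw [prodExp.curry]

/-- A positive vote means that more than half of the rounds reject. `prodExp.majority` counts ties
as failures, so it covers this strict case as well as the non-strict one under the alternative. -/
theorem totalVote_null {D R T : ℕ} [NeZero D] {p : Fin D → ℝ} (hp : ∀ i, 0 ≤ p i)
    (hp1 : ∑ i, p i = 1) :
    prodExp (fun _ : Fin (R * T) => labelWeight p p)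
      (fun Z => if 0 < totalVote Z then 1 else 0) ≤ (1 / 2) ^ R := by
  have hw := isWeight_labelWeight hp hp hp1 hp1
  have h1 := integerStat_null (ι := Fin T) hp hp1
  rw [Fintype.card_fin] at h1
  have h2 := prodExp.majority (R := R) (prodExp.isWeight_pi (hw (Fin T)) (Fin R))
    (fun z => rejectThreshold D < integerStat D z) h1
  rw [← prodExp_rounds] at h2
  refine (prodExp.mono (hw _) fun Z => ?_).trans h2
  rw [totalVote_eq]
  beta_reduce
  split_ifs with h3 h4
  · exact le_rfl
  · omega
  · norm_num
  · exact le_rfl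

theorem totalVote_alternative {D R n : ℕ} [NeZero D] [NeZero n] {p q : Fin D → ℝ}
    (hp : ∀ i, 0 ≤ p i) (hq : ∀ i, 0 ≤ q i) (hp1 : ∑ i, p i = 1) (hq1 : ∑ i, q i = 1)
    (h : 8192 * (D : ℝ) ^ (3 / 4 : ℝ) ≤ n * hellingerSq p q) :
    prodExp (fun _ : Fin (R * (n + n)) => labelWeight p q)
      (fun Z => if 0 < totalVote Z then 0 else 1) ≤ (1 / 2) ^ R := by
  have hw := isWeight_labelWeight hp hq hp1 hq1
  have h1 := integerStat_alternative (ι := Fin n) (κ := Fin n) rfl hp hq hp1 hq1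
    (by simpa using h)
  rw [Fintype.card_fin] at h1
  have h1' : prodExp (fun _ : Fin (n + n) => labelWeight p q)
      (fun z => if integerStat D z ≤ rejectThreshold D then 1 else 0) ≤ 1 / 16 := by
    -- The statistic is symmetric in the positions, so a round may be split into two halves for the
    -- analysis only.
    rw [prodExp.reindex finSumFinEquiv]
    refine le_trans (le_of_eq ?_) h1
    congr 1
    funext z
    have : integerStat D (fun t => z (finSumFinEquiv.symm t)) = integerStat D z := by
      have e1 : ∀ i, labelCount (fun t => z (finSumFinEquiv.symm t)) i = labelCount z i :=
        fun i => Equiv.sum_comp finSumFinEquiv.symm (fun t => if (z t).2 = i then (1 : ℤ) else 0)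
      have e2 : ∀ i, labelSum (fun t => z (finSumFinEquiv.symm t)) i = labelSum z i :=
        fun i => Equiv.sum_comp finSumFinEquiv.symm
          (fun t => if (z t).2 = i then bitSign (z t).1 else 0)
      simp only [integerStat, e1, e2]
    rw [this]
  have h2 := prodExp.majority (R := R) (prodExp.isWeight_pi (hw (Fin (n + n))) (Fin R))
    (fun z => integerStat D z ≤ rejectThreshold D) h1'
  rw [← prodExp_rounds] at h2
  refine (prodExp.mono (hw _) fun Z => ?_).trans h2
  have hc : (Finset.univ.filter fun j : Fin R => rejectThreshold D <
      integerStat D fun t : Fin (n + n) => Z (finProdFinEquiv (j, t))).card +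
      (Finset.univ.filter fun j : Fin R =>
      integerStat D (fun t : Fin (n + n) => Z (finProdFinEquiv (j, t))) ≤
        rejectThreshold D).card = R := by
    have := Finset.card_filter_add_card_filter_not (s := (Finset.univ : Finset (Fin R)))
      (fun j => rejectThreshold D <
        integerStat D fun t : Fin (n + n) => Z (finProdFinEquiv (j, t)))
    simpa only [not_lt, Finset.card_univ, Fintype.card_fin] using this
  rw [totalVote_eq]
  beta_reduce
  split_ifs with h3 h4 h4
  · norm_num
  · exact le_rfl
  · exact le_rfl
  · omega

/-- The number of coordinates of a sample that have to be read. -/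
def keyLength (q r : ℕ) : ℕ := if 2 ≤ q then r else 0

/-- The number of keys of samples. -/
def keyCount (q r : ℕ) : ℕ := q ^ keyLength q r

theorem keyCount_pos (q r : ℕ) : 0 < keyCount q r := by
  rw [keyCount, keyLength]
  split_ifs with h
  · positivity
  · simp

instance (q r : ℕ) : NeZero (keyCount q r) := ⟨(keyCount_pos q r).ne'⟩

/-- Half the number of samples of a round. -/
def halfRound (q r : ℕ) (τ : ℝ) : ℕ := ⌈8192 * (keyCount q r : ℝ) ^ (3 / 4 : ℝ) / τ⌉₊

/-- The number of rounds. -/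
def numRounds (δ : ℝ) : ℕ := ⌈Real.logb 2 (1 / δ)⌉₊

theorem half_pow_numRounds_le {δ : ℝ} (hδ : 0 < δ) : (1 / 2 : ℝ) ^ numRounds δ ≤ δ := by
  have h1 : Real.logb 2 (1 / δ) ≤ numRounds δ := Nat.le_ceil _
  rw [Real.logb_le_iff_le_rpow (by norm_num) (by positivity), Real.rpow_natCast] at h1
  rw [one_div_pow]
  exact (one_div_le (by positivity) hδ).2 h1

/-- The squared Hellinger test: in each round every coin chooses one of the two sources, and the
scaled sum of `(S² - N) / N` over all the keys, where `N` is the number of occurrences of the key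
and `S` the sum of the signs of their coins, is compared with a threshold. -/
def hellingerTest : TwoSampleTest where
  prog := Cmd.testCode
  samples q r τ δ := numRounds δ * (halfRound q r τ + halfRound q r τ)
  coins q r τ δ := numRounds δ * (halfRound q r τ + halfRound q r τ)
  arity := 9
  args q r τ δ := ![0, numRounds δ, (halfRound q r τ + halfRound q r τ : ℕ), keyLength q r, q,
    keyCount q r, rejectThreshold (keyCount q r), 1, 1]

/-- The labelled keys that the test sees. -/
def extendLabels {D m : ℕ} [NeZero D] (Z : Fin m → Bool × Fin D) (t : ℕ) : Bool × Fin D :=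
  if h : t < m then Z ⟨t, h⟩ else (false, 0)

theorem hellingerTest_final {q r : ℕ} {τ δ : ℝ} {inp : Cmd.Input}
    {Z : Fin (numRounds δ * (halfRound q r τ + halfRound q r τ)) →
      Bool × Fin (keyCount q r)}
    (hZ : ∀ t : Fin (numRounds δ * (halfRound q r τ + halfRound q r τ)), inp.coin t = (Z t).1 ∧
      Cmd.hornerKey q (inp.sample (inp.coin t) t) (keyLength q r) = ((Z t).2 : ℕ)) :
    hellingerTest.rejects q r τ δ inp = decide (0 < totalVote Z) ∧
    hellingerTest.steps q r τ δ inp = 1 + numRounds δ * (7 +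
      (halfRound q r τ + halfRound q r τ) * (27 + 5 * keyLength q r)) := by
  have hshow : Cmd.Shows inp q (keyLength q r)
      (numRounds δ * (halfRound q r τ + halfRound q r τ)) (extendLabels Z) := by
    intro t ht
    rw [extendLabels, dif_pos ht]
    exact hZ ⟨t, ht⟩
  obtain ⟨h1, h2⟩ := Cmd.exec_testCode inp
    { reg := fun i => if h : i < hellingerTest.arity then hellingerTest.args q r τ δ ⟨i, h⟩ else 0
      mem := fun _ => 0
      steps := 0 } (θ := rejectThreshold (keyCount q r)) hshow rfl rfl rfl rfl rfl rfl rfl rfl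
      rfl rfl rfl rfl
  constructor
  · rw [TwoSampleTest.rejects, TwoSampleTest.final]
    change decide (0 < (Cmd.exec inp Cmd.testCode _).reg 0) = _
    rw [h2]
    congr 2
    rw [totalVote]
    refine Finset.sum_congr rfl fun j _ => ?_
    congr 1
    funext t
    have e : (j : ℕ) * (halfRound q r τ + halfRound q r τ) + t =
        (finProdFinEquiv (j, t) : Fin _) := by
      simp [finProdFinEquiv]; ring
    rw [extendLabels, e, dif_pos (Fin.isLt _)]
  · rw [TwoSampleTest.steps, TwoSampleTest.final]
    change (Cmd.exec inp Cmd.testCode _).steps = _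
    rw [h1]

/-! ## Summing out variables without children -/

section SumOut

variable {n q : ℕ}

/-- Exchanging the coordinate at `v` with the spare letter is an involution of the pairs (x, β). -/
theorem sum_update (v : Fin n) (Φ : (Fin n → Fin q) → ℝ) :
    ∑ x, ∑ β, Φ (Function.update x v β) = q * ∑ x, Φ x := by
  let φ : (Fin n → Fin q) × Fin q → (Fin n → Fin q) × Fin q := fun p =>
    (Function.update p.1 v p.2, p.1 v)
  have hφ : Function.Involutive φ := by
    rintro ⟨x, β⟩
    simp [φ]
  rw [← Fintype.sum_prod_type' (f := fun x β => Φ (Function.update x v β))]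
  have := Equiv.sum_comp hφ.toPerm (fun p => Φ p.1)
  simp only [Function.Involutive.coe_toPerm, φ] at this
  rw [this, Fintype.sum_prod_type, Finset.mul_sum]
  simp

/-- The variables in `O` occur only as arguments of their own factors, so they can be averaged one
at a time. The factor 1/q appears because the right-hand sum still runs over all coordinates,
including those in `O`. -/
theorem sum_out (hq : q ≠ 0) (O : Finset (Fin n)) {F : (Fin n → Fin q) → ℝ}
    {g : Fin n → Fin q → (Fin n → Fin q) → ℝ}
    (hF : ∀ x y : Fin n → Fin q, (∀ u ∉ O, x u = y u) → F x = F y)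
    (hg : ∀ v ∈ O, ∀ β, ∀ x y : Fin n → Fin q, (∀ u ∉ O, x u = y u) → g v β x = g v β y) :
    ∑ x, F x * ∏ v ∈ O, g v (x v) x = ∑ x, F x * ∏ v ∈ O, ((q : ℝ)⁻¹ * ∑ β, g v β x) := by
  have key : ∀ s ⊆ O, ∀ F : (Fin n → Fin q) → ℝ,
      (∀ x y : Fin n → Fin q, (∀ u ∉ s, x u = y u) → F x = F y) →
      ∑ x, F x * ∏ v ∈ s, g v (x v) x = ∑ x, F x * ∏ v ∈ s, ((q : ℝ)⁻¹ * ∑ β, g v β x) := by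
    intro s
    induction s using Finset.induction_on with
    | empty => intro _ F _; simp
    | insert a s ha ih =>
      intro hs F hF
      have haO := hs (Finset.mem_insert_self a s)
      have hsO : s ⊆ O := fun u hu => hs (Finset.mem_insert_of_mem hu)
      simp only [Finset.prod_insert ha, ← mul_assoc]
      rw [ih hsO (fun x => F x * g a (x a) x)]
      · have h1 := sum_update a
          (fun x => F x * g a (x a) x * ∏ v ∈ s, ((q : ℝ)⁻¹ * ∑ β, g v β x))
        have hq' : (q : ℝ) ≠ 0 := by exact_mod_cast hq
        rw [← mul_left_cancel_iff_of_pos (a := (q : ℝ)) (by positivity), ← h1, Finset.mul_sum]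
        refine Finset.sum_congr rfl fun x _ => ?_
        have e : ∀ β, ∀ u ∉ O, Function.update x a β u = x u := fun β u hu =>
          Function.update_of_ne (fun h : u = a => hu (by rwa [h])) _ _
        have e1 : ∀ β, F (Function.update x a β) = F x := fun β =>
          hF _ _ fun u hu => Function.update_of_ne
            (fun h : u = a => hu (h ▸ Finset.mem_insert_self a s)) _ _
        have e2 : ∀ β, ∏ v ∈ s, ((q : ℝ)⁻¹ * ∑ γ, g v γ (Function.update x a β)) =
            ∏ v ∈ s, ((q : ℝ)⁻¹ * ∑ γ, g v γ x) := fun β =>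
          Finset.prod_congr rfl fun v hv => by
            simp only [hg v (hsO hv) _ _ _ (e β)]
        simp only [e1, e2, Function.update_self, hg a haO _ _ _ (e _)]
        rw [← Finset.sum_mul, ← Finset.mul_sum]
        field_simp
      · intro x y h
        have h1 : x a = y a := h a ha
        rw [hF x y fun u hu => h u fun hus => hu (Finset.mem_insert_of_mem hus), h1,
          hg a haO _ x y fun u hu => h u fun hus => hu (hsO hus)]
  exact key O subset_rfl F hF

end SumOut

/-! ## Causal models -/

namespace CausalModel

variable {n k q : ℕ} {G : KPartiteDesign n k} (M : CausalModel G q)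

/-- The factor `P(x_v = β | pa_v)`. -/
def factor (v : Fin n) (β : Fin q) (x : Fin n → Fin q) : ℝ := (M.cpd v fun u => x u).1 β

theorem factor_nonneg (v : Fin n) (β : Fin q) (x : Fin n → Fin q) : 0 ≤ M.factor v β x :=
  (M.cpd v fun u => x u).2.1 β

theorem sum_factor (v : Fin n) (x : Fin n → Fin q) : ∑ β, M.factor v β x = 1 :=
  (M.cpd v fun u => x u).2.2

theorem factor_congr {v : Fin n} (β : Fin q) {x y : Fin n → Fin q}
    (h : ∀ u ∈ G.parents v, x u = y u) : M.factor v β x = M.factor v β y := by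
  have : (fun u : G.parents v => x u) = fun u : G.parents v => y u := funext fun u => h u u.2
  simp only [factor, this]

theorem P_eq (x : Fin n → Fin q) : M.P x = ∏ v, M.factor v (x v) x := rfl

theorem P_nonneg (x : Fin n → Fin q) : 0 ≤ M.P x :=
  Finset.prod_nonneg fun v _ => M.factor_nonneg v _ x

theorem layer_lt_of_mem_parents {u v : Fin n} (h : u ∈ G.parents v) : G.layer u < G.layer v :=
  G.layer_lt (u, v) (Finset.mem_filter.1 h).2

/-- A variable in the lowest occupied layer has no parents, so its conditional exists, and there is
no probability vector on an empty alphabet. -/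
theorem alphabet_ne_zero (M : CausalModel G q) (hn : n ≠ 0) : q ≠ 0 := by
  rintro rfl
  have : Nonempty (Fin n) := ⟨⟨0, Nat.pos_of_ne_zero hn⟩⟩
  obtain ⟨v, -, hv⟩ := Finset.exists_min_image (Finset.univ : Finset (Fin n)) G.layer
    Finset.univ_nonempty
  have f : G.parents v → Fin 0 := fun u =>
    absurd (layer_lt_of_mem_parents u.2) (not_lt.2 (hv u (Finset.mem_univ _)))
  simpa using (M.cpd v f).2.2

/-- Induction over the layers, with all factors from layer `l` on replaced by 1/q: passing to `l +
1` sums out layer `l`, none of whose variables is a parent of a variable whose factor is present.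
The case `l = 0` is the uniform distribution and `l = k` is `P`. -/
theorem sum_P : ∑ x, M.P x = 1 := by
  rcases Nat.eq_zero_or_pos n with rfl | hn
  · simp [P]
  have hq := M.alphabet_ne_zero hn.ne'
  have hq' : (q : ℝ) ≠ 0 := by exact_mod_cast hq
  have key : ∀ l : ℕ, ∑ x : Fin n → Fin q,
      ∏ v, (if (G.layer v : ℕ) < l then M.factor v (x v) x else (q : ℝ)⁻¹) = 1 := by
    intro l
    induction l with
    | zero => simp [hq']
    | succ l ih =>
      rw [← ih]
      set O := Finset.univ.filter fun v => (G.layer v : ℕ) = l with hO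
      set F : (Fin n → Fin q) → ℝ := fun x =>
        ∏ v ∈ Oᶜ, (if (G.layer v : ℕ) < l then M.factor v (x v) x else (q : ℝ)⁻¹) with hFdef
      have hpar : ∀ v, (G.layer v : ℕ) ≤ l → ∀ x y : Fin n → Fin q, (∀ u ∉ O, x u = y u) →
          ∀ u ∈ G.parents v, x u = y u := by
        intro v hv x y h u hu
        have := layer_lt_of_mem_parents hu
        refine h u ?_
        simp only [hO, Finset.mem_filter, Finset.mem_univ, true_and]
        omega
      have hF : ∀ x y : Fin n → Fin q, (∀ u ∉ O, x u = y u) → F x = F y := by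
        intro x y h
        refine Finset.prod_congr rfl fun v hv => ?_
        split_ifs with hl
        · rw [M.factor_congr _ (hpar v hl.le x y h), h v (Finset.mem_compl.1 hv)]
        · rfl
      have e1 : ∀ x : Fin n → Fin q, ∏ v, (if (G.layer v : ℕ) < l + 1 then M.factor v (x v) x
          else (q : ℝ)⁻¹) = F x * ∏ v ∈ O, M.factor v (x v) x := by
        intro x
        rw [← Finset.prod_compl_mul_prod O]
        congr 1
        · refine Finset.prod_congr rfl fun v hv => ?_
          have : (G.layer v : ℕ) ≠ l := by simpa [hO] using hv
          by_cases hl : (G.layer v : ℕ) < l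
          · rw [if_pos hl, if_pos (by omega)]
          · rw [if_neg hl, if_neg (by omega)]
        · refine Finset.prod_congr rfl fun v hv => ?_
          have : (G.layer v : ℕ) = l := by simpa [hO] using hv
          rw [if_pos (by omega)]
      have e2 : ∀ x : Fin n → Fin q, ∏ v, (if (G.layer v : ℕ) < l then M.factor v (x v) x
          else (q : ℝ)⁻¹) = F x * ∏ v ∈ O, (q : ℝ)⁻¹ := by
        intro x
        rw [← Finset.prod_compl_mul_prod O]
        congr 1
        refine Finset.prod_congr rfl fun v hv => ?_
        have : (G.layer v : ℕ) = l := by simpa [hO] using hv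
        rw [if_neg (by omega)]
      simp only [e1, e2]
      rw [sum_out hq O hF (g := fun v β x => M.factor v β x)]
      · simp only [sum_factor, mul_one]
      · intro v hv β x y h
        exact M.factor_congr β (hpar v (by simpa [hO] using (Finset.mem_filter.1 hv).2.le) x y h)
  have := key k
  simpa only [Fin.is_lt, if_true, P_eq] using this

theorem marginal_nonneg (u : Fin n) (a : Fin q) : 0 ≤ M.marginal u a :=
  Finset.sum_nonneg fun x _ => by split_ifs <;> simp [M.P_nonneg x]

theorem sum_marginal (u : Fin n) : ∑ a, M.marginal u a = 1 := by
  simp only [marginal]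
  rw [Finset.sum_comm, ← M.sum_P]
  exact Finset.sum_congr rfl fun x _ => by simp

theorem P_le_marginal (u : Fin n) (x : Fin n → Fin q) : M.P x ≤ M.marginal u (x u) := by
  have := Finset.single_le_sum (f := fun y : Fin n → Fin q => if y u = x u then M.P y else 0)
    (fun y _ => by split_ifs <;> simp [M.P_nonneg y]) (Finset.mem_univ x)
  simpa [marginal] using this

/-- The model of the distribution after intervention. -/
def intervened (S : Finset (Fin n × Fin n)) : CausalModel G q where
  cpd v pa := ⟨fun a => ∑ y : {u : Fin n // (u, v) ∈ S} → Fin q,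
      (M.cpd v fun u => if h : ((u : Fin n), v) ∈ S then y ⟨u, h⟩ else pa u).1 a *
        ∏ u : {u : Fin n // (u, v) ∈ S}, M.marginal u.1 (y u), by
    refine ⟨fun a => Finset.sum_nonneg fun y _ => mul_nonneg ((M.cpd v _).2.1 a)
      (Finset.prod_nonneg fun u _ => M.marginal_nonneg _ _), ?_⟩
    rw [Finset.sum_comm]
    simp only [← Finset.sum_mul]
    have h := Finset.prod_univ_sum (fun _ : {u : Fin n // (u, v) ∈ S} => Finset.univ)
      (fun u a => M.marginal u.1 a)
    simp only [sum_marginal, Finset.prod_const_one, Fintype.piFinset_univ] at h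
    rw [h]
    refine Finset.sum_congr rfl fun y _ => ?_
    rw [(M.cpd v fun u => if h : ((u : Fin n), v) ∈ S then y ⟨u, h⟩ else pa u).2.2, one_mul]⟩

/-- Averaging a conditional over independent parents gives a conditional on the same parent set, so
all facts about `P` apply to the intervened distribution. -/
theorem PS_eq (S : Finset (Fin n × Fin n)) : M.PS S = (M.intervened S).P := rfl

theorem intervened_factor_of_no_edge {S : Finset (Fin n × Fin n)} {v : Fin n}
    (h : ∀ u, (u, v) ∉ S) (β : Fin q) (x : Fin n → Fin q) :
    (M.intervened S).factor v β x = M.factor v β x := by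
  have : IsEmpty {u : Fin n // (u, v) ∈ S} := ⟨fun u => h u.1 u.2⟩
  simp [factor, intervened, h]

/-- If a factor of P_S vanishes at x, so does its summand in which the replaced parents take their
values in x. Then the conditional or a marginal vanishes at x, and each of them forces P(x) = 0. -/
theorem P_eq_zero_of_PS_eq_zero (S : Finset (Fin n × Fin n)) {x : Fin n → Fin q}
    (h : M.PS S x = 0) : M.P x = 0 := by
  obtain ⟨v, -, hv⟩ := Finset.prod_eq_zero_iff.1 h
  rw [Finset.sum_eq_zero_iff_of_nonneg fun y _ => mul_nonneg ((M.cpd v _).2.1 _)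
      (Finset.prod_nonneg fun u _ => M.marginal_nonneg _ _)] at hv
  have h1 := hv (fun u => x u.1) (Finset.mem_univ _)
  have e : (fun u : G.parents v => if h : ((u : Fin n), v) ∈ S then
      (fun u : {u : Fin n // (u, v) ∈ S} => x u.1) ⟨u, h⟩ else x u) = fun u : G.parents v => x u := by
    funext u; split_ifs <;> rfl
  rw [e] at h1
  rcases mul_eq_zero.1 h1 with h2 | h2
  · exact Finset.prod_eq_zero (Finset.mem_univ v) h2
  · obtain ⟨u, -, hu⟩ := Finset.prod_eq_zero_iff.1 h2
    exact le_antisymm (hu ▸ M.P_le_marginal u.1 x) (M.P_nonneg x)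

end CausalModel

/-! ## Squared Hellinger distances of causal models -/

theorem phiDiv_hellingerPhi_eq {X : Type*} [Fintype X] {p q : X → ℝ} (hq : ∀ x, 0 ≤ q x)
    (h : ∀ x, q x = 0 → p x = 0) : phiDiv hellingerPhi p q = hellingerSq p q := by
  refine Finset.sum_congr rfl fun x _ => ?_
  rcases (hq x).eq_or_lt with h0 | h0
  · rw [h x h0.symm, ← h0]; simp
  · rw [hellingerPhi, Real.sqrt_div' _ h0.le]
    have h1 : √(q x) ≠ 0 := (Real.sqrt_pos.2 h0).ne'
    have h2 : q x = √(q x) ^ 2 := (Real.sq_sqrt h0.le).symm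
    conv_lhs => rw [h2]
    rw [Real.sqrt_sq (Real.sqrt_nonneg _)]
    field_simp

theorem eq_of_hellingerSq_eq_zero {X : Type*} [Fintype X] {p q : X → ℝ} (hp : ∀ x, 0 ≤ p x)
    (hq : ∀ x, 0 ≤ q x) (h : hellingerSq p q = 0) : p = q := by
  funext x
  have h1 := (Finset.sum_eq_zero_iff_of_nonneg fun x _ => by positivity).1 h x
    (Finset.mem_univ x)
  have h2 : √(p x) = √(q x) := by
    have h3 : (√(p x) - √(q x)) ^ 2 = 0 := by linarith
    exact sub_eq_zero.1 (pow_eq_zero_iff two_ne_zero |>.1 h3)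
  rwa [Real.sqrt_inj (hp x) (hq x)] at h2

theorem hellingerSq_eq_one_sub {X : Type*} [Fintype X] {p q : X → ℝ} (hp : ∀ x, 0 ≤ p x)
    (hq : ∀ x, 0 ≤ q x) (hp1 : ∑ x, p x = 1) (hq1 : ∑ x, q x = 1) :
    hellingerSq p q = 1 - ∑ x, √(p x) * √(q x) := by
  have e : ∀ x, 1 / 2 * (√(p x) - √(q x)) ^ 2 =
      1 / 2 * p x + 1 / 2 * q x - √(p x) * √(q x) := by
    intro x
    linear_combination 1 / 2 * Real.sq_sqrt (hp x) + 1 / 2 * Real.sq_sqrt (hq x)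
  simp only [hellingerSq, e, Finset.sum_sub_distrib, Finset.sum_add_distrib, ← Finset.mul_sum,
    hp1, hq1]
  ring

/-- Weierstrass' product inequality; it turns multiplicativity of the affinity into subadditivity of
the distance. -/
theorem one_sub_sum_le_prod_one_sub {ι : Type*} (s : Finset ι) (h : ι → ℝ) (h0 : ∀ i, 0 ≤ h i)
    (h1 : ∀ i, h i ≤ 1) : 1 - ∑ i ∈ s, h i ≤ ∏ i ∈ s, (1 - h i) := by
  classical
  induction s using Finset.induction_on with
  | empty => simp
  | insert a s ha ih =>
    rw [Finset.sum_insert ha, Finset.prod_insert ha]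
    have h2 : ∏ i ∈ s, (1 - h i) ≤ 1 :=
      Finset.prod_le_one (fun i _ => by linarith [h1 i]) (fun i _ => by linarith [h0 i])
    nlinarith [h0 a]

theorem marginalOn_nonneg {n q : ℕ} {W : Finset (Fin n)} {p : (Fin n → Fin q) → ℝ}
    (hp : ∀ x, 0 ≤ p x) (z : W → Fin q) : 0 ≤ marginalOn W p z :=
  Finset.sum_nonneg fun x _ => by split_ifs <;> simp [hp x]

theorem marginalOn_eq_zero {n q : ℕ} {W : Finset (Fin n)} {p p' : (Fin n → Fin q) → ℝ}
    (hp : ∀ x, 0 ≤ p x) (h : ∀ x, p x = 0 → p' x = 0) {z : W → Fin q}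
    (hz : marginalOn W p z = 0) : marginalOn W p' z = 0 := by
  have h1 := (Finset.sum_eq_zero_iff_of_nonneg fun x _ => by
    split_ifs <;> simp [hp x]).1 hz
  refine Finset.sum_eq_zero fun x hx => ?_
  have h2 := h1 x hx
  split_ifs at h2 ⊢ with h3
  · exact h x h2
  · rfl

/-! ### Subadditivity over the outcome variables -/

namespace CausalModel

variable {n k q : ℕ} {G : KPartiteDesign n k} (M N : CausalModel G q)

/-- The outcome variables. -/
def outcomes (G : KPartiteDesign n k) : Finset (Fin n) :=
  Finset.univ.filter fun v => G.IsOutcome v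

theorem notMem_outcomes_of_mem_parents {u v : Fin n} (h : u ∈ G.parents v) :
    u ∉ outcomes G := by
  intro hu
  have h1 : (G.layer u : ℕ) < G.layer v := layer_lt_of_mem_parents h
  have h2 := (G.layer v).isLt
  have h3 : (G.layer u : ℕ) + 1 = k := (Finset.mem_filter.1 hu).2
  omega

/-- The part of the distribution that belongs to the variables before the last layer. -/
def basePart (x : Fin n → Fin q) : ℝ := ∏ v ∈ (outcomes G)ᶜ, M.factor v (x v) x

theorem P_eq_basePart_mul (x : Fin n → Fin q) :
    M.P x = M.basePart x * ∏ v ∈ outcomes G, M.factor v (x v) x :=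
  (Finset.prod_compl_mul_prod (outcomes G) _).symm

theorem factor_congr_outcomes (v : Fin n) (β : Fin q) (x y : Fin n → Fin q)
    (h : ∀ u ∉ outcomes G, x u = y u) : M.factor v β x = M.factor v β y :=
  M.factor_congr β fun u hu => h u (notMem_outcomes_of_mem_parents hu)

theorem basePart_congr (x y : Fin n → Fin q) (h : ∀ u ∉ outcomes G, x u = y u) :
    M.basePart x = M.basePart y :=
  Finset.prod_congr rfl fun v hv => by
    rw [M.factor_congr_outcomes v _ x y h, h v (Finset.mem_compl.1 hv)]

theorem basePart_nonneg (x : Fin n → Fin q) : 0 ≤ M.basePart x :=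
  Finset.prod_nonneg fun v _ => M.factor_nonneg v _ x

/-- The distribution in which the outcome variables are uniform and independent. -/
def baseDist (x : Fin n → Fin q) : ℝ := M.basePart x * ∏ _v ∈ outcomes G, (q : ℝ)⁻¹

theorem baseDist_nonneg (x : Fin n → Fin q) : 0 ≤ M.baseDist x :=
  mul_nonneg (M.basePart_nonneg x) (Finset.prod_nonneg fun _ _ => by positivity)

theorem sum_basePart_mul (hq : q ≠ 0) {F : (Fin n → Fin q) → ℝ}
    {g : Fin n → Fin q → (Fin n → Fin q) → ℝ}
    (hF : ∀ x y : Fin n → Fin q, (∀ u ∉ outcomes G, x u = y u) → F x = F y)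
    (hg : ∀ v ∈ outcomes G, ∀ β, ∀ x y : Fin n → Fin q, (∀ u ∉ outcomes G, x u = y u) →
      g v β x = g v β y) :
    ∑ x, M.basePart x * F x * ∏ v ∈ outcomes G, g v (x v) x =
      ∑ x, M.baseDist x * (F x * ∏ v ∈ outcomes G, ∑ β, g v β x) := by
  rw [sum_out hq (outcomes G) (F := fun x => M.basePart x * F x)
    (fun x y h => by rw [M.basePart_congr x y h, hF x y h]) hg]
  refine Finset.sum_congr rfl fun x _ => ?_
  rw [Finset.prod_mul_distrib, baseDist]
  ring

theorem sum_baseDist (hq : q ≠ 0) : ∑ x, M.baseDist x = 1 := by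
  have h := M.sum_basePart_mul hq (F := fun _ => 1) (g := M.factor) (fun _ _ _ => rfl)
    (fun v _ β => M.factor_congr_outcomes v β)
  simp only [mul_one, sum_factor, Finset.prod_const_one, ← P_eq_basePart_mul, sum_P] at h
  exact h.symm

/-- The squared Hellinger distance of the conditional distributions of `v`. -/
def localDist (v : Fin n) (x : Fin n → Fin q) : ℝ :=
  hellingerSq (fun β => M.factor v β x) (fun β => N.factor v β x)

theorem localDist_eq (v : Fin n) (x : Fin n → Fin q) :
    M.localDist N v x = 1 - ∑ β, √(M.factor v β x) * √(N.factor v β x) :=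
  hellingerSq_eq_one_sub (M.factor_nonneg v · x) (N.factor_nonneg v · x) (M.sum_factor v x)
    (N.sum_factor v x)

theorem localDist_nonneg (v : Fin n) (x : Fin n → Fin q) : 0 ≤ M.localDist N v x := by
  rw [localDist, hellingerSq]
  positivity

theorem localDist_le_one (v : Fin n) (x : Fin n → Fin q) : M.localDist N v x ≤ 1 := by
  rw [localDist_eq]
  linarith [Finset.sum_nonneg fun (β : Fin q) (_ : β ∈ Finset.univ) =>
    mul_nonneg (Real.sqrt_nonneg (M.factor v β x)) (Real.sqrt_nonneg (N.factor v β x))]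

variable {M N}

theorem basePart_eq (hMN : ∀ v ∉ outcomes G, ∀ β x, N.factor v β x = M.factor v β x)
    (x : Fin n → Fin q) : N.basePart x = M.basePart x :=
  Finset.prod_congr rfl fun v hv => hMN v (Finset.mem_compl.1 hv) _ x

theorem baseDist_eq (hMN : ∀ v ∉ outcomes G, ∀ β x, N.factor v β x = M.factor v β x)
    (x : Fin n → Fin q) : N.baseDist x = M.baseDist x := by
  rw [baseDist, basePart_eq hMN, baseDist]

/-- The squared Hellinger distance of models that differ in outcome variables only. -/
theorem hellingerSq_P_le (hq : q ≠ 0)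
    (hMN : ∀ v ∉ outcomes G, ∀ β x, N.factor v β x = M.factor v β x) :
    hellingerSq M.P N.P ≤ ∑ v ∈ outcomes G, ∑ x, M.baseDist x * M.localDist N v x := by
  rw [hellingerSq_eq_one_sub M.P_nonneg N.P_nonneg M.sum_P N.sum_P]
  -- The base parts coincide, so their roots multiply to the base part itself, and the rest is a
  -- product of local affinities, each of which sums to 1 - h_v.
  have e : ∀ x, √(M.P x) * √(N.P x) = M.basePart x * 1 *
      ∏ v ∈ outcomes G, (√(M.factor v (x v) x) * √(N.factor v (x v) x)) := by
    intro x
    rw [P_eq_basePart_mul, P_eq_basePart_mul, basePart_eq hMN,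
      Real.sqrt_mul (M.basePart_nonneg x), Real.sqrt_mul (M.basePart_nonneg x),
      Real.sqrt_prod _ fun v _ => M.factor_nonneg v _ x,
      Real.sqrt_prod _ fun v _ => N.factor_nonneg v _ x, Finset.prod_mul_distrib]
    linear_combination (∏ v ∈ outcomes G, √(M.factor v (x v) x)) *
      (∏ v ∈ outcomes G, √(N.factor v (x v) x)) * Real.mul_self_sqrt (M.basePart_nonneg x)
  simp only [e]
  rw [M.sum_basePart_mul hq (F := fun _ => 1)
    (g := fun v β x => √(M.factor v β x) * √(N.factor v β x)) (fun _ _ _ => rfl)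
    (fun v _ β x y h => by
      rw [M.factor_congr_outcomes v β x y h, N.factor_congr_outcomes v β x y h])]
  conv_lhs => enter [1]; rw [← M.sum_baseDist hq]
  rw [← Finset.sum_sub_distrib, Finset.sum_comm]
  refine Finset.sum_le_sum fun x _ => ?_
  rw [← Finset.mul_sum, ← mul_one_sub]
  refine mul_le_mul_of_nonneg_left ?_ (M.baseDist_nonneg x)
  have e2 : ∀ v, ∑ β, √(M.factor v β x) * √(N.factor v β x) = 1 - M.localDist N v x :=
    fun v => by rw [localDist_eq]; ring
  simp only [e2, one_mul]
  have := one_sub_sum_le_prod_one_sub (outcomes G) (fun v => M.localDist N v x)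
    (fun v => M.localDist_nonneg N v x) (fun v => M.localDist_le_one N v x)
  linarith

/-- The indicator that the assignment `z` of a family agrees with `x` on the parents. -/
def agrees (v : Fin n) (z : G.family v → Fin q) (x : Fin n → Fin q) : Prop :=
  ∀ u (hu : u ∈ G.parents v), x u = z ⟨u, Finset.mem_insert_of_mem hu⟩

open Classical in
-- The other outcome variables are nobody's parents and sum to 1. What remains is the probability of
-- the parents' values, which depends on the earlier layers only, times one conditional probability.
theorem marginalOn_family (M : CausalModel G q) (hq : q ≠ 0) {v : Fin n} (hv : v ∈ outcomes G)
    (z : G.family v → Fin q) :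
    marginalOn (G.family v) M.P z =
      (∑ x, M.baseDist x * if agrees v z x then 1 else 0) *
        (M.cpd v fun u => z ⟨u, Finset.mem_insert_of_mem u.2⟩).1
          (z ⟨v, Finset.mem_insert_self _ _⟩) := by
  set a := z ⟨v, Finset.mem_insert_self _ _⟩ with ha
  -- The constraint on the value at `v` is absorbed into the factor of `v`, so that the outcomes can
  -- be summed out.
  set g : Fin n → Fin q → (Fin n → Fin q) → ℝ := fun w β x =>
    if w = v then (if β = a then M.factor w β x else 0) else M.factor w β x with hg
  have hiff : ∀ x : Fin n → Fin q, (fun u : G.family v => x u) = z ↔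
      agrees v z x ∧ x v = a := by
    intro x
    constructor
    · rintro rfl
      exact ⟨fun u hu => rfl, rfl⟩
    · rintro ⟨h1, h2⟩
      funext ⟨u, hu⟩
      rcases Finset.mem_insert.1 hu with rfl | h3
      · exact h2
      · exact h1 u h3
  have e : ∀ x, (if (fun u : G.family v => x u) = z then M.P x else 0) =
      M.basePart x * (if agrees v z x then 1 else 0) * ∏ w ∈ outcomes G, g w (x w) x := by
    intro x
    by_cases h1 : agrees v z x
    · by_cases h2 : x v = a
      · rw [if_pos ((hiff x).2 ⟨h1, h2⟩), if_pos h1, mul_one, P_eq_basePart_mul]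
        congr 1
        refine Finset.prod_congr rfl fun w _ => ?_
        simp only [hg]
        split_ifs with h3 h4
        · rfl
        · subst h3; exact absurd h2 h4
        · rfl
      · rw [if_neg fun h => h2 ((hiff x).1 h).2, Finset.prod_eq_zero hv (by simp [hg, h2]),
          mul_zero]
    · rw [if_neg fun h => h1 ((hiff x).1 h).1, if_neg h1, mul_zero, zero_mul]
  rw [marginalOn, Finset.sum_congr rfl fun x _ => e x, M.sum_basePart_mul hq]
  · rw [Finset.sum_mul]
    refine Finset.sum_congr rfl fun x _ => ?_
    by_cases h1 : agrees v z x
    · have e1 : ∏ w ∈ outcomes G, ∑ β, g w β x = M.factor v a x := by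
        rw [Finset.prod_eq_single_of_mem v hv]
        · simp [hg]
        · intro w _ hw
          simp [hg, hw, sum_factor]
      have e2 : M.factor v a x =
          (M.cpd v fun u => z ⟨u, Finset.mem_insert_of_mem u.2⟩).1 a := by
        rw [factor]
        have : (fun u : G.parents v => x u) =
            fun u : G.parents v => z ⟨u, Finset.mem_insert_of_mem u.2⟩ := funext fun u => h1 u u.2
        rw [this]
      rw [e1, e2, mul_assoc]
    · simp [h1]
  · intro x y h
    have : agrees v z x ↔ agrees v z y := by
      constructor <;> intro h1 u hu
      · rw [← h u (notMem_outcomes_of_mem_parents hu)]; exact h1 u hu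
      · rw [h u (notMem_outcomes_of_mem_parents hu)]; exact h1 u hu
    simp only [this]
  · intro w _ β x y h
    simp only [hg, M.factor_congr_outcomes w β x y h]

open Classical in
-- An assignment of the family that agrees with `x` on the parents is determined by its letter at
-- `v`, which is not its own parent.
theorem sum_agrees (v : Fin n) (x : Fin n → Fin q) (φ : Fin q → ℝ) :
    ∑ z : G.family v → Fin q, (if agrees v z x then φ (z ⟨v, Finset.mem_insert_self _ _⟩)
      else 0) = ∑ β, φ β := by
  have hvp : v ∉ G.parents v := fun h => lt_irrefl _ (layer_lt_of_mem_parents h)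
  set ext : Fin q → G.family v → Fin q := fun β u => Function.update x v β u with hext
  have hiff : ∀ z β, z = ext β ↔ agrees v z x ∧ β = z ⟨v, Finset.mem_insert_self _ _⟩ := by
    intro z β
    constructor
    · rintro rfl
      refine ⟨fun u hu => ?_, by simp [hext]⟩
      have : u ≠ v := fun h => hvp (h ▸ hu)
      simp [hext, this]
    · rintro ⟨h1, h2⟩
      funext ⟨u, hu⟩
      by_cases h3 : u = v
      · subst h3; simp [hext, h2]
      · rcases Finset.mem_insert.1 hu with h4 | h4
        · exact absurd h4 h3
        · simp [hext, h3, h1 u h4]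
  have e1 : ∀ β, φ β = ∑ z, if z = ext β then φ β else 0 := fun β => by simp
  rw [Finset.sum_congr rfl fun β _ => e1 β, Finset.sum_comm]
  refine Finset.sum_congr rfl fun z _ => ?_
  simp only [hiff, ite_and]
  split_ifs with h <;> simp

open Classical in
/-- The squared Hellinger distance of the marginals on the family of an outcome variable. -/
theorem hellingerSq_family (hq : q ≠ 0)
    (hMN : ∀ v ∉ outcomes G, ∀ β x, N.factor v β x = M.factor v β x) {v : Fin n}
    (hv : v ∈ outcomes G) :
    hellingerSq (marginalOn (G.family v) M.P) (marginalOn (G.family v) N.P) =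
      ∑ x, M.baseDist x * M.localDist N v x := by
  have e : ∀ z : G.family v → Fin q, 1 / 2 * (√(marginalOn (G.family v) M.P z) -
      √(marginalOn (G.family v) N.P z)) ^ 2 =
      ∑ x, M.baseDist x * if agrees v z x then
        1 / 2 * (√(M.factor v (z ⟨v, Finset.mem_insert_self _ _⟩) x) -
          √(N.factor v (z ⟨v, Finset.mem_insert_self _ _⟩) x)) ^ 2 else 0 := by
    intro z
    -- Both marginals carry the same weight of the parents' values, which therefore comes out of the
    -- squared difference of roots.
    rw [marginalOn_family M hq hv, marginalOn_family N hq hv]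
    simp only [baseDist_eq hMN]
    have hc : 0 ≤ ∑ x, M.baseDist x * if agrees v z x then 1 else 0 :=
      Finset.sum_nonneg fun x _ => mul_nonneg (M.baseDist_nonneg x) (by split_ifs <;> norm_num)
    rw [Real.sqrt_mul hc, Real.sqrt_mul hc, ← mul_sub, mul_pow, Real.sq_sqrt hc,
      mul_left_comm, Finset.sum_mul]
    refine Finset.sum_congr rfl fun x _ => ?_
    split_ifs with h
    · have : (fun u : G.parents v => x u) =
          fun u : G.parents v => z ⟨u, Finset.mem_insert_of_mem u.2⟩ := funext fun u => h u u.2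
      rw [factor, factor, this, mul_one]
    · simp
  rw [hellingerSq, Finset.sum_congr rfl fun z _ => e z, Finset.sum_comm]
  refine Finset.sum_congr rfl fun x _ => ?_
  rw [← Finset.mul_sum, sum_agrees v x (fun β => 1 / 2 * (√(M.factor v β x) -
    √(N.factor v β x)) ^ 2)]
  rfl

end CausalModel

/-! ## Keys of the assignments of a family -/

namespace Cmd

theorem hornerKey_bounds {q : ℤ} {f : ℕ → ℤ} (hf : ∀ i, 0 ≤ f i ∧ f i < q) (r : ℕ) :
    0 ≤ hornerKey q f r ∧ hornerKey q f r < q ^ r := by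
  have hq : 0 < q := (hf 0).1.trans_lt (hf 0).2
  induction r with
  | zero => simp [hornerKey]
  | succ r ih =>
    rw [hornerKey, pow_succ]
    have := hf r
    have h1 := mul_le_mul_of_nonneg_right (Int.add_one_le_of_lt ih.2) hq.le
    have h2 := mul_nonneg ih.1 hq.le
    constructor <;> linarith

theorem hornerKey_injective {q : ℤ} {f g : ℕ → ℤ} (hf : ∀ i, 0 ≤ f i ∧ f i < q)
    (hg : ∀ i, 0 ≤ g i ∧ g i < q) {r : ℕ} (h : hornerKey q f r = hornerKey q g r) :
    ∀ i < r, f i = g i := by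
  have hq : 0 < q := (hf 0).1.trans_lt (hf 0).2
  induction r with
  | zero => simp
  | succ r ih =>
    rw [hornerKey, hornerKey] at h
    have h1 : f r = g r := by
      have := congrArg (· % q) h
      simpa [Int.add_emod, Int.emod_eq_of_lt (hf r).1 (hf r).2,
        Int.emod_eq_of_lt (hg r).1 (hg r).2] using this
    have h2 : hornerKey q f r = hornerKey q g r := by
      rw [h1] at h
      exact mul_right_cancel₀ hq.ne' (add_right_cancel h)
    intro i hi
    rcases Nat.lt_succ_iff_lt_or_eq.1 hi with h3 | rfl
    · exact ih h2 i h3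
    · exact h1

end Cmd

section FamilyKey

variable {n k q : ℕ} (G : KPartiteDesign n k) (v : Fin n)

/-- The `i`-th coordinate of an assignment of the family of `v`. -/
def familyDigit (z : G.family v → Fin q) (i : ℕ) : ℤ :=
  if hi : i < (G.family v).card then
    ((z ⟨(G.family v).orderEmbOfFin rfl ⟨i, hi⟩, Finset.orderEmbOfFin_mem _ _ _⟩ : Fin q) : ℕ)
  else 0

theorem familyDigit_bounds (z : G.family v → Fin q) (i : ℕ) :
    0 ≤ familyDigit G v z i ∧ familyDigit G v z i < q := by
  have hq : 0 < q := (z ⟨v, Finset.mem_insert_self _ _⟩).pos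
  rw [familyDigit]
  split_ifs with h
  · have := (z ⟨(G.family v).orderEmbOfFin rfl ⟨i, h⟩, Finset.orderEmbOfFin_mem _ _ _⟩).isLt
    constructor <;> omega
  · constructor <;> omega

/-- The key of an assignment of the family of `v`. -/
def familyKey (r : ℕ) (z : G.family v → Fin q) : Fin (keyCount q r) :=
  ⟨(Cmd.hornerKey q (familyDigit G v z) (keyLength q r)).toNat, by
    have := Cmd.hornerKey_bounds (familyDigit_bounds G v z) (keyLength q r)
    rw [keyCount, ← Nat.cast_lt (α := ℤ), Int.toNat_of_nonneg this.1]
    exact_mod_cast this.2⟩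

theorem familyKey_coe (r : ℕ) (z : G.family v → Fin q) :
    ((familyKey G v r z : ℕ) : ℤ) = Cmd.hornerKey q (familyDigit G v z) (keyLength q r) :=
  Int.toNat_of_nonneg (Cmd.hornerKey_bounds (familyDigit_bounds G v z) (keyLength q r)).1

/-- Smaller families are padded with zeros up to length `r`. For fewer than two letters all
assignments coincide, and the empty key is enough. -/
theorem familyKey_injective {r : ℕ} (hr : (G.family v).card ≤ r) :
    Function.Injective (familyKey (q := q) G v r) := by
  intro z z' h
  by_cases hq : 2 ≤ q
  · have h1 : Cmd.hornerKey q (familyDigit G v z) r = Cmd.hornerKey q (familyDigit G v z') r := by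
      have := congrArg (fun i : Fin (keyCount q r) => ((i : ℕ) : ℤ)) h
      simpa only [familyKey_coe, keyLength, if_pos hq] using this
    have h2 := Cmd.hornerKey_injective (familyDigit_bounds G v z) (familyDigit_bounds G v z') h1
    funext ⟨u, hu⟩
    have hmem : u ∈ Set.range ((G.family v).orderEmbOfFin rfl) := by
      rw [Finset.range_orderEmbOfFin]; exact hu
    obtain ⟨i, rfl⟩ := hmem
    have h3 := h2 i (i.isLt.trans_le hr)
    rw [familyDigit, familyDigit, dif_pos i.isLt, dif_pos i.isLt] at h3
    exact Fin.ext (by exact_mod_cast h3)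
  · funext u
    have := (z u).isLt
    have := (z' u).isLt
    exact Fin.ext (by omega)

variable {G v}

/-- The law of the key of the family of `v` for a sample from `p`. -/
def keyLaw (G : KPartiteDesign n k) (v : Fin n) (r : ℕ) (p : (Fin n → Fin q) → ℝ)
    (i : Fin (keyCount q r)) : ℝ :=
  ∑ x : Fin n → Fin q, if familyKey G v r (fun u => x u) = i then p x else 0

theorem keyLaw_nonneg {r : ℕ} {p : (Fin n → Fin q) → ℝ} (hp : ∀ x, 0 ≤ p x)
    (i : Fin (keyCount q r)) : 0 ≤ keyLaw G v r p i :=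
  Finset.sum_nonneg fun x _ => by split_ifs <;> simp [hp x]

theorem sum_keyLaw {r : ℕ} {p : (Fin n → Fin q) → ℝ} (hp : ∑ x, p x = 1) :
    ∑ i, keyLaw G v r p i = 1 := by
  simp only [keyLaw]
  rw [Finset.sum_comm, ← hp]
  exact Finset.sum_congr rfl fun x _ => by simp

theorem keyLaw_eq_sum_marginalOn {r : ℕ} (p : (Fin n → Fin q) → ℝ) (i : Fin (keyCount q r)) :
    keyLaw G v r p i =
      ∑ z, if familyKey G v r z = i then marginalOn (G.family v) p z else 0 := by
  have e : ∀ z : G.family v → Fin q, (if familyKey G v r z = i then marginalOn (G.family v) p z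
      else 0) = ∑ x : Fin n → Fin q, if (fun u : G.family v => x u) = z then
        (if familyKey G v r z = i then p x else 0) else 0 := by
    intro z
    rw [marginalOn]
    split_ifs <;> simp
  simp only [e]
  rw [Finset.sum_comm]
  exact Finset.sum_congr rfl fun x _ => by simp

theorem hellingerSq_le_keyLaw {r : ℕ} (hr : (G.family v).card ≤ r)
    (p p' : (Fin n → Fin q) → ℝ) :
    hellingerSq (marginalOn (G.family v) p) (marginalOn (G.family v) p') ≤
      hellingerSq (keyLaw G v r p) (keyLaw G v r p') := by
  have hinj := familyKey_injective (q := q) G v hr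
  have e : ∀ (p : (Fin n → Fin q) → ℝ) z,
      marginalOn (G.family v) p z = keyLaw G v r p (familyKey G v r z) := by
    intro p z
    rw [keyLaw_eq_sum_marginalOn]
    simp [hinj.eq_iff]
  rw [hellingerSq]
  simp only [e]
  rw [← Finset.sum_image (s := Finset.univ) (g := familyKey G v r)
    (f := fun i => 1 / 2 * (√(keyLaw G v r p i) - √(keyLaw G v r p' i)) ^ 2)
    (fun x _ y _ h => hinj h)]
  exact Finset.sum_le_sum_of_subset_of_nonneg (Finset.subset_univ _) fun _ _ _ => by positivity

end FamilyKey

/-! ## Probabilities of events of the samples and coins -/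

section SampleProb

variable {n k q m : ℕ} {P Q : (Fin n → Fin q) → ℝ}

/-- The law of one sample from each source, with one coin for each variable. -/
def drawWeight (P Q : (Fin n → Fin q) → ℝ)
    (a : (Fin n → Fin q) × (Fin n → Fin q) × (Fin n → Bool)) : ℝ :=
  P a.1 * Q a.2.1 * (1 / 2) ^ n

/-- Regrouping by the sample index makes the draws independent and identically distributed. This
needs as many coins per test as samples. -/
theorem sampleProb_eq_prodExp
    (A : (Fin m → Fin n → Fin q) → (Fin m → Fin n → Fin q) → (Fin n → Fin m → Bool) → Bool) :
    sampleProb P Q A = prodExp (fun _ : Fin m => drawWeight P Q) (fun z =>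
      if A (fun t => (z t).1) (fun t => (z t).2.1) (fun v t => (z t).2.2 v) = true
        then 1 else 0) := by
  rw [prodExp, ← Equiv.sum_comp (Equiv.arrowProdEquivProdArrow (Fin m) (fun _ => Fin n → Fin q)
    (fun _ => (Fin n → Fin q) × (Fin n → Bool))).symm, Fintype.sum_prod_type, sampleProb]
  refine Finset.sum_congr rfl fun x _ => ?_
  rw [← Equiv.sum_comp (Equiv.arrowProdEquivProdArrow (Fin m) (fun _ => Fin n → Fin q)
    (fun _ => Fin n → Bool)).symm, Fintype.sum_prod_type]
  refine Finset.sum_congr rfl fun y _ => ?_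
  rw [← Equiv.sum_comp (Equiv.piComm (fun (_ : Fin n) (_ : Fin m) => Bool))]
  refine Finset.sum_congr rfl fun ρ _ => ?_
  simp only [drawWeight, Equiv.arrowProdEquivProdArrow, Equiv.coe_fn_symm_mk, Equiv.piComm_apply,
    Finset.prod_mul_distrib, Finset.prod_const, Finset.card_univ, Fintype.card_fin, ← pow_mul,
    mul_ite, mul_one, mul_zero]

theorem sum_coins (v : Fin n) (c : Bool) :
    ∑ ρ : Fin n → Bool, (if ρ v = c then (1 / 2 : ℝ) ^ n else 0) = 1 / 2 := by
  have hw : IsWeight (fun (_ : Fin n) (_ : Bool) => (1 / 2 : ℝ)) :=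
    ⟨fun _ _ => by norm_num, fun _ => by simp⟩
  have h := prodExp.coord hw v (fun a => if a = c then 1 else 0)
  simpa [prodExp] using h

theorem isWeight_drawWeight (hP : ∀ x, 0 ≤ P x) (hQ : ∀ x, 0 ≤ Q x) (hP1 : ∑ x, P x = 1)
    (hQ1 : ∑ x, Q x = 1) (η : Type*) : IsWeight (fun _ : η => drawWeight P Q) where
  nonneg _ a := mul_nonneg (mul_nonneg (hP _) (hQ _)) (by positivity)
  sum_eq_one _ := by
    have e : ∀ x y : Fin n → Fin q, ∑ _ρ : Fin n → Bool, P x * Q y * (1 / 2) ^ n = P x * Q y := by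
      intro x y
      simp
      field_simp
    simp only [Fintype.sum_prod_type, drawWeight, e, ← Finset.mul_sum, hP1, hQ1, mul_one]

/-- The sample from the source that the coin does not select sums out to 1, as do the coins of the
other tests. -/
theorem map_drawWeight (G : KPartiteDesign n k) (v : Fin n) (r : ℕ) (hP1 : ∑ x, P x = 1)
    (hQ1 : ∑ x, Q x = 1) (b : Bool × Fin (keyCount q r)) :
    (∑ a : (Fin n → Fin q) × (Fin n → Fin q) × (Fin n → Bool),
      if (a.2.2 v, familyKey G v r (fun u => (if a.2.2 v then a.1 else a.2.1) u)) = b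
        then drawWeight P Q a else 0) = labelWeight (keyLaw G v r P) (keyLaw G v r Q) b := by
  obtain ⟨c, i⟩ := b
  simp only [Fintype.sum_prod_type, drawWeight, labelWeight]
  have e : ∀ (x y : Fin n → Fin q) (ρ : Fin n → Bool),
      (if (ρ v, familyKey G v r (fun u => (if ρ v then x else y) u)) = (c, i)
        then P x * Q y * (1 / 2) ^ n else 0) =
      (if familyKey G v r (fun u => (if c then x else y) u) = i then P x * Q y else 0) *
        (if ρ v = c then (1 / 2 : ℝ) ^ n else 0) := by
    intro x y ρ
    by_cases h : ρ v = c
    · subst h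
      simp [ite_mul]
    · simp [h]
  simp only [e, ← Finset.mul_sum, sum_coins]
  cases c
  · rw [Finset.sum_comm]
    simp only [Bool.false_eq_true, if_false, keyLaw, ← Finset.sum_mul]
    rw [mul_comm]
    congr 1
    refine Finset.sum_congr rfl fun y _ => ?_
    split_ifs
    · rw [← Finset.sum_mul, hP1, one_mul]
    · simp
  · simp only [if_true, keyLaw, ← Finset.sum_mul]
    rw [mul_comm]
    congr 1
    refine Finset.sum_congr rfl fun x _ => ?_
    split_ifs
    · rw [← Finset.mul_sum, hQ1, mul_one]
    · simp

/-- An event that depends on the labelled keys of one family only. -/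
theorem sampleProb_labels (G : KPartiteDesign n k) (v : Fin n) (r : ℕ) (hP1 : ∑ x, P x = 1)
    (hQ1 : ∑ x, Q x = 1) (B : (Fin m → Bool × Fin (keyCount q r)) → Bool) :
    sampleProb P Q (fun x y (ρ : Fin n → Fin m → Bool) =>
      B fun t => (ρ v t, familyKey G v r (fun u => (if ρ v t then x t else y t) u))) =
    prodExp (fun _ : Fin m => labelWeight (keyLaw G v r P) (keyLaw G v r Q))
      (fun Z => if B Z = true then 1 else 0) := by
  rw [sampleProb_eq_prodExp]
  have h := prodExp.map (fun _ : Fin m => drawWeight P Q)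
    (fun a : (Fin n → Fin q) × (Fin n → Fin q) × (Fin n → Bool) =>
      (a.2.2 v, familyKey G v r (fun u => (if a.2.2 v then a.1 else a.2.1) u)))
    (fun Z => if B Z = true then 1 else 0)
  simp only [map_drawWeight G v r hP1 hQ1] at h
  exact h

theorem sampleProb_add_not (hP : ∀ x, 0 ≤ P x) (hQ : ∀ x, 0 ≤ Q x) (hP1 : ∑ x, P x = 1)
    (hQ1 : ∑ x, Q x = 1)
    (A : (Fin m → Fin n → Fin q) → (Fin m → Fin n → Fin q) → (Fin n → Fin m → Bool) → Bool) :
    sampleProb P Q A + sampleProb P Q (fun x y ρ => !A x y ρ) = 1 := by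
  rw [sampleProb_eq_prodExp, sampleProb_eq_prodExp, ← prodExp.add]
  refine Eq.trans ?_ (prodExp.const (isWeight_drawWeight hP hQ hP1 hQ1 (Fin m)) 1)
  congr 1
  funext z
  cases A (fun t => (z t).1) (fun t => (z t).2.1) (fun v t => (z t).2.2 v) <;> simp

theorem sampleProb_mono (hP : ∀ x, 0 ≤ P x) (hQ : ∀ x, 0 ≤ Q x) (hP1 : ∑ x, P x = 1)
    (hQ1 : ∑ x, Q x = 1)
    {A B : (Fin m → Fin n → Fin q) → (Fin m → Fin n → Fin q) → (Fin n → Fin m → Bool) → Bool}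
    (h : ∀ x y ρ, A x y ρ = true → B x y ρ = true) : sampleProb P Q A ≤ sampleProb P Q B := by
  rw [sampleProb_eq_prodExp, sampleProb_eq_prodExp]
  refine prodExp.mono (isWeight_drawWeight hP hQ hP1 hQ1 (Fin m)) fun z => ?_
  by_cases hA : A (fun t => (z t).1) (fun t => (z t).2.1) (fun v t => (z t).2.2 v) = true
  · rw [if_pos hA, if_pos (h _ _ _ hA)]
  · rw [if_neg hA]; split_ifs <;> norm_num

/-- The tests share their samples and need not be independent, so only a union bound is available.
-/
theorem sampleProb_exists_le (hP : ∀ x, 0 ≤ P x) (hQ : ∀ x, 0 ≤ Q x) (hP1 : ∑ x, P x = 1)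
    (hQ1 : ∑ x, Q x = 1) (s : Finset (Fin n))
    (B : Fin n → (Fin m → Fin n → Fin q) → (Fin m → Fin n → Fin q) → (Fin n → Fin m → Bool) →
      Bool) :
    sampleProb P Q (fun x y ρ => decide (∃ v ∈ s, B v x y ρ = true)) ≤
      ∑ v ∈ s, sampleProb P Q (B v) := by
  simp only [sampleProb_eq_prodExp]
  rw [← prodExp.sum]
  refine prodExp.mono (isWeight_drawWeight hP hQ hP1 hQ1 (Fin m)) fun z => ?_
  have h0 : ∀ v ∈ s, (0 : ℝ) ≤ if B v (fun t => (z t).1) (fun t => (z t).2.1)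
      (fun v t => (z t).2.2 v) = true then 1 else 0 := fun v _ => by split_ifs <;> norm_num
  split_ifs with h
  · obtain ⟨v, hv, hB⟩ := of_decide_eq_true h
    refine le_trans ?_ (Finset.single_le_sum h0 hv)
    rw [if_pos hB]
  · exact Finset.sum_nonneg h0

end SampleProb

/-! ## The algorithm with the squared Hellinger test -/

namespace InfluenceTest

variable {n k q : ℕ} {G : KPartiteDesign n k} {S : Finset (Fin n × Fin n)} {ε : ℝ}

theorem card_family_le {v : Fin n} (hv : v ∈ G.outcomeTargets S) :
    (G.family v).card ≤ G.maxOutcomeInDegree + 1 := by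
  refine (Finset.card_insert_le _ _).trans (Nat.add_le_add_right ?_ 1)
  exact Finset.le_sup (f := fun v => (G.parents v).card)
    (Finset.mem_filter.2 ⟨Finset.mem_univ v, (Finset.mem_filter.1 hv).2.1⟩)

theorem familyInput_shows {m : ℕ} (v : Fin n) (r : ℕ) (x y : Fin m → Fin n → Fin q)
    (ρ : Fin m → Bool) (t : Fin m) :
    (familyInput G v x y ρ).coin t = ρ t ∧
    Cmd.hornerKey q ((familyInput G v x y ρ).sample ((familyInput G v x y ρ).coin t) t)
      (keyLength q r) =
        ((familyKey G v r (fun u => (if ρ t then x t else y t) u) : Fin _) : ℕ) := by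
  have h : (familyInput G v x y ρ).coin t = ρ t := by simp [familyInput]
  refine ⟨h, ?_⟩
  rw [h, familyKey_coe]
  congr 1
  funext i
  cases hc : ρ t <;> simp [familyInput, familyDigit]

theorem test_eq (v : Fin n) (x y : Fin (numSamples hellingerTest G q S ε) → Fin n → Fin q)
    (ρ : Fin n → Fin (numCoins hellingerTest G q S ε) → Bool) :
    testRejects hellingerTest G S ε x y ρ v = decide (0 < totalVote (T :=
        halfRound q (G.maxOutcomeInDegree + 1) (threshold G S ε) +
        halfRound q (G.maxOutcomeInDegree + 1) (threshold G S ε))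
      fun t : Fin (numRounds (testError G S) * _) =>
        (ρ v t, familyKey G v (G.maxOutcomeInDegree + 1)
          (fun u => (if ρ v t then x t else y t) u))) ∧
    testSteps hellingerTest G S ε x y ρ v = 1 + numRounds (testError G S) * (7 +
      (halfRound q (G.maxOutcomeInDegree + 1) (threshold G S ε) +
        halfRound q (G.maxOutcomeInDegree + 1) (threshold G S ε)) *
        (27 + 5 * keyLength q (G.maxOutcomeInDegree + 1))) :=
  hellingerTest_final fun t => familyInput_shows v (G.maxOutcomeInDegree + 1) x y (ρ v) t

variable (M : CausalModel G q)

theorem omega_pos {v : Fin n} (hv : v ∈ G.outcomeTargets S) : 0 < G.omega S :=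
  Finset.card_pos.2 ⟨v, hv⟩

theorem testError_pos {v : Fin n} (hv : v ∈ G.outcomeTargets S) : 0 < testError G S := by
  have := omega_pos hv
  rw [testError]
  positivity

theorem threshold_pos (hε : 0 < ε) {v : Fin n} (hv : v ∈ G.outcomeTargets S) :
    0 < threshold G S ε := by
  have := omega_pos hv
  rw [threshold]
  positivity

theorem PS_nonneg (x : Fin n → Fin q) : 0 ≤ M.PS S x := by
  rw [M.PS_eq]; exact (M.intervened S).P_nonneg x

theorem sum_PS : ∑ x, M.PS S x = 1 := by
  rw [M.PS_eq]; exact (M.intervened S).sum_P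

/-- The test at `v` rejects a true null hypothesis with small probability. -/
theorem testRejects_null {v : Fin n} (hv : v ∈ G.outcomeTargets S)
    (h : marginalOn (G.family v) M.P = marginalOn (G.family v) (M.PS S)) :
    sampleProb M.P (M.PS S) (fun x y ρ => testRejects hellingerTest G S ε x y ρ v) ≤
      1 / (3 * G.omega S) := by
  simp only [(test_eq v _ _ _).1]
  refine (sampleProb_labels G v (G.maxOutcomeInDegree + 1) M.sum_P (sum_PS M)
    (fun Z => decide (0 < totalVote (T :=
        halfRound q (G.maxOutcomeInDegree + 1) (threshold G S ε) +
        halfRound q (G.maxOutcomeInDegree + 1) (threshold G S ε)) Z))).trans_le ?_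
  have hlaw : keyLaw G v (G.maxOutcomeInDegree + 1) (M.PS S) =
      keyLaw G v (G.maxOutcomeInDegree + 1) M.P := by
    funext i
    rw [keyLaw_eq_sum_marginalOn, keyLaw_eq_sum_marginalOn, h]
  rw [hlaw]
  simp only [decide_eq_true_eq]
  exact (totalVote_null (keyLaw_nonneg M.P_nonneg) (sum_keyLaw M.sum_P)).trans
    (half_pow_numRounds_le (testError_pos hv))

/-- The test at `v` accepts with small probability under the alternative. -/
theorem testRejects_alternative (hε : 0 < ε) {v : Fin n} (hv : v ∈ G.outcomeTargets S)
    (h : threshold G S ε ≤ hellingerSq (marginalOn (G.family v) M.P)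
      (marginalOn (G.family v) (M.PS S))) :
    sampleProb M.P (M.PS S) (fun x y ρ => !testRejects hellingerTest G S ε x y ρ v) ≤
      1 / (3 * G.omega S) := by
  simp only [(test_eq v _ _ _).1]
  refine (sampleProb_labels G v (G.maxOutcomeInDegree + 1) M.sum_P (sum_PS M)
    (fun Z => !decide (0 < totalVote (T :=
        halfRound q (G.maxOutcomeInDegree + 1) (threshold G S ε) +
        halfRound q (G.maxOutcomeInDegree + 1) (threshold G S ε)) Z))).trans_le ?_
  have hτ := threshold_pos hε hv
  set r := G.maxOutcomeInDegree + 1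
  set τ := threshold G S ε
  have hD : (0 : ℝ) < keyCount q r := by exact_mod_cast keyCount_pos q r
  have hn : NeZero (halfRound q r τ) := ⟨(Nat.ceil_pos.2 (by positivity)).ne'⟩
  have hbig : 8192 * (keyCount q r : ℝ) ^ (3 / 4 : ℝ) ≤ halfRound q r τ *
      hellingerSq (keyLaw G v r M.P) (keyLaw G v r (M.PS S)) := by
    have h1 : 8192 * (keyCount q r : ℝ) ^ (3 / 4 : ℝ) / τ ≤ halfRound q r τ := Nat.le_ceil _
    rw [div_le_iff₀ hτ] at h1
    exact h1.trans (mul_le_mul_of_nonneg_left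
      (h.trans (hellingerSq_le_keyLaw (card_family_le hv) _ _)) (Nat.cast_nonneg _))
  have h2 := totalVote_alternative (R := numRounds (testError G S)) (keyLaw_nonneg M.P_nonneg)
    (keyLaw_nonneg (PS_nonneg M)) (sum_keyLaw M.sum_P) (sum_keyLaw (sum_PS M)) hbig
  refine le_trans (le_of_eq ?_) (h2.trans (half_pow_numRounds_le (testError_pos hv)))
  congr 1
  funext Z
  by_cases hZ : 0 < totalVote Z <;> simp [hZ]

theorem phiDiv_family_eq (v : Fin n) :
    phiDiv hellingerPhi (marginalOn (G.family v) M.P) (marginalOn (G.family v) (M.PS S)) =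
      hellingerSq (marginalOn (G.family v) M.P) (marginalOn (G.family v) (M.PS S)) :=
  phiDiv_hellingerPhi_eq (marginalOn_nonneg (PS_nonneg M)) fun _ hz =>
    marginalOn_eq_zero (PS_nonneg M) (fun _ hx => M.P_eq_zero_of_PS_eq_zero S hx) hz

theorem causalInfluence_eq : M.causalInfluence hellingerPhi S = hellingerSq M.P (M.PS S) :=
  phiDiv_hellingerPhi_eq (PS_nonneg M) fun _ hx => M.P_eq_zero_of_PS_eq_zero S hx

/-- A large causal influence is visible in the family of some outcome variable. -/
theorem exists_family_dist (hε : 0 < ε) (hε1 : ε ≤ 1) (hS : ∀ e ∈ S, G.IsOutcome e.2)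
    (h : ε ≤ M.causalInfluence hellingerPhi S) :
    ∃ v ∈ G.outcomeTargets S, threshold G S ε ≤
      hellingerSq (marginalOn (G.family v) M.P) (marginalOn (G.family v) (M.PS S)) := by
  rw [causalInfluence_eq] at h
  have hn : n ≠ 0 := by
    rintro rfl
    have : hellingerSq M.P (M.PS S) = 0 := by
      simp [hellingerSq, CausalModel.P, CausalModel.PS]
    linarith
  have hq := M.alphabet_ne_zero hn
  have hMN : ∀ v ∉ CausalModel.outcomes G, ∀ β x,
      (M.intervened S).factor v β x = M.factor v β x := fun v hv β x =>
    M.intervened_factor_of_no_edge (fun u hu => hv (Finset.mem_filter.2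
      ⟨Finset.mem_univ v, hS (u, v) hu⟩)) β x
  -- If all distances stayed below the threshold, subadditivity would give a total of at most ω ·
  -- ε²/(2ω) = ε²/2, which is below ε because ε ≤ 1.
  by_contra! hcon
  have h1 := CausalModel.hellingerSq_P_le hq hMN
  have hsub : G.outcomeTargets S ⊆ CausalModel.outcomes G := fun v hv =>
    Finset.mem_filter.2 ⟨Finset.mem_univ v, (Finset.mem_filter.1 hv).2.1⟩
  have h2 : ∑ v ∈ CausalModel.outcomes G,
      ∑ x, M.baseDist x * M.localDist (M.intervened S) v x =
      ∑ v ∈ G.outcomeTargets S, hellingerSq (marginalOn (G.family v) M.P)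
        (marginalOn (G.family v) (M.PS S)) := by
    rw [← Finset.sum_subset hsub]
    · exact Finset.sum_congr rfl fun v hv =>
        (CausalModel.hellingerSq_family hq hMN (hsub hv)).symm
    · intro v hv hvS
      refine Finset.sum_eq_zero fun x _ => ?_
      have h3 : ∀ u, (u, v) ∉ S := fun u hu => hvS (Finset.mem_filter.2
        ⟨Finset.mem_univ v, (Finset.mem_filter.1 hv).2, u, hu⟩)
      simp [CausalModel.localDist, hellingerSq, M.intervened_factor_of_no_edge h3]
  have h3 : ∑ v ∈ G.outcomeTargets S, hellingerSq (marginalOn (G.family v) M.P)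
      (marginalOn (G.family v) (M.PS S)) ≤ G.omega S * threshold G S ε := by
    refine (Finset.sum_le_card_nsmul _ _ _ fun v hv => (hcon v hv).le).trans (le_of_eq ?_)
    rw [nsmul_eq_mul]; rfl
  have h4 : G.omega S * threshold G S ε ≤ ε ^ 2 / 2 := by
    rw [threshold]
    rcases Nat.eq_zero_or_pos (G.omega S) with h0 | h0
    · rw [h0]; simp; positivity
    · have : (G.omega S : ℝ) ≠ 0 := by positivity
      refine le_of_eq ?_
      field_simp
  rw [M.PS_eq] at h h2 h3
  rw [M.PS_eq] at *
  nlinarith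

theorem output_null (h : M.causalInfluence hellingerPhi S = 0) :
    2 / 3 ≤ sampleProb M.P (M.PS S) (fun x y ρ => !output hellingerTest G S ε x y ρ) := by
  rw [causalInfluence_eq] at h
  have hP := eq_of_hellingerSq_eq_zero M.P_nonneg (PS_nonneg M) h
  have h1 : sampleProb M.P (M.PS S) (fun x y ρ => output hellingerTest G S ε x y ρ) ≤ 1 / 3 := by
    refine (sampleProb_exists_le M.P_nonneg (PS_nonneg M) M.sum_P (sum_PS M)
      (G.outcomeTargets S) (fun v x y ρ => testRejects hellingerTest G S ε x y ρ v)).trans ?_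
    refine (Finset.sum_le_card_nsmul _ _ _ fun v hv =>
      testRejects_null M hv (by rw [← hP])).trans ?_
    rw [nsmul_eq_mul, ← KPartiteDesign.omega]
    rcases Nat.eq_zero_or_pos (G.omega S) with h0 | h0
    · rw [h0]; norm_num
    · have : (G.omega S : ℝ) ≠ 0 := by positivity
      refine le_of_eq ?_
      field_simp
  have h2 := sampleProb_add_not M.P_nonneg (PS_nonneg M) M.sum_P (sum_PS M)
    (Q := M.PS S) (m := numSamples hellingerTest G q S ε) (fun x y ρ => output hellingerTest G S ε x y ρ)
  have h3 : sampleProb M.P (M.PS S) (fun x y ρ => !output hellingerTest G S ε x y ρ) =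
    1 - sampleProb M.P (M.PS S) (fun x y ρ => output hellingerTest G S ε x y ρ) :=
    eq_sub_of_add_eq' h2
  rw [h3]
  linarith

theorem output_alternative (hε : 0 < ε) (hε1 : ε ≤ 1) (hS : ∀ e ∈ S, G.IsOutcome e.2)
    (h : ε ≤ M.causalInfluence hellingerPhi S) :
    2 / 3 ≤ sampleProb M.P (M.PS S) (fun x y ρ => output hellingerTest G S ε x y ρ) := by
  obtain ⟨v, hv, hd⟩ := exists_family_dist M hε hε1 hS h
  have h1 := testRejects_alternative M hε hv hd
  have h2 := sampleProb_add_not M.P_nonneg (PS_nonneg M) M.sum_P (sum_PS M)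
    (Q := M.PS S) (m := numSamples hellingerTest G q S ε)
    (fun x y ρ => testRejects hellingerTest G S ε x y ρ v)
  have h3 : sampleProb M.P (M.PS S) (fun x y ρ => testRejects hellingerTest G S ε x y ρ v) =
    1 - sampleProb M.P (M.PS S) (fun x y ρ => !testRejects hellingerTest G S ε x y ρ v) :=
    eq_sub_of_add_eq h2
  have h4 : sampleProb M.P (M.PS S) (fun x y ρ => testRejects hellingerTest G S ε x y ρ v) ≤
      sampleProb M.P (M.PS S) (fun x y ρ => output hellingerTest G S ε x y ρ) :=
    sampleProb_mono M.P_nonneg (PS_nonneg M) M.sum_P (sum_PS M)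
      (m := numSamples hellingerTest G q S ε)
      (A := fun x y ρ => testRejects hellingerTest G S ε x y ρ v)
      (B := fun x y ρ => output hellingerTest G S ε x y ρ)
      fun x y ρ hr => decide_eq_true ⟨v, hv, hr⟩
  have hω : (1 : ℝ) ≤ G.omega S := by exact_mod_cast omega_pos hv
  have h5 : 1 / (3 * (G.omega S : ℝ)) ≤ 1 / 3 :=
    one_div_le_one_div_of_le (by norm_num) (by linarith)
  linarith

end InfluenceTest

namespace InfluenceTest

/-! ## Sample complexity and running time -/

theorem keyCount_eq_pow {q : ℕ} (hq : q ≠ 0) (r : ℕ) : keyCount q r = q ^ r := by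
  rw [keyCount, keyLength]
  split_ifs with h
  · rfl
  · have : q = 1 := by omega
    simp [this]

/-- From 3ω ≤ 4B the binary logarithm is at most 2 + 2 log B, since log 2 ≥ 1/2. The ceiling adds at
most 1. -/
theorem numRounds_le {ω B : ℝ} (hω : 1 ≤ ω) (hB : ω ≤ B) :
    (numRounds (1 / (3 * ω)) : ℝ) ≤ 4 * (1 + Real.log B) := by
  have h2 := Real.log_two_gt_d9
  have hB1 : 1 ≤ B := hω.trans hB
  have hlB := Real.log_nonneg hB1
  have h3 : Real.log (3 * ω) ≤ 2 * Real.log 2 + Real.log B := by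
    have : Real.log (3 * ω) ≤ Real.log (2 ^ 2 * B) :=
      Real.log_le_log (by positivity) (by linarith)
    rw [Real.log_mul (x := 2 ^ 2) (by norm_num) (by positivity), Real.log_pow] at this
    exact_mod_cast this
  have h4 : Real.logb 2 (1 / (1 / (3 * ω))) ≤ 2 + 2 * Real.log B := by
    rw [one_div_one_div, Real.logb, div_le_iff₀ (by linarith)]
    nlinarith
  have h5 : 0 ≤ Real.logb 2 (1 / (1 / (3 * ω))) := by
    rw [one_div_one_div]
    exact Real.logb_nonneg (by norm_num) (by linarith)
  have h6 := Nat.ceil_lt_add_one h5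
  rw [numRounds]
  linarith

/-- For q ≥ 2, B ≥ 2^(3r/4) makes `r` logarithmic in B. For q = 1, B does not grow with `r`, and the
bound holds only because `keyLength` is then 0. -/
theorem keyLength_le {q r : ℕ} {B : ℝ} (hq : q ≠ 0) (hB : (q : ℝ) ^ ((3 / 4 : ℝ) * r) ≤ B)
    (hB1 : 1 ≤ B) : (keyLength q r : ℝ) ≤ 2 * (1 + Real.log B) := by
  have h2 := Real.log_two_gt_d9
  have hlB := Real.log_nonneg hB1
  rw [keyLength]
  split_ifs with h
  · have hq2 : (2 : ℝ) ≤ q := by exact_mod_cast h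
    have h3 : Real.log ((q : ℝ) ^ ((3 / 4 : ℝ) * r)) ≤ Real.log B :=
      Real.log_le_log (by positivity) hB
    rw [Real.log_rpow (by linarith)] at h3
    have h4 : Real.log 2 ≤ Real.log q := Real.log_le_log (by norm_num) hq2
    have h5 : (3 / 4 : ℝ) * r * Real.log 2 ≤ 3 / 4 * r * Real.log q :=
      mul_le_mul_of_nonneg_left h4 (by positivity)
    have h6 : (0 : ℝ) ≤ r := Nat.cast_nonneg r
    nlinarith
  · simp only [Nat.cast_zero]
    positivity

/-- The quotient under the ceiling is 8192 · 2B, and rounding up costs at most 1 ≤ B. -/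
theorem halfRound_le {q r : ℕ} {ω ε B : ℝ} (hq : q ≠ 0) (hω : 1 ≤ ω) (hε : 0 < ε)
    (hB : B = (q : ℝ) ^ ((3 / 4 : ℝ) * r) * ω / ε ^ 2) (hB1 : 1 ≤ B) :
    (halfRound q r (ε ^ 2 / (2 * ω)) : ℝ) ≤ 16385 * B := by
  have e : 8192 * (keyCount q r : ℝ) ^ (3 / 4 : ℝ) / (ε ^ 2 / (2 * ω)) = 16384 * B := by
    have h1 : (keyCount q r : ℝ) ^ (3 / 4 : ℝ) = (q : ℝ) ^ ((3 / 4 : ℝ) * r) := by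
      rw [keyCount_eq_pow hq, Nat.cast_pow, ← Real.rpow_natCast, ← Real.rpow_mul (by positivity)]
      congr 1
      ring
    rw [h1, hB]
    field_simp
    ring
  rw [halfRound, e]
  have := Nat.ceil_lt_add_one (a := 16384 * B) (by linarith)
  linarith

variable {n k q : ℕ} {G : KPartiteDesign n k} {S : Finset (Fin n × Fin n)} {ε B : ℝ}

/-- For ω = 0 the threshold is a division by zero, hence 0, and dividing by it makes the number of
samples per round 0 as well. -/
theorem numSamples_eq_zero (h : G.omega S = 0) : numSamples hellingerTest G q S ε = 0 := by
  simp [numSamples, hellingerTest, halfRound, threshold, h]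

theorem complexity (M : CausalModel G q) (hε : 0 < ε) (hε1 : ε ≤ 1)
    (hB : B = (q : ℝ) ^ ((3 / 4 : ℝ) * (G.maxOutcomeInDegree + 1)) * G.omega S / ε ^ 2) :
    (numSamples hellingerTest G q S ε : ℝ) ≤ 10000000 * B * (1 + Real.log B) ^ 2 ∧
    ∀ x y ρ, (time hellingerTest G S ε (q := q) x y ρ : ℝ) ≤
      10000000 * B * (1 + Real.log B) ^ 2 := by
  rcases Nat.eq_zero_or_pos (G.omega S) with h0 | h0
  · have hB0 : B = 0 := by simp [hB, h0]
    have hT : G.outcomeTargets S = ∅ := Finset.card_eq_zero.1 h0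
    constructor
    · simp [numSamples_eq_zero h0, hB0]
    · intro x y ρ
      simp [time, numSamples_eq_zero h0, h0, hT, hB0]
  have hn : n ≠ 0 := by
    rintro rfl
    obtain ⟨v, -⟩ := Finset.card_pos.1 h0
    exact v.elim0
  have hq := M.alphabet_ne_zero hn
  have hq1 : (1 : ℝ) ≤ q := by exact_mod_cast Nat.one_le_iff_ne_zero.2 hq
  have hω : (1 : ℝ) ≤ G.omega S := by exact_mod_cast h0
  set r := G.maxOutcomeInDegree + 1 with hr
  have hB' : B = (q : ℝ) ^ ((3 / 4 : ℝ) * r) * G.omega S / ε ^ 2 := by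
    rw [hB, hr]; push_cast; rfl
  have hp : 1 ≤ (q : ℝ) ^ ((3 / 4 : ℝ) * r) := Real.one_le_rpow hq1 (by positivity)
  have hε2 : ε ^ 2 ≤ 1 := pow_le_one₀ hε.le hε1
  have hpw : (q : ℝ) ^ ((3 / 4 : ℝ) * r) * G.omega S ≤ B := by
    rw [hB', le_div_iff₀ (by positivity)]
    exact mul_le_of_le_one_right (by positivity) hε2
  have hωB : (G.omega S : ℝ) ≤ B := (le_mul_of_one_le_left (by positivity) hp).trans hpw
  have hqB : (q : ℝ) ^ ((3 / 4 : ℝ) * r) ≤ B := (le_mul_of_one_le_right (by positivity) hω).trans hpw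
  have hB1 : 1 ≤ B := hω.trans hωB
  have hR := numRounds_le hω hωB
  have hK := keyLength_le hq hqB hB1
  have hH := halfRound_le hq hω hε hB' hB1
  set L := 1 + Real.log B with hL
  have hL1 : 1 ≤ L := by linarith [Real.log_nonneg hB1]
  change (numRounds (testError G S) : ℝ) ≤ 4 * L at hR
  change (halfRound q r (threshold G S ε) : ℝ) ≤ 16385 * B at hH
  set R := numRounds (testError G S)
  set h := halfRound q r (threshold G S ε)
  have hm : numSamples hellingerTest G q S ε = R * (h + h) := rfl
  have hBL : B * L ≤ B * L ^ 2 := by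
    refine mul_le_mul_of_nonneg_left ?_ (by linarith)
    nlinarith
  have hBL1 : B ≤ B * L := le_mul_of_one_le_right (by linarith) hL1
  have hm' : ((R * (h + h) : ℕ) : ℝ) ≤ 131080 * (B * L) := by
    push_cast
    have : (R : ℝ) * (h + h) ≤ 4 * L * (16385 * B + 16385 * B) := by gcongr
    linarith
  constructor
  · rw [hm]
    linarith
  · intro x y ρ
    have hsteps : (G.outcomeTargets S).sup (testSteps hellingerTest G S ε x y ρ) ≤
        1 + R * (7 + (h + h) * (27 + 5 * keyLength q r)) :=
      Finset.sup_le fun v _ => (test_eq v x y ρ).2.le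
    have hsteps' : ((1 + R * (7 + (h + h) * (27 + 5 * keyLength q r)) : ℕ) : ℝ) ≤
        5000000 * (B * L ^ 2) := by
      push_cast
      have h1 : (27 : ℝ) + 5 * keyLength q r ≤ 37 * L := by linarith
      -- The factors are at most 4L rounds, 2 · 16385B samples per round, and 27 + 5 · 2L ≤ 37L
      -- steps per sample; 7 ≤ 7BL covers the overhead of a round.
      have h2 : (R : ℝ) * (7 + (h + h) * (27 + 5 * keyLength q r)) ≤
          4 * L * (7 * (B * L) + (16385 * B + 16385 * B) * (37 * L)) := by
        gcongr
        linarith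
      have h3 : 4 * L * (7 * (B * L) + (16385 * B + 16385 * B) * (37 * L)) =
          4849988 * (B * L ^ 2) := by ring
      linarith
    have ht : time hellingerTest G S ε x y ρ ≤ 2 * (R * (h + h)) +
        (1 + R * (7 + (h + h) * (27 + 5 * keyLength q r))) + G.omega S := by
      rw [time, hm]
      exact Nat.add_le_add_right (Nat.add_le_add_left hsteps _) _
    have ht' : (time hellingerTest G S ε x y ρ : ℝ) ≤ 2 * ((R * (h + h) : ℕ) : ℝ) +
        ((1 + R * (7 + (h + h) * (27 + 5 * keyLength q r)) : ℕ) : ℝ) + G.omega S := by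
      exact_mod_cast ht
    linarith

end InfluenceTest

end

/-! ### The main theorem -/

theorem mainTheorem4 :
    ∃ (T : TwoSampleTest) (K : ℝ) (c : ℕ),
      ∀ (n k q : ℕ) (G : KPartiteDesign n k) (M : CausalModel G q)
        (S : Finset (Fin n × Fin n)) (ε B : ℝ),
        S ⊆ G.edges → 0 < ε → ε ≤ 1 →
        B = (q : ℝ) ^ ((3 / 4 : ℝ) * (G.maxOutcomeInDegree + 1)) * G.omega S / ε ^ 2 →
        -- sample complexity
        (InfluenceTest.numSamples T G q S ε : ℝ) ≤ K * B * (1 + Real.log B) ^ c ∧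
        -- running time, for every outcome of the samples and coins
        (∀ x y ρ, (InfluenceTest.time T G S ε (q := q) x y ρ : ℝ) ≤ K * B * (1 + Real.log B) ^ c) ∧
        -- each of the tests is a squared Hellinger test of its two hypotheses
        (∀ v ∈ G.outcomeTargets S,
          (marginalOn (G.family v) M.P = marginalOn (G.family v) (M.PS S) →
            sampleProb M.P (M.PS S) (fun x y ρ => InfluenceTest.testRejects T G S ε x y ρ v)
              ≤ 1 / (3 * G.omega S)) ∧
          (ε ^ 2 / (2 * G.omega S) ≤ phiDiv hellingerPhi (marginalOn (G.family v) M.P)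
              (marginalOn (G.family v) (M.PS S)) →
            sampleProb M.P (M.PS S) (fun x y ρ => !InfluenceTest.testRejects T G S ε x y ρ v)
              ≤ 1 / (3 * G.omega S))) ∧
        -- no causal influence: failure is returned
        (M.causalInfluence hellingerPhi S = 0 →
          2 / 3 ≤ sampleProb M.P (M.PS S) (fun x y ρ => !InfluenceTest.output T G S ε x y ρ)) ∧
        -- causal influence at least the threshold: success is returned
        ((∀ e ∈ S, G.IsOutcome e.2) → ε ≤ M.causalInfluence hellingerPhi S →
          2 / 3 ≤ sampleProb M.P (M.PS S) (fun x y ρ => InfluenceTest.output T G S ε x y ρ)) := by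
  refine ⟨hellingerTest, 10000000, 2, fun n k q G M S ε B _ hε hε1 hB => ?_⟩
  obtain ⟨h1, h2⟩ := InfluenceTest.complexity M hε hε1 hB
  refine ⟨h1, h2, fun v hv => ⟨InfluenceTest.testRejects_null M hv, fun hd => ?_⟩,
    InfluenceTest.output_null M, InfluenceTest.output_alternative M hε hε1⟩
  rw [InfluenceTest.phiDiv_family_eq M v] at hd
  exact InfluenceTest.testRejects_alternative M hε hv hd
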